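/- Let $d\ge 1$. An instance $\mathcal I$ of a CSP of arity $d$ has variables $x_1,\dots,x_n\in\{\pm1\}$ and constraints $C_1,\dots,C_m$, each consisting of $d$ variables (possibly repeated) and a predicate $P_i\subseteq\{\pm1\}^d$; predicates may differ between constraints. Let $n\ge 2$ be even. Write $\mathsf{val}_{\mathcal I}(\alpha)$ for the number of constraints satisfied by $\alpha\in\{\pm1\}^n$, and let $$OPT=\max_{\alpha:\ \sum_i\alpha_i=0}\mathsf{val}_{\mathcal I}(\alpha),\qquad AVG=\mathop{\mathbb E}_{\alpha:\ \sum_i\alpha_i=0}\big[\mathsf{val}_{\mathcal I}(\alpha)\big]$$ (uniform average) be the optimal and the average value under the bisection constraint $\sum_i x_i=0$. A *kernel* of $\mathcal I$ under the bisection constraint is a set $S$ of variables together with a multilinear polynomial $g$ of degree at most $d$ with rational coefficients, involving only variables in $S$, such that $g(\alpha)=\mathsf{val}_{\mathcal I}(\alpha)$ for every $\alpha\in\{\pm1\}^n$ with $\sum_i\alpha_i=0$. Put $$C_d=24\,d^2\cdot 7^d\cdot 9^d\cdot 2^{2d}\cdot\big(d!\,(d-1)!\cdots 2!\big)^2 .$$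 **Theorem.** There is an algorithm (a program of a unit-cost random access machine over the integers with addition and subtraction) which, given $d\ge1$, an instance $\mathcal I$ of a CSP of arity $d$ with $n$ variables ($n\ge 2$ even) and $m$ constraints, and an integer parameter $t$, either outputs a kernel of $\mathcal I$ under the bisection constraint on at most $C_d\,t^2$ variables (the set of variables and the list of the coefficients and monomials of the polynomial), or certifies that $OPT\ge AVG+t$, i.e. halts with this answer, and the answer is correct. Its running time is at most $K_d\,(m+n^{cd})$, where $c$ is an absolute constant and $K_d$ depends only on $d$; in particular it is $n^{O(d)}$ for every fixed $d$ when $m=n^{O(d)}$. -/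

import Mathlib

/-! ## Boolean constraint satisfaction problems under the bisection constraint -/

/-- A constraint on `n` variables with values in `{-1, 1}`: the `d` variables it reads and the
predicate, a set of patterns in `{-1, 1}^d`. Variables may be repeated, so constraints on fewer
than `d` variables are included. -/
structure Constraint (d n : ℕ) where
  scope : Fin d → Fin n
  pred : Finset (Fin d → ℤˣ)

/-- An instance, of arity `d`, with variables `x_0, …, x_{n-1}`. -/
structure CSP (d n : ℕ) where
  constraints : List (Constraint d n)

/-- The number of constraints. -/
def CSP.size {d n : ℕ} (I : CSP d n) : ℕ := I.constraints.length

/-- The number of constraints that the assignment `x` satisfies. -/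
def CSP.val {d n : ℕ} (I : CSP d n) (x : Fin n → ℤˣ) : ℕ :=
  I.constraints.countP fun C => decide ((fun j => x (C.scope j)) ∈ C.pred)

/-- The assignments with `∑ i, x i = 0`. -/
def bisections (n : ℕ) : Finset (Fin n → ℤˣ) :=
  Finset.univ.filter fun x => ∑ i, (x i : ℤ) = 0

/-- The largest value of a bisection. -/
def CSP.opt {d n : ℕ} (I : CSP d n) : ℕ := (bisections n).sup I.val

/-- The expected value of a uniformly random bisection. -/
def CSP.avg {d n : ℕ} (I : CSP d n) : ℚ :=
  (∑ x ∈ bisections n, (I.val x : ℚ)) / (bisections n).card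

/-! ## Kernels -/

/-- A list of variables together with an explicit polynomial `(∑ a_l ∏_{i ∈ l} x_i) / denom`,
given by the list of its coefficients `a_l` and monomials `l`. -/
structure Kernel (n : ℕ) where
  vars : List (Fin n)
  denom : ℕ
  terms : List (ℤ × List (Fin n))

/-- The value of the polynomial at `x`. -/
def Kernel.eval {n : ℕ} (κ : Kernel n) (x : Fin n → ℤˣ) : ℚ :=
  (κ.terms.map fun p => (p.1 : ℚ) * (p.2.map fun i => ((x i : ℤ) : ℚ)).prod).sum / κ.denom

/-- `κ` is a kernel of `I` under the bisection constraint: its polynomial is multilinear of degree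
at most `d`, with no monomial listed twice, involves only the variables in `κ.vars`, and agrees on
every bisection with the number of satisfied constraints. -/
structure Kernel.IsKernelOf {d n : ℕ} (κ : Kernel n) (I : CSP d n) : Prop where
  denom_pos : 0 < κ.denom
  increasing : ∀ p ∈ κ.terms, p.2.Pairwise (· < ·)
  distinct : (κ.terms.map Prod.snd).Nodup
  degree_le : ∀ p ∈ κ.terms, p.2.length ≤ d
  support : ∀ p ∈ κ.terms, ∀ i ∈ p.2, i ∈ κ.vars
  agree : ∀ x ∈ bisections n, κ.eval x = I.val x

/-- `24 d² · 7^d · 9^d · 2^{2d} · (d! (d-1)! ⋯ 2!)²`. -/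
def kernelConst (d : ℕ) : ℕ :=
  24 * d ^ 2 * 7 ^ d * 9 ^ d * 2 ^ (2 * d) * (∏ k ∈ Finset.Icc 2 d, k.factorial) ^ 2

/-! ## A random access machine with a step count -/

/-- Programs of a random access machine. Registers are numbered by `ℕ` and memory cells by `ℤ`;
both hold integers. A program mentions finitely many registers and reaches the memory by indirect
addressing only. The arithmetic instructions are addition and subtraction (no multiplication, so
that unit cost is a realistic measure: each step lengthens the numbers by at most one bit). -/
inductive Prog : Type
  | const (r : ℕ) (z : ℤ)
  | add (r a b : ℕ)
  | sub (r a b : ℕ)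
  | load (r a : ℕ)
  | store (a b : ℕ)
  | seq (P Q : Prog)
  | ite (r : ℕ) (P Q : Prog)
  | loop (r : ℕ) (P : Prog)

/-- The contents of the registers and of the memory. -/
structure RamState where
  reg : ℕ → ℤ
  mem : ℤ → ℤ

/-- Write `z` into register `r`. -/
def RamState.setReg (s : RamState) (r : ℕ) (z : ℤ) : RamState :=
  { s with reg := Function.update s.reg r z }

/-- Write `z` into memory cell `a`. -/
def RamState.setMem (s : RamState) (a z : ℤ) : RamState :=
  { s with mem := Function.update s.mem a z }

/-- `Exec P s T s'`: started in state `s`, the program `P` halts after exactly `T` steps, in state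
`s'`. Every instruction and every evaluation of a test is one step. -/
inductive Exec : Prog → RamState → ℕ → RamState → Prop
  | const (s : RamState) (r : ℕ) (z : ℤ) : Exec (.const r z) s 1 (s.setReg r z)
  | add (s : RamState) (r a b : ℕ) : Exec (.add r a b) s 1 (s.setReg r (s.reg a + s.reg b))
  | sub (s : RamState) (r a b : ℕ) : Exec (.sub r a b) s 1 (s.setReg r (s.reg a - s.reg b))
  | load (s : RamState) (r a : ℕ) : Exec (.load r a) s 1 (s.setReg r (s.mem (s.reg a)))
  | store (s : RamState) (a b : ℕ) : Exec (.store a b) s 1 (s.setMem (s.reg a) (s.reg b))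
  | seq {P Q : Prog} {s s' s'' : RamState} {T T' : ℕ} :
      Exec P s T s' → Exec Q s' T' s'' → Exec (.seq P Q) s (T + T') s''
  | ite_pos {r : ℕ} {P Q : Prog} {s s' : RamState} {T : ℕ} :
      0 < s.reg r → Exec P s T s' → Exec (.ite r P Q) s (T + 1) s'
  | ite_neg {r : ℕ} {P Q : Prog} {s s' : RamState} {T : ℕ} :
      s.reg r ≤ 0 → Exec Q s T s' → Exec (.ite r P Q) s (T + 1) s'
  | loop_stop {r : ℕ} {P : Prog} {s : RamState} :
      s.reg r ≤ 0 → Exec (.loop r P) s 1 s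
  | loop_step {r : ℕ} {P : Prog} {s s' s'' : RamState} {T T' : ℕ} :
      0 < s.reg r → Exec P s T s' → Exec (.loop r P) s' T' s'' →
        Exec (.loop r P) s (T + 1 + T') s''

/-- The initial state: the input is stored from address `0` on, everything else is `0`. -/
def RamState.init (w : List ℤ) : RamState where
  reg := fun _ => 0
  mem := fun a => if 0 ≤ a then w.getD a.toNat 0 else 0

/-- The output `w` is stored from the address in register `0` on. -/
def RamState.Shows (s : RamState) (w : List ℤ) : Prop :=
  ∀ (i : ℕ) (h : i < w.length), s.mem (s.reg 0 + i) = w[i]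

/-! ## Input and output format -/

/-- The pattern in `{-1, 1}^d` whose `j`-th entry is `-1` if and only if bit `j` of `b` is set. -/
def pattern (d b : ℕ) : Fin d → ℤˣ := fun j => if b.testBit j then -1 else 1

/-- A constraint is written as its `d` variables followed by its truth table of `2 ^ d` bits. -/
def Constraint.encode {d n : ℕ} (C : Constraint d n) : List ℤ :=
  List.ofFn (fun j => ((C.scope j : ℕ) : ℤ)) ++
    (List.range (2 ^ d)).map fun b => if pattern d b ∈ C.pred then 1 else 0

/-- An instance and the parameter: `d`, `n`, the number of constraints, `t`, the constraints. -/
def CSP.encode {d n : ℕ} (I : CSP d n) (t : ℤ) : List ℤ :=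
  [(d : ℤ), (n : ℤ), (I.size : ℤ), t] ++ I.constraints.flatMap Constraint.encode

/-- A list of variables is written as its length followed by its entries. -/
def encodeVars {n : ℕ} (l : List (Fin n)) : List ℤ :=
  (l.length : ℤ) :: l.map fun i => ((i : ℕ) : ℤ)

/-- A kernel: its variables, the denominator, the number of terms, and for each term the
coefficient and the monomial. -/
def Kernel.encode {n : ℕ} (κ : Kernel n) : List ℤ :=
  encodeVars κ.vars ++ [(κ.denom : ℤ), (κ.terms.length : ℤ)] ++
    κ.terms.flatMap fun p => p.1 :: encodeVars p.2

/-! ## Functions of low degree on sets of coordinates -/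

/-! Identify an assignment with the set `X` on which it is `-1`. The number of satisfied constraints
is then a sum of functions of at most `d` coordinates ("degree `d`"), and the bisections are the
middle slice `X.card = n / 2`. Call two variables interchangeable if exchanging them changes the
value of no bisection. The theorem is a dichotomy on the number of disjoint pairs that are not
interchangeable.

Few pairs. A maximal family of disjoint non-interchangeable pairs covers a set `S` outside which all
variables are interchangeable. If `S` has at most `n / 2` elements, the value of a bisection `X` is
a function `F (X ∩ S)`, and alternating sums of `F` of order above `d` vanish: inside the slice one
finds cubes whose directions exchange an element of `S` with a partner outside
(`sum_extension_eq_zero`). Möbius inversion then writes `F` as a polynomial of degree at most `d`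
with denominator `2 ^ d` (`CSP.isJunta_of_forall`, `CSP.sum_coef_mul`).

Many pairs. With `q = 4 d 144^d τ²` disjoint pairs, the maximum exceeds the mean by `τ`
(`exists_average_add_le`). From each bisection the exchanges of these pairs span a cube of
bisections, on which the value has degree `d`. A pair that matters at all matters at a fraction of
at least `2 / 4^d` of the bisections (`two_mul_card_le_card_swapAt_ne`), and values are integers, so
the total influence on these cubes is large on average. Influence is at most a multiple of the
variance (`total_influence_le`), the variance is controlled by the first absolute moment through
hypercontractivity (`two_pow_mul_sum_sq_le`), and the mean absolute deviation is at most twice the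
distance from mean to maximum (`sum_abs_sub_le`).

Algorithm. A function of degree `d` on a slice that vanishes on a ball of radius `d` vanishes
(`eq_zero_of_eq_zero_on_ball`), so interchangeability need only be tested near one fixed bisection,
which takes `n^{O(d)}` evaluations. One scan over all ordered pairs marks a maximal family greedily.
If `n ≤ 4 q`, all variables are kept; otherwise at least `2 q` marked variables certify a large
optimum, and fewer of them form a kernel.

Machine. The algorithm is written in a small language whose expressions use bounded sums, compiled
to the random access machine with a proof of correctness and a time bound. The constraints are read
once, into a table indexed by tuples of `d` literals; afterwards nothing depends on `m`. Input and
output use the nonnegative addresses, the tables the negative ones. -/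

/-- The sums of functions that depend on at most `d` coordinates each. -/
def lowDegree (ι M : Type*) [DecidableEq ι] [AddCommGroup M] (d : ℕ) : AddSubgroup (Finset ι → M) :=
  AddSubgroup.closure {φ | ∃ T : Finset ι, T.card ≤ d ∧ ∀ X Y, X ∩ T = Y ∩ T → φ X = φ Y}

section LowDegree

variable {ι κ M : Type*} [DecidableEq ι] [DecidableEq κ] [AddCommGroup M] {d : ℕ} {f : Finset ι → M}

theorem mem_lowDegree_of_dependsOn (T : Finset ι) (hT : T.card ≤ d)
    (h : ∀ X Y, X ∩ T = Y ∩ T → f X = f Y) : f ∈ lowDegree ι M d :=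
  AddSubgroup.subset_closure ⟨T, hT, h⟩

theorem const_mem_lowDegree (d : ℕ) (c : M) : (fun _ => c) ∈ lowDegree ι M d :=
  mem_lowDegree_of_dependsOn ∅ (by simp) (by simp)

theorem lowDegree_zero_const (hf : f ∈ lowDegree ι M 0) (X Y : Finset ι) : f X = f Y := by
  induction hf using AddSubgroup.closure_induction with
  | mem φ h =>
    obtain ⟨T, hT, h⟩ := h
    obtain rfl : T = ∅ := by simpa using hT
    exact h _ _ (by simp)
  | zero => rfl
  | add φ ψ _ _ h1 h2 => simp [h1, h2]
  | neg φ _ h => simp [h]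

/-- If the trace of `Φ Z` on `T` is determined by at most `T.card` coordinates of `Z`, a generator
supported on `T` pulls back to a generator. All changes of variables below (exchanges of pairs,
cubes inside a slice) are instances. -/
theorem lowDegree_comp (hf : f ∈ lowDegree ι M d) (Φ : Finset κ → Finset ι)
    (hΦ : ∀ T : Finset ι, ∃ T' : Finset κ, T'.card ≤ T.card ∧
      ∀ Z Z', Z ∩ T' = Z' ∩ T' → Φ Z ∩ T = Φ Z' ∩ T) :
    (fun Z => f (Φ Z)) ∈ lowDegree κ M d := by
  induction hf using AddSubgroup.closure_induction with
  | mem φ h =>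
    obtain ⟨T, hT, h⟩ := h
    obtain ⟨T', hT', h'⟩ := hΦ T
    exact mem_lowDegree_of_dependsOn T' (hT'.trans hT) fun Z Z' e => h _ _ (h' _ _ e)
  | zero => exact zero_mem _
  | add φ ψ _ _ h1 h2 => exact add_mem h1 h2
  | neg φ _ h => exact neg_mem h

/-- A discrete derivative lowers the degree: a generator supported on `T` either does not see the
difference between `Φ` and `Ψ` and cancels, or both substitutions leave it a smaller support. -/
theorem lowDegree_sub_comp (hf : f ∈ lowDegree ι M (d + 1)) (Φ Ψ : Finset κ → Finset ι)
    (h : ∀ T : Finset ι, (∀ Z, Φ Z ∩ T = Ψ Z ∩ T) ∨ ∃ T' : Finset κ, T'.card + 1 ≤ T.card ∧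
      ∀ Z Z', Z ∩ T' = Z' ∩ T' → Φ Z ∩ T = Φ Z' ∩ T ∧ Ψ Z ∩ T = Ψ Z' ∩ T) :
    (fun Z => f (Φ Z) - f (Ψ Z)) ∈ lowDegree κ M d := by
  induction hf using AddSubgroup.closure_induction with
  | mem φ hφ =>
    obtain ⟨T, hT, hφ⟩ := hφ
    rcases h T with h | ⟨T', hT', h'⟩
    · have : (fun Z => φ (Φ Z) - φ (Ψ Z)) = fun _ => 0 := by
        funext Z
        rw [hφ _ _ (h Z), sub_self]
      rw [this]
      exact zero_mem _
    · refine mem_lowDegree_of_dependsOn T' (by omega) fun Z Z' e => ?_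
      rw [hφ _ _ (h' _ _ e).1, hφ _ _ (h' _ _ e).2]
  | zero => simpa using const_mem_lowDegree d (0 : M)
  | add φ ψ _ _ h1 h2 =>
    convert add_mem h1 h2 using 1
    funext Z
    simp only [Pi.add_apply]
    abel
  | neg φ _ h1 =>
    convert neg_mem h1 using 1
    funext Z
    simp only [Pi.neg_apply]
    abel

theorem inter_eq_inter_iff {X Y T : Finset ι} : X ∩ T = Y ∩ T ↔ ∀ i ∈ T, i ∈ X ↔ i ∈ Y := by
  constructor
  · intro h i hi
    have := congrArg (i ∈ ·) h
    simpa [hi] using this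
  · intro h
    ext i
    by_cases hi : i ∈ T <;> simp [hi, h i]

/-- A generator with support `T` misses some `a ∈ s`, so the terms of `Z` and `insert a Z` cancel.
-/
theorem sum_powerset_neg_one_pow_eq_zero [Module ℚ M] (hf : f ∈ lowDegree ι M d) {s : Finset ι}
    (hs : d < s.card) : ∑ Z ∈ s.powerset, (-1 : ℚ) ^ Z.card • f Z = 0 := by
  induction hf using AddSubgroup.closure_induction with
  | mem φ h =>
    obtain ⟨T, hT, h⟩ := h
    obtain ⟨a, has, haT⟩ : ∃ a ∈ s, a ∉ T := by
      by_contra! hc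
      exact absurd (Finset.card_le_card hc) (by omega)
    rw [← Finset.insert_erase has, Finset.sum_powerset_insert (Finset.notMem_erase a s),
      ← Finset.sum_add_distrib]
    refine Finset.sum_eq_zero fun Z hZ => ?_
    have haZ : a ∉ Z := fun hh => Finset.notMem_erase a s (Finset.mem_powerset.1 hZ hh)
    rw [h (insert a Z) Z (by rw [Finset.insert_inter_of_notMem haT]), Finset.card_insert_of_notMem haZ,
      pow_succ, mul_neg_one, neg_smul, add_neg_cancel]
  | zero => simp
  | add φ ψ _ _ h1 h2 => simp [smul_add, Finset.sum_add_distrib, h1, h2]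
  | neg φ _ h => simp [h]

end LowDegree

/-! ## Moments of functions of low degree on the discrete cube -/

section Cube

variable {ι : Type*} [DecidableEq ι] {d : ℕ} {G : Finset ι → ℚ} {a : ι} {s : Finset ι}

/-- The average over the coordinate `a`. -/
def evenPart (a : ι) (G : Finset ι → ℚ) : Finset ι → ℚ := fun Z => (G (Z.erase a) + G (insert a Z)) / 2

/-- Half the difference in direction `a`. -/
def oddPart (a : ι) (G : Finset ι → ℚ) : Finset ι → ℚ := fun Z => (G (Z.erase a) - G (insert a Z)) / 2

theorem smul_mem_lowDegree (hG : G ∈ lowDegree ι ℚ d) (c : ℚ) :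
    (fun Z => c * G Z) ∈ lowDegree ι ℚ d := by
  induction hG using AddSubgroup.closure_induction with
  | mem φ h =>
    obtain ⟨T, hT, h⟩ := h
    exact mem_lowDegree_of_dependsOn T hT fun X Y e => by rw [h X Y e]
  | zero => simpa using const_mem_lowDegree d (0 : ℚ)
  | add φ ψ _ _ h1 h2 =>
    convert add_mem h1 h2 using 1
    funext Z
    simp [mul_add]
  | neg φ _ h1 =>
    convert neg_mem h1 using 1
    funext Z
    simp

theorem evenPart_mem_lowDegree (hG : G ∈ lowDegree ι ℚ d) : evenPart a G ∈ lowDegree ι ℚ d := by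
  have h1 : (fun Z => G (Finset.erase Z a)) ∈ lowDegree ι ℚ d :=
    lowDegree_comp hG _ fun T => ⟨T, le_rfl, fun Z Z' e => by
      rw [inter_eq_inter_iff] at e ⊢
      intro i hi
      simp [e i hi]⟩
  have h2 : (fun Z => G (insert a Z)) ∈ lowDegree ι ℚ d :=
    lowDegree_comp hG _ fun T => ⟨T, le_rfl, fun Z Z' e => by
      rw [inter_eq_inter_iff] at e ⊢
      intro i hi
      simp [e i hi]⟩
  convert smul_mem_lowDegree (add_mem h1 h2) (1 / 2) using 1
  funext Z
  simp [evenPart]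
  ring

theorem oddPart_mem_lowDegree (hG : G ∈ lowDegree ι ℚ (d + 1)) : oddPart a G ∈ lowDegree ι ℚ d := by
  have h : (fun Z => G (Finset.erase Z a) - G (insert a Z)) ∈ lowDegree ι ℚ d := by
    refine lowDegree_sub_comp hG _ _ fun T => ?_
    by_cases ha : a ∈ T
    · refine Or.inr ⟨T.erase a, (Finset.card_erase_add_one ha).le, fun Z Z' e => ?_⟩
      simp only [inter_eq_inter_iff] at e ⊢
      constructor <;> intro i hi <;> by_cases hia : i = a <;> simp [hia, e i, hi]
    · refine Or.inl fun Z => ?_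
      rw [inter_eq_inter_iff]
      intro i hi
      have : i ≠ a := fun h => ha (h ▸ hi)
      simp [this]
  convert smul_mem_lowDegree h (1 / 2) using 1
  funext Z
  simp [oddPart]
  ring

theorem apply_eq_evenPart_add_oddPart (G : Finset ι → ℚ) {Z : Finset ι} (ha : a ∉ Z) :
    G Z = evenPart a G Z + oddPart a G Z := by
  simp only [evenPart, oddPart, Finset.erase_eq_of_notMem ha]
  ring

theorem apply_insert_eq_evenPart_sub_oddPart (G : Finset ι → ℚ) (a : ι) (Z : Finset ι) :
    G (insert a Z) = evenPart a G Z - oddPart a G Z := by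
  simp only [evenPart, oddPart]
  ring

/-- As a function of the sign of coordinate `a`, `G` is `A ± B` with `A` and `B` independent of `a`,
and `B` of degree one less. This splitting drives both inductions on the dimension of the cube that
follow. -/
theorem sum_powerset_insert_eq {R : Type*} [AddCommMonoid R] (ha : a ∉ s) (F : Finset ι → ℚ → R) :
    ∑ Z ∈ (insert a s).powerset, F Z (G Z) =
      ∑ Z ∈ s.powerset, (F Z (evenPart a G Z + oddPart a G Z) +
        F (insert a Z) (evenPart a G Z - oddPart a G Z)) := by
  rw [Finset.sum_powerset_insert ha, ← Finset.sum_add_distrib]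
  refine Finset.sum_congr rfl fun Z hZ => ?_
  rw [apply_insert_eq_evenPart_sub_oddPart G a,
    ← apply_eq_evenPart_add_oddPart G fun h => ha (Finset.mem_powerset.1 hZ h)]

/-- Hypercontractivity on the discrete cube: the fourth moment of a function of degree `d`. -/
theorem two_pow_mul_sum_pow_four_le (s : Finset ι) (d : ℕ) (G : Finset ι → ℚ)
    (hG : G ∈ lowDegree ι ℚ d) :
    2 ^ s.card * ∑ Z ∈ s.powerset, G Z ^ 4 ≤ 9 ^ d * (∑ Z ∈ s.powerset, G Z ^ 2) ^ 2 := by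
  induction s using Finset.induction_on generalizing d G with
  | empty =>
    simp only [Finset.card_empty, pow_zero, Finset.powerset_empty, Finset.sum_singleton, one_mul]
    have : (1 : ℚ) ≤ 9 ^ d := one_le_pow₀ (by norm_num)
    nlinarith [sq_nonneg (G ∅ ^ 2)]
  | insert a s ha ih =>
    rcases d with _ | d
    · have hc : ∀ Z, G Z = G ∅ := fun Z => lowDegree_zero_const hG _ _
      simp only [hc, Finset.sum_const, Finset.card_powerset, nsmul_eq_mul]
      push_cast
      apply le_of_eq
      ring
    · rw [sum_powerset_insert_eq ha fun _ x => x ^ 4, sum_powerset_insert_eq ha fun _ x => x ^ 2]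
      have hA := ih _ _ (evenPart_mem_lowDegree (a := a) hG)
      have hB := ih _ _ (oddPart_mem_lowDegree (a := a) hG)
      set A := evenPart a G
      set B := oddPart a G
      set α4 := ∑ Z ∈ s.powerset, A Z ^ 4
      set β4 := ∑ Z ∈ s.powerset, B Z ^ 4
      set α2 := ∑ Z ∈ s.powerset, A Z ^ 2
      set β2 := ∑ Z ∈ s.powerset, B Z ^ 2
      set γ := ∑ Z ∈ s.powerset, A Z ^ 2 * B Z ^ 2
      have h4 : ∑ Z ∈ s.powerset, ((A Z + B Z) ^ 4 + (A Z - B Z) ^ 4) = 2 * (α4 + 6 * γ + β4) := by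
        simp only [α4, β4, γ, Finset.mul_sum, ← Finset.sum_add_distrib]
        exact Finset.sum_congr rfl fun _ _ => by ring
      have h2 : ∑ Z ∈ s.powerset, ((A Z + B Z) ^ 2 + (A Z - B Z) ^ 2) = 2 * (α2 + β2) := by
        simp only [α2, β2, Finset.mul_sum, ← Finset.sum_add_distrib]
        exact Finset.sum_congr rfl fun _ _ => by ring
      have hγ : γ ^ 2 ≤ α4 * β4 := by
        refine Finset.sum_sq_le_sum_mul_sum_of_sq_le_mul _ (fun _ _ => by positivity) (fun _ _ => by positivity)
          fun _ _ => le_of_eq (by ring)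
      have hα2 : 0 ≤ α2 := Finset.sum_nonneg fun _ _ => sq_nonneg _
      have hβ2 : 0 ≤ β2 := Finset.sum_nonneg fun _ _ => sq_nonneg _
      have hβ4 : 0 ≤ β4 := Finset.sum_nonneg fun _ _ => by positivity
      -- Cauchy–Schwarz for the mixed term. The odd part has degree `d`, so the factors `9 ^ (d +
      -- 1)` and `9 ^ d` have geometric mean `3 * 9 ^ d`, and `6 * 3 * 9 ^ d = 2 * 9 ^ (d + 1)` is
      -- the mixed term of the square to be reached.
      have hγ' : 2 ^ s.card * γ ≤ 3 * 9 ^ d * (α2 * β2) := by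
        refine abs_le_of_sq_le_sq' ?_ (by positivity) |>.2
        calc (2 ^ s.card * γ) ^ 2 = (2 ^ s.card) ^ 2 * γ ^ 2 := by ring
          _ ≤ (2 ^ s.card) ^ 2 * (α4 * β4) := by gcongr
          _ = (2 ^ s.card * α4) * (2 ^ s.card * β4) := by ring
          _ ≤ (9 ^ (d + 1) * α2 ^ 2) * (9 ^ d * β2 ^ 2) := by gcongr
          _ = (3 * 9 ^ d * (α2 * β2)) ^ 2 := by ring
      rw [h4, h2, Finset.card_insert_of_notMem ha, pow_succ]
      rw [pow_succ] at hA ⊢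
      have : 0 ≤ (9 : ℚ) ^ d * β2 ^ 2 := by positivity
      nlinarith [this, hA, hB, hγ']

/-- The total influence of a function of degree `d` is at most `d` times its variance. -/
theorem total_influence_le (s : Finset ι) (d : ℕ) (G : Finset ι → ℚ) (hG : G ∈ lowDegree ι ℚ d) :
    2 ^ s.card * ∑ i ∈ s, ∑ Z ∈ s.powerset, (G (insert i Z) - G (Z.erase i)) ^ 2 ≤
      4 * d * (2 ^ s.card * ∑ Z ∈ s.powerset, G Z ^ 2 - (∑ Z ∈ s.powerset, G Z) ^ 2) := by
  induction s using Finset.induction_on generalizing d G with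
  | empty => simp
  | insert a s ha ih =>
    rcases d with _ | d
    · have hc : ∀ Z, G Z = G ∅ := fun Z => lowDegree_zero_const hG _ _
      simp [hc]
    · have hA := ih _ _ (evenPart_mem_lowDegree (a := a) hG)
      have hB := ih _ _ (oddPart_mem_lowDegree (a := a) hG)
      have hns : ∀ Z ∈ s.powerset, a ∉ Z := fun Z hZ h => ha (Finset.mem_powerset.1 hZ h)
      have h2 : ∑ Z ∈ (insert a s).powerset, G Z ^ 2 =
          2 * (∑ Z ∈ s.powerset, evenPart a G Z ^ 2 + ∑ Z ∈ s.powerset, oddPart a G Z ^ 2) := by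
        rw [sum_powerset_insert_eq ha fun _ x => x ^ 2, ← Finset.sum_add_distrib, Finset.mul_sum]
        exact Finset.sum_congr rfl fun _ _ => by ring
      have h1 : ∑ Z ∈ (insert a s).powerset, G Z = 2 * ∑ Z ∈ s.powerset, evenPart a G Z := by
        rw [sum_powerset_insert_eq ha fun _ x => x, Finset.mul_sum]
        exact Finset.sum_congr rfl fun _ _ => by ring
      have ha' : ∑ Z ∈ (insert a s).powerset, (G (insert a Z) - G (Z.erase a)) ^ 2 =
          8 * ∑ Z ∈ s.powerset, oddPart a G Z ^ 2 := by
        rw [Finset.sum_powerset_insert ha, ← Finset.sum_add_distrib, Finset.mul_sum]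
        refine Finset.sum_congr rfl fun Z hZ => ?_
        simp only [oddPart, Finset.insert_idem, Finset.erase_insert (hns Z hZ),
          Finset.erase_eq_of_notMem (hns Z hZ)]
        ring
      have hi : ∀ i ∈ s, ∑ Z ∈ (insert a s).powerset, (G (insert i Z) - G (Z.erase i)) ^ 2 =
          2 * (∑ Z ∈ s.powerset, (evenPart a G (insert i Z) - evenPart a G (Z.erase i)) ^ 2 +
            ∑ Z ∈ s.powerset, (oddPart a G (insert i Z) - oddPart a G (Z.erase i)) ^ 2) := by
        intro i his
        have hia : i ≠ a := fun h => ha (h ▸ his)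
        rw [Finset.sum_powerset_insert ha, ← Finset.sum_add_distrib, ← Finset.sum_add_distrib,
          Finset.mul_sum]
        refine Finset.sum_congr rfl fun Z hZ => ?_
        have e1 : a ∉ insert i Z := by simp [hia.symm, hns Z hZ]
        have e2 : a ∉ Z.erase i := by simp [hns Z hZ]
        rw [Finset.insert_comm, Finset.erase_insert_of_ne hia.symm,
          apply_insert_eq_evenPart_sub_oddPart G a, apply_insert_eq_evenPart_sub_oddPart G a,
          apply_eq_evenPart_add_oddPart G e1, apply_eq_evenPart_add_oddPart G e2]
        ring
      rw [Finset.sum_insert ha, ha', Finset.sum_congr rfl hi, ← Finset.mul_sum,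
        Finset.sum_add_distrib, h1, h2, Finset.card_insert_of_notMem ha]
      -- The influence of `a` raises the factor `4 * d` of the odd part to `4 * (d + 1)`. The
      -- squared sum of the odd part enters with a favourable sign and is dropped.
      have hsq : 0 ≤ (d : ℚ) * (∑ Z ∈ s.powerset, oddPart a G Z) ^ 2 := by positivity
      push_cast at hA ⊢
      rw [pow_succ]
      nlinarith [hA, hB, hsq]

/-- A function of degree `d` with mean zero: the second moment is bounded by the first one. -/
theorem two_pow_mul_sum_sq_le (s : Finset ι) (d : ℕ) (G : Finset ι → ℚ)
    (hG : G ∈ lowDegree ι ℚ d) :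
    2 ^ s.card * ∑ Z ∈ s.powerset, G Z ^ 2 ≤ 9 ^ d * (∑ Z ∈ s.powerset, |G Z|) ^ 2 := by
  have h4 := two_pow_mul_sum_pow_four_le s d G hG
  set m1 := ∑ Z ∈ s.powerset, |G Z|
  set m2 := ∑ Z ∈ s.powerset, G Z ^ 2
  set m3 := ∑ Z ∈ s.powerset, |G Z| ^ 3
  set m4 := ∑ Z ∈ s.powerset, G Z ^ 4
  have c1 : m2 ^ 2 ≤ m1 * m3 := by
    refine Finset.sum_sq_le_sum_mul_sum_of_sq_le_mul _ (fun _ _ => abs_nonneg _)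
      (fun _ _ => by positivity) fun Z _ => le_of_eq ?_
    rw [← sq_abs (G Z)]
    ring
  have c2 : m3 ^ 2 ≤ m2 * m4 := by
    refine Finset.sum_sq_le_sum_mul_sum_of_sq_le_mul _ (fun _ _ => sq_nonneg _)
      (fun _ _ => by positivity) fun Z _ => le_of_eq ?_
    rw [← pow_mul, mul_comm, pow_mul, sq_abs]
    ring
  have n1 : 0 ≤ m1 := Finset.sum_nonneg fun _ _ => abs_nonneg _
  have n2 : 0 ≤ m2 := Finset.sum_nonneg fun _ _ => sq_nonneg _
  rcases n2.eq_or_lt with h0 | h0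
  · rw [← h0, mul_zero]
    positivity
  -- Hölder's inequality, through the third moment: `m2 ^ 4 ≤ m1 ^ 2 * m3 ^ 2 ≤ m1 ^ 2 * m2 * m4`.
  have key : m2 ^ 3 ≤ m1 ^ 2 * m4 := by
    have : m2 * m2 ^ 3 ≤ m2 * (m1 ^ 2 * m4) := by
      calc m2 * m2 ^ 3 = (m2 ^ 2) ^ 2 := by ring
        _ ≤ (m1 * m3) ^ 2 := by gcongr
        _ = m1 ^ 2 * m3 ^ 2 := by ring
        _ ≤ m1 ^ 2 * (m2 * m4) := by gcongr
        _ = m2 * (m1 ^ 2 * m4) := by ring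
    exact le_of_mul_le_mul_left this h0
  have : m2 ^ 2 * (2 ^ s.card * m2) ≤ m2 ^ 2 * (9 ^ d * m1 ^ 2) := by
    calc m2 ^ 2 * (2 ^ s.card * m2) = 2 ^ s.card * m2 ^ 3 := by ring
      _ ≤ 2 ^ s.card * (m1 ^ 2 * m4) := by gcongr
      _ = m1 ^ 2 * (2 ^ s.card * m4) := by ring
      _ ≤ m1 ^ 2 * (9 ^ d * m2 ^ 2) := by gcongr
      _ = m2 ^ 2 * (9 ^ d * m1 ^ 2) := by ring
  exact le_of_mul_le_mul_left this (by positivity)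

end Cube

/-! ## Functions of low degree on a slice of the cube -/

section Slice

variable {ι : Type*} [DecidableEq ι]

/-- A function on the `m`-subsets of `B` that is invariant under exchanges is constant. -/
theorem eq_of_exchange_invariant {α : Type*} {F : Finset ι → α} {B : Finset ι} {m : ℕ}
    (hF : ∀ X ∈ B.powersetCard m, ∀ a ∈ X, ∀ b ∈ B, b ∉ X → F X = F (insert b (X.erase a)))
    {X Y : Finset ι} (hX : X ∈ B.powersetCard m) (hY : Y ∈ B.powersetCard m) : F X = F Y := by
  obtain ⟨hYB, hYm⟩ := Finset.mem_powersetCard.1 hY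
  induction hk : (X \ Y).card using Nat.strong_induction_on generalizing X with
  | _ k ih =>
    obtain ⟨hXB, hXm⟩ := Finset.mem_powersetCard.1 hX
    rcases (X \ Y).eq_empty_or_nonempty with he | ⟨a, ha⟩
    · rw [Finset.eq_of_subset_of_card_le (Finset.sdiff_eq_empty_iff_subset.1 he) (by omega)]
    · have hYX : (Y \ X).Nonempty := by
        rw [← Finset.card_pos, ← Finset.card_sdiff_comm (hXm.trans hYm.symm)]
        exact Finset.card_pos.2 ⟨a, ha⟩
      obtain ⟨b, hb⟩ := hYX
      rw [Finset.mem_sdiff] at ha hb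
      rw [hF X hX a ha.1 b (hYB hb.1) hb.2]
      refine ih ((insert b (X.erase a) \ Y).card) ?_ ?_ rfl
      · rw [← hk]
        refine Finset.card_lt_card (Finset.ssubset_iff_subset_ne.2 ⟨fun i => ?_, fun h => ?_⟩)
        · simp only [Finset.mem_sdiff, Finset.mem_insert, Finset.mem_erase]
          rintro ⟨rfl | h, h'⟩
          · exact absurd hb.1 h'
          · exact ⟨h.2, h'⟩
        · have := h.symm ▸ Finset.mem_sdiff.2 ha
          simp only [Finset.mem_sdiff, Finset.mem_insert, Finset.mem_erase] at this
          rcases this.1 with rfl | h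
          · exact ha.2 hb.1
          · exact h.1 rfl
      · rw [Finset.mem_powersetCard]
        refine ⟨Finset.insert_subset (hYB hb.1) ((Finset.erase_subset _ _).trans hXB), ?_⟩
        rw [Finset.card_insert_of_notMem (fun h => hb.2 (Finset.mem_of_mem_erase h)),
          Finset.card_erase_add_one ha.1, hXm]

/-- A generator that reads neither `a` nor `b` cancels; any other loses at least one coordinate once
`a` and `b` are fixed. -/
theorem exchange_mem_lowDegree {d : ℕ} {f : Finset ι → ℚ} (hf : f ∈ lowDegree ι ℚ (d + 1)) (a b : ι) :
    (fun Y : Finset ι => f (insert a ((Y.erase a).erase b)) - f (insert b ((Y.erase a).erase b))) ∈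
      lowDegree ι ℚ d := by
  refine lowDegree_sub_comp hf _ _ fun T => ?_
  by_cases h : a ∉ T ∧ b ∉ T
  · refine Or.inl fun Z => inter_eq_inter_iff.2 fun i hi => ?_
    have h1 : i ≠ a := fun e => h.1 (e ▸ hi)
    have h2 : i ≠ b := fun e => h.2 (e ▸ hi)
    simp [h1, h2]
  · refine Or.inr ⟨(T.erase a).erase b, ?_, fun Z Z' e => ?_⟩
    · refine Nat.succ_le_of_lt (Finset.card_lt_card ?_)
      refine Finset.ssubset_iff_subset_ne.2
        ⟨(Finset.erase_subset _ _).trans (Finset.erase_subset _ _), fun e => h ⟨fun ha => ?_, fun hb => ?_⟩⟩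
      · rw [← e] at ha
        simp at ha
      · rw [← e] at hb
        simp at hb
    · simp only [inter_eq_inter_iff] at e ⊢
      constructor <;> intro i hi <;> by_cases h1 : i = a <;> by_cases h2 : i = b <;>
        simp [h1, h2] <;> exact e i (by simp [h1, h2, hi])

/-- Removing two points from the ground set shrinks the middle slice by at most a factor 4: the loss
per degree in the next theorem. -/
theorem centralBinom_succ_le (m : ℕ) : (m + 1).centralBinom ≤ 4 * m.centralBinom := by
  have h := Nat.succ_mul_centralBinom_succ m
  have : (m + 1) * (m + 1).centralBinom ≤ (m + 1) * (4 * m.centralBinom) := by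
    rw [h]
    nlinarith
  exact Nat.le_of_mul_le_mul_left this (by omega)

/-- A function of degree `k` that does not vanish on the middle slice is nonzero at a fraction of
at least `4 ^ (-k)` of its points. -/
theorem centralBinom_le_card_ne_zero (k : ℕ) (h : Finset ι → ℚ) (hh : h ∈ lowDegree ι ℚ k)
    (U : Finset ι) (m : ℕ) (hU : U.card = 2 * m) {X : Finset ι} (hX : X ∈ U.powersetCard m)
    (hne : h X ≠ 0) :
    m.centralBinom ≤ 4 ^ k * ((U.powersetCard m).filter fun X => h X ≠ 0).card := by
  induction k generalizing h U m X with
  | zero =>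
    have : (U.powersetCard m).filter (fun X => h X ≠ 0) = U.powersetCard m :=
      Finset.filter_true_of_mem fun Y _ => by rwa [lowDegree_zero_const hh Y X]
    rw [this, Finset.card_powersetCard, hU, Nat.centralBinom]
    simp
  | succ k ih =>
    -- Either `h` is constant on the slice, hence nowhere zero there, or some exchange of `a` and
    -- `b` changes it. In the latter case the derivative along this exchange has degree `k` and does
    -- not vanish on the middle slice of `U` without `a` and `b`.
    by_cases hc : ∀ X ∈ U.powersetCard m, ∀ a ∈ X, ∀ b ∈ U, b ∉ X →
        h X = h (insert b (X.erase a))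
    · have : (U.powersetCard m).filter (fun X => h X ≠ 0) = U.powersetCard m :=
        Finset.filter_true_of_mem fun Y hY => by rwa [eq_of_exchange_invariant hc hY hX]
      rw [this, Finset.card_powersetCard, hU, Nat.centralBinom]
      exact Nat.le_mul_of_pos_left _ (by positivity)
    · push Not at hc
      obtain ⟨Y, hY, a, haY, b, hbU, hbY, hYne⟩ := hc
      obtain ⟨hYU, hYm⟩ := Finset.mem_powersetCard.1 hY
      have hab : a ≠ b := fun e => hbY (e ▸ haY)
      obtain ⟨m, rfl⟩ : ∃ m', m = m' + 1 :=
        ⟨m - 1, by have := Finset.card_pos.2 ⟨a, haY⟩; omega⟩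
      have hUc : ((U.erase a).erase b).card = 2 * m := by
        rw [Finset.card_erase_of_mem (Finset.mem_erase.2 ⟨hab.symm, hbU⟩),
          Finset.card_erase_of_mem (hYU haY), hU]
        omega
      have hYa : ((Y.erase a).erase a).erase b = Y.erase a := by
        rw [Finset.erase_idem, Finset.erase_eq_of_notMem]
        exact fun hh => hbY (Finset.mem_of_mem_erase hh)
      have key := ih _ (exchange_mem_lowDegree hh a b) _ m hUc (X := Y.erase a) (by
        rw [Finset.mem_powersetCard, Finset.card_erase_of_mem haY, hYm]
        refine ⟨fun i hi => ?_, rfl⟩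
        have hi' := Finset.mem_erase.1 hi
        exact Finset.mem_erase.2 ⟨fun e => hbY (e ▸ hi'.2), Finset.mem_erase.2 ⟨hi'.1, hYU hi'.2⟩⟩) (by
        rw [hYa, Finset.insert_erase haY]
        exact sub_ne_zero.2 hYne)
      -- Where the derivative at `Y` is nonzero, so is `h` at `insert a Y` or at `insert b Y`.
      -- Erasing `a` and `b` recovers `Y`, so this choice is injective.
      have hcard : (((U.erase a).erase b).powersetCard m |>.filter fun Y =>
          h (insert a ((Y.erase a).erase b)) - h (insert b ((Y.erase a).erase b)) ≠ 0).card ≤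
          ((U.powersetCard (m + 1)).filter fun X => h X ≠ 0).card := by
        refine Finset.card_le_card_of_injOn
          (fun Y => if h (insert a Y) ≠ 0 then insert a Y else insert b Y) ?_ ?_
        · intro Z hZ
          simp only [Finset.coe_filter, Set.mem_ofPred_eq, Finset.mem_powersetCard] at hZ ⊢
          obtain ⟨⟨hZU, hZm⟩, hZ⟩ := hZ
          have haZ : a ∉ Z := fun hh => by simpa using hZU hh
          have hbZ : b ∉ Z := fun hh => by simpa using hZU hh
          rw [Finset.erase_eq_of_notMem haZ, Finset.erase_eq_of_notMem hbZ] at hZ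
          have hZU' : Z ⊆ U := hZU.trans ((Finset.erase_subset _ _).trans (Finset.erase_subset _ _))
          split_ifs with hz
          · exact ⟨⟨Finset.insert_subset (hYU haY) hZU',
              by rw [Finset.card_insert_of_notMem haZ, hZm]⟩, hz⟩
          · rw [not_not] at hz
            rw [hz, zero_sub, neg_ne_zero] at hZ
            exact ⟨⟨Finset.insert_subset hbU hZU',
              by rw [Finset.card_insert_of_notMem hbZ, hZm]⟩, hZ⟩
        · intro Z hZ Z' hZ' e
          simp only [Finset.coe_filter, Set.mem_ofPred_eq, Finset.mem_powersetCard] at hZ hZ'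
          have n1 : a ∉ Z := fun hh => by simpa using hZ.1.1 hh
          have n2 : b ∉ Z := fun hh => by simpa using hZ.1.1 hh
          have n3 : a ∉ Z' := fun hh => by simpa using hZ'.1.1 hh
          have n4 : b ∉ Z' := fun hh => by simpa using hZ'.1.1 hh
          have r : ∀ W : Finset ι, a ∉ W → b ∉ W →
              ((if h (insert a W) ≠ 0 then insert a W else insert b W).erase a).erase b = W := by
            intro W h1 h2
            split_ifs <;> ext i <;> by_cases e1 : i = a <;> by_cases e2 : i = b <;>
              simp_all
          have := congrArg (fun W => (W.erase a).erase b) e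
          simpa only [r Z n1 n2, r Z' n3 n4] using this
      calc (m + 1).centralBinom ≤ 4 * m.centralBinom := centralBinom_succ_le m
        _ ≤ 4 * (4 ^ k * ((U.powersetCard (m + 1)).filter fun X => h X ≠ 0).card) := by
          gcongr
          exact key.trans (Nat.mul_le_mul_left _ hcard)
        _ = _ := by ring

/-- The set `X` after exchanging the coordinates `a` and `b`. -/
def swapAt (a b : ι) (X : Finset ι) : Finset ι := X.map (Equiv.swap a b).toEmbedding

theorem mem_swapAt {a b i : ι} {X : Finset ι} : i ∈ swapAt a b X ↔ Equiv.swap a b i ∈ X := by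
  rw [swapAt, Finset.mem_map_equiv, Equiv.symm_swap]

theorem swapAt_insert_left {a b : ι} {Y : Finset ι} (ha : a ∉ Y) (hb : b ∉ Y) :
    swapAt a b (insert a Y) = insert b Y := by
  ext i
  rw [mem_swapAt, Finset.mem_insert, Finset.mem_insert]
  by_cases h1 : i = a
  · subst h1
    simp [ha, hb, eq_comm]
  · by_cases h2 : i = b
    · simp [h2]
    · rw [Equiv.swap_apply_of_ne_of_ne h1 h2]
      simp [h1, h2]

theorem swapAt_comm (a b : ι) (X : Finset ι) : swapAt a b X = swapAt b a X := by
  rw [swapAt, swapAt, Equiv.swap_comm]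

theorem swapAt_eq_self {a b : ι} {X : Finset ι} (h : a ∈ X ↔ b ∈ X) : swapAt a b X = X := by
  ext i
  rw [mem_swapAt]
  by_cases h1 : i = a
  · simp [h1, h]
  · by_cases h2 : i = b
    · simp [h2, h]
    · rw [Equiv.swap_apply_of_ne_of_ne h1 h2]

theorem swapAt_eq_insert_erase {a b : ι} {X : Finset ι} (ha : a ∈ X) (hb : b ∉ X) :
    swapAt a b X = insert b (X.erase a) := by
  conv_lhs => rw [← Finset.insert_erase ha]
  exact swapAt_insert_left (Finset.notMem_erase _ _) fun h => hb (Finset.mem_of_mem_erase h)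

/-- If exchanging `a` and `b` changes a function of degree `d` somewhere on the middle slice, then
it does so at a fraction of at least `2 / 4 ^ d` of its points. -/
theorem two_mul_card_le_card_swapAt_ne [Fintype ι] {d h : ℕ} (hι : Fintype.card ι = 2 * h)
    {f : Finset ι → ℚ} (hf : f ∈ lowDegree ι ℚ (d + 1)) {a b : ι} {X : Finset ι} (hX : X.card = h)
    (hne : f X ≠ f (swapAt a b X)) :
    2 * (Finset.univ.powersetCard h : Finset (Finset ι)).card ≤ 4 ^ (d + 1) *
      ((Finset.univ.powersetCard h).filter fun X => f X ≠ f (swapAt a b X)).card := by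
  -- An exchange that changes the value moves `X`, so `X` contains exactly one of `a` and `b`.
  wlog haX : a ∈ X ∧ b ∉ X generalizing a b
  · have hb : b ∈ X ∧ a ∉ X := by
      by_contra hc
      exact hne (by rw [swapAt_eq_self (by tauto)])
    have := this (a := b) (b := a) (by rwa [swapAt_comm]) hb
    simpa only [swapAt_comm b a] using this
  obtain ⟨haX, hbX⟩ := haX
  have hab : a ≠ b := fun e => hbX (e ▸ haX)
  obtain ⟨m, rfl⟩ : ∃ m, h = m + 1 := ⟨h - 1, by have := Finset.card_pos.2 ⟨a, haX⟩; omega⟩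
  set U := ((Finset.univ : Finset ι).erase a).erase b with hU
  have hUc : U.card = 2 * m := by
    rw [hU, Finset.card_erase_of_mem (by simp [hab.symm]), Finset.card_erase_of_mem (by simp),
      Finset.card_univ, hι]
    omega
  have hXa : ((X.erase a).erase a).erase b = X.erase a := by
    rw [Finset.erase_idem, Finset.erase_eq_of_notMem]
    exact fun hh => hbX (Finset.mem_of_mem_erase hh)
  have key := centralBinom_le_card_ne_zero d _ (exchange_mem_lowDegree hf a b) U m hUc
    (X := X.erase a) (by
      rw [Finset.mem_powersetCard, Finset.card_erase_of_mem haX, hX]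
      refine ⟨fun i hi => ?_, rfl⟩
      have hi' := Finset.mem_erase.1 hi
      simp only [hU, Finset.mem_erase, Finset.mem_univ, and_true]
      exact ⟨fun e => hbX (e ▸ hi'.2), hi'.1⟩) (by
      rw [hXa, Finset.insert_erase haX]
      rw [swapAt_eq_insert_erase haX hbX] at hne
      exact sub_ne_zero.2 hne)
  set 𝒴 := (U.powersetCard m).filter fun Y =>
    f (insert a ((Y.erase a).erase b)) - f (insert b ((Y.erase a).erase b)) ≠ 0 with h𝒴
  have hY : ∀ Y ∈ 𝒴, a ∉ Y ∧ b ∉ Y ∧ Y.card = m ∧ f (insert a Y) ≠ f (insert b Y) := by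
    intro Y hY
    simp only [h𝒴, Finset.mem_filter, Finset.mem_powersetCard] at hY
    have n1 : a ∉ Y := fun hh => by simpa [hU] using hY.1.1 hh
    have n2 : b ∉ Y := fun hh => by simpa [hU] using hY.1.1 hh
    rw [Finset.erase_eq_of_notMem n1, Finset.erase_eq_of_notMem n2] at hY
    exact ⟨n1, n2, hY.1.2, sub_ne_zero.1 hY.2⟩
  have inj : ∀ c, (∀ Y ∈ 𝒴, c ∉ Y) → Set.InjOn (insert c) (𝒴 : Set (Finset ι)) := by
    intro c hc Y hY Y' hY' e
    have := congrArg (fun W => W.erase c) e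
    simpa only [Finset.erase_insert (hc Y hY), Finset.erase_insert (hc Y' hY')] using this
  -- Each `Y` gives two sets affected by the exchange, one containing `a` and one containing `b`;
  -- this is the factor 2.
  have hdis : Disjoint (𝒴.image (insert a)) (𝒴.image (insert b)) := by
    rw [Finset.disjoint_left]
    intro W h1 h2
    obtain ⟨Y, hY1, rfl⟩ := Finset.mem_image.1 h1
    obtain ⟨Y', hY2, e⟩ := Finset.mem_image.1 h2
    have : b ∈ insert a Y := e ▸ Finset.mem_insert_self b Y'
    rcases Finset.mem_insert.1 this with h | h
    · exact hab h.symm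
    · exact (hY Y hY1).2.1 h
  have hsub : 𝒴.image (insert a) ∪ 𝒴.image (insert b) ⊆
      (Finset.univ.powersetCard (m + 1)).filter fun X => f X ≠ f (swapAt a b X) := by
    intro W hW
    rw [Finset.mem_filter, Finset.mem_powersetCard_univ]
    rcases Finset.mem_union.1 hW with h | h
    · obtain ⟨Y, hY1, rfl⟩ := Finset.mem_image.1 h
      obtain ⟨n1, n2, n3, n4⟩ := hY Y hY1
      rw [Finset.card_insert_of_notMem n1, swapAt_insert_left n1 n2]
      exact ⟨by omega, n4⟩
    · obtain ⟨Y, hY1, rfl⟩ := Finset.mem_image.1 h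
      obtain ⟨n1, n2, n3, n4⟩ := hY Y hY1
      rw [Finset.card_insert_of_notMem n2, swapAt_comm, swapAt_insert_left n2 n1]
      exact ⟨by omega, n4.symm⟩
  have hc := Finset.card_le_card hsub
  rw [Finset.card_union_of_disjoint hdis, Finset.card_image_of_injOn (inj a fun Y h => (hY Y h).1),
    Finset.card_image_of_injOn (inj b fun Y h => (hY Y h).2.1)] at hc
  have hcard : (Finset.univ.powersetCard (m + 1) : Finset (Finset ι)).card = (m + 1).centralBinom := by
    rw [Finset.card_powersetCard, Finset.card_univ, hι, Nat.centralBinom]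
  rw [hcard]
  have := centralBinom_succ_le m
  calc 2 * (m + 1).centralBinom ≤ 2 * (4 * (4 ^ d * 𝒴.card)) := by gcongr; omega
    _ = 4 ^ (d + 1) * (𝒴.card + 𝒴.card) := by ring
    _ ≤ _ := by gcongr

end Slice

/-! ## Exchanging many pairs of coordinates -/

section Pairs

variable {ι : Type*} [DecidableEq ι] [Fintype ι] {π ℓ : ι → ι}

/-- The set `X` after the exchange of `k` with `π k`, for all coordinates `k` with label in `Z`. -/
def swapPairs (π ℓ : ι → ι) (X Z : Finset ι) : Finset ι :=
  Finset.univ.filter fun k => (if ℓ k ∈ Z then π k else k) ∈ X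

theorem mem_swapPairs {X Z : Finset ι} {k : ι} :
    k ∈ swapPairs π ℓ X Z ↔ (if ℓ k ∈ Z then π k else k) ∈ X := by
  simp [swapPairs]

theorem swapPairs_swapPairs (hπ : Function.Involutive π) (hℓ : ∀ k, ℓ (π k) = ℓ k)
    (X Z : Finset ι) : swapPairs π ℓ (swapPairs π ℓ X Z) Z = X := by
  ext k
  by_cases h : ℓ k ∈ Z <;> simp [mem_swapPairs, h, hℓ, hπ k]

theorem card_swapPairs (hπ : Function.Involutive π) (hℓ : ∀ k, ℓ (π k) = ℓ k)
    (X Z : Finset ι) : (swapPairs π ℓ X Z).card = X.card := by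
  refine Finset.card_nbij' (fun k => if ℓ k ∈ Z then π k else k)
    (fun k => if ℓ k ∈ Z then π k else k) (fun k hk => mem_swapPairs.1 hk) (fun k hk => ?_)
    (fun k _ => ?_) (fun k _ => ?_)
  · rw [Finset.mem_coe, mem_swapPairs]
    by_cases h : ℓ k ∈ Z <;> simpa [h, hℓ, hπ k] using hk
  all_goals by_cases h : ℓ k ∈ Z <;> simp [h, hℓ, hπ k]

/-- Membership of `k` depends on `Z` only through the label `ℓ k`: a whole pair is one bit of the
cube, and the degree does not grow. -/
theorem swapPairs_mem_lowDegree {d : ℕ} {f : Finset ι → ℚ} (hf : f ∈ lowDegree ι ℚ d) (π ℓ : ι → ι)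
    (X : Finset ι) : (fun Z => f (swapPairs π ℓ X Z)) ∈ lowDegree ι ℚ d :=
  lowDegree_comp hf _ fun T => ⟨T.image ℓ, Finset.card_image_le, fun Z Z' e => by
    rw [inter_eq_inter_iff] at e ⊢
    intro i hi
    rw [mem_swapPairs, mem_swapPairs]
    simp only [e (ℓ i) (Finset.mem_image_of_mem _ hi)]⟩

/-- Flipping bit `i` of the cube exchanges `i` with `π i`, so influences on the cube count exchanges
that change the value. -/
theorem swapPairs_insert {i : ι} (hi : ∀ k, ℓ k = i ↔ k = i ∨ k = π i)
    (hπ : Function.Involutive π) (X Z : Finset ι) :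
    swapPairs π ℓ X (insert i Z) = swapAt i (π i) (swapPairs π ℓ X (Z.erase i)) := by
  ext k
  rw [mem_swapAt, mem_swapPairs, mem_swapPairs]
  have hii : ℓ i = i := (hi i).2 (Or.inl rfl)
  have hiπ : ℓ (π i) = i := (hi _).2 (Or.inr rfl)
  by_cases h : ℓ k = i
  · rcases (hi k).1 h with rfl | rfl
    · simp [hiπ, hii]
    · simp [hiπ, hii, hπ i]
  · have h1 : k ≠ i := fun e => h ((hi k).2 (Or.inl e))
    have h2 : k ≠ π i := fun e => h ((hi k).2 (Or.inr e))
    rw [Equiv.swap_apply_of_ne_of_ne h1 h2]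
    simp [h]

/-- For fixed `Z` the exchanges form an involution of the slice: a uniformly random set stays
uniform. -/
theorem sum_swapPairs (hπ : Function.Involutive π) (hℓ : ∀ k, ℓ (π k) = ℓ k) (h : ℕ)
    (Z : Finset ι) (F : Finset ι → ℚ) :
    ∑ X ∈ Finset.univ.powersetCard h, F (swapPairs π ℓ X Z) = ∑ X ∈ Finset.univ.powersetCard h, F X :=
  Finset.sum_nbij' (fun X => swapPairs π ℓ X Z) (fun X => swapPairs π ℓ X Z)
    (fun X hX => by
      rw [Finset.mem_powersetCard_univ] at *; rw [card_swapPairs hπ hℓ, hX])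
    (fun X hX => by
      rw [Finset.mem_powersetCard_univ] at *; rw [card_swapPairs hπ hℓ, hX])
    (fun X _ => swapPairs_swapPairs hπ hℓ X Z) (fun X _ => swapPairs_swapPairs hπ hℓ X Z)
    fun _ _ => rfl

/-- Deviations above and below the mean balance, and those above are at most `M - μ`. Pointwise,
`|x| ≤ 2 * (M - μ) - x` for `x = φ z - μ`, and the sum of `x` is zero. -/
theorem sum_abs_sub_le {α : Type*} (s : Finset α) (φ : α → ℚ) (μ M : ℚ)
    (hμ : ∑ z ∈ s, φ z = s.card * μ) (hM : ∀ z ∈ s, φ z ≤ M) (hs : s.Nonempty) :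
    ∑ z ∈ s, |φ z - μ| ≤ 2 * s.card * (M - μ) := by
  have hc : (0 : ℚ) < s.card := by exact_mod_cast Finset.card_pos.2 hs
  have hMμ : μ ≤ M := by
    have : ∑ z ∈ s, φ z ≤ s.card * M := by simpa using Finset.sum_le_card_nsmul s φ M hM
    rw [hμ] at this
    exact le_of_mul_le_mul_left this hc
  calc ∑ z ∈ s, |φ z - μ| ≤ ∑ z ∈ s, (2 * (M - μ) - (φ z - μ)) := by
        refine Finset.sum_le_sum fun z hz => abs_le.2 ⟨?_, ?_⟩ <;> linarith [hM z hz]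
    _ = 2 * s.card * (M - μ) := by
        rw [Finset.sum_sub_distrib, Finset.sum_sub_distrib, hμ]
        simp
        ring

theorem pow_mul_pow_eq_sq_pow (k : ℕ) : (144 : ℚ) ^ k * 9 ^ k = (36 ^ k) ^ 2 := by
  rw [← mul_pow, ← pow_mul, mul_comm k, pow_mul]
  norm_num

/-- If many disjoint exchanges of two coordinates affect a function of degree `d` with integer
values on the middle slice, then its maximum there exceeds its mean considerably. -/
theorem exists_average_add_le {d h t : ℕ} (hι : Fintype.card ι = 2 * h) {f : Finset ι → ℚ}
    (hf : f ∈ lowDegree ι ℚ (d + 1)) (hint : ∀ X Y, f X ≠ f Y → 1 ≤ (f X - f Y) ^ 2)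
    (hπ : Function.Involutive π) (hℓ : ∀ k, ℓ (π k) = ℓ k) (s : Finset ι)
    (hs : s.card = 4 * (d + 1) * 144 ^ (d + 1) * t ^ 2)
    (hpair : ∀ i ∈ s, ∀ k, ℓ k = i ↔ k = i ∨ k = π i)
    (hne : ∀ i ∈ s, ∃ X : Finset ι, X.card = h ∧ f X ≠ f (swapAt i (π i) X)) :
    ∃ X : Finset ι, X.card = h ∧
      (∑ X ∈ Finset.univ.powersetCard h, f X) / (Finset.univ.powersetCard h : Finset (Finset ι)).card + t
        ≤ f X := by
  set 𝒮 : Finset (Finset ι) := Finset.univ.powersetCard h with h𝒮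
  have hne𝒮 : 𝒮.Nonempty := by
    rw [h𝒮, Finset.powersetCard_nonempty, Finset.card_univ]
    omega
  obtain ⟨X₀, hX₀, hmax⟩ := Finset.exists_max_image 𝒮 f hne𝒮
  set M := f X₀
  refine ⟨X₀, Finset.mem_powersetCard_univ.1 hX₀, ?_⟩
  have hc𝒮 : (0 : ℚ) < 𝒮.card := by exact_mod_cast Finset.card_pos.2 hne𝒮
  set P : ℚ := 2 ^ s.card with hP
  have hPpos : 0 < P := by positivity
  have hPc : ((s.powerset.card : ℕ) : ℚ) = P := by simp [hP]
  -- Each starting set `X` spans a cube of exchanges of the pairs in `s`. On it `φ X` has degree `d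
  -- + 1` and mean `μ X`, and `e X` is its total absolute deviation.
  set φ : Finset ι → Finset ι → ℚ := fun X Z => f (swapPairs π ℓ X Z) with hφ
  set μ : Finset ι → ℚ := fun X => (∑ Z ∈ s.powerset, φ X Z) / P with hμ
  set e : Finset ι → ℚ := fun X => ∑ Z ∈ s.powerset, |φ X Z - μ X| with he
  have hPμ : ∀ X, ∑ Z ∈ s.powerset, φ X Z = P * μ X := fun X => by
    simp only [hμ]
    field_simp
  have hup : ∀ X ∈ 𝒮, e X ≤ 2 * P * (M - μ X) := by
    intro X hX
    have := sum_abs_sub_le s.powerset (φ X) (μ X) M (by rw [hPc, hPμ]) (fun Z _ => hmax _ (by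
      rw [h𝒮, Finset.mem_powersetCard_univ] at hX ⊢
      rw [card_swapPairs hπ hℓ, hX])) ⟨∅, Finset.empty_mem_powerset s⟩
    rwa [hPc] at this
  have hμsum : ∑ X ∈ 𝒮, μ X = ∑ X ∈ 𝒮, f X := by
    have : ∑ X ∈ 𝒮, ∑ Z ∈ s.powerset, φ X Z = P * ∑ X ∈ 𝒮, f X := by
      rw [Finset.sum_comm, Finset.sum_congr rfl fun Z _ => sum_swapPairs hπ hℓ h Z f,
        Finset.sum_const, nsmul_eq_mul, hPc]
    simp only [hμ]
    rw [← Finset.sum_div, this]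
    field_simp
  set D : ℚ := ((d + 1 : ℕ) : ℚ) with hD
  -- The number of pairs of a vertex and a direction of the cube across which the value changes.
  set I : Finset ι → ℚ := fun X => ∑ i ∈ s, ∑ Z ∈ s.powerset,
    if φ X (insert i Z) ≠ φ X (Z.erase i) then 1 else 0 with hI
  have hlow : ∀ X, I X ≤ 4 * D * 36 ^ (d + 1) * t * e X := by
    intro X
    have hG : (fun Z => φ X Z - μ X) ∈ lowDegree ι ℚ (d + 1) :=
      sub_mem (swapPairs_mem_lowDegree hf π ℓ X) (const_mem_lowDegree _ (μ X))
    have h1 := total_influence_le s (d + 1) _ hG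
    have h2 := two_pow_mul_sum_sq_le s (d + 1) _ hG
    have h0 : ∑ Z ∈ s.powerset, (φ X Z - μ X) = 0 := by
      rw [Finset.sum_sub_distrib, hPμ, Finset.sum_const, nsmul_eq_mul, hPc, sub_self]
    rw [h0] at h1
    rw [← hP] at h1 h2
    have hIle : I X ≤ ∑ i ∈ s, ∑ Z ∈ s.powerset,
        (φ X (insert i Z) - μ X - (φ X (Z.erase i) - μ X)) ^ 2 := by
      refine Finset.sum_le_sum fun i _ => Finset.sum_le_sum fun Z _ => ?_
      rw [sub_sub_sub_cancel_right]
      split_ifs with hne'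
      · exact hint _ _ hne'
      · positivity
    have hIq : I X ≤ s.card * P := by
      calc I X ≤ ∑ i ∈ s, ∑ Z ∈ s.powerset, (1 : ℚ) := by
            refine Finset.sum_le_sum fun i _ => Finset.sum_le_sum fun Z _ => ?_
            split_ifs <;> norm_num
        _ = s.card * P := by
          rw [Finset.sum_const, Finset.sum_const, nsmul_eq_mul, nsmul_eq_mul, mul_one, hPc]
    have hI0 : 0 ≤ I X := Finset.sum_nonneg fun i _ => Finset.sum_nonneg fun Z _ => by
      split_ifs <;> norm_num
    have he0 : 0 ≤ e X := Finset.sum_nonneg fun _ _ => abs_nonneg _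
    have h3 : P * I X ≤ 4 * D * (9 ^ (d + 1) * e X ^ 2) := by
      calc P * I X ≤ _ := mul_le_mul_of_nonneg_left hIle hPpos.le
        _ ≤ _ := h1
        _ = 4 * D * (P * ∑ Z ∈ s.powerset, (φ X Z - μ X) ^ 2) := by rw [hD]; ring
        _ ≤ _ := by gcongr
    -- The bound `h3` is quadratic in `e X`, but averaging over `X` needs a linear one. Multiplying
    -- by the trivial bound `I X ≤ s.card * P` turns it into a comparison of squares, whose root is
    -- exact because of the choice of `s.card` and `144 * 9 = 36 ^ 2`.
    refine (abs_le_of_sq_le_sq' ?_ (mul_nonneg (by positivity) he0)).2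
    calc I X ^ 2 = I X * I X := sq _
      _ ≤ s.card * P * I X := mul_le_mul_of_nonneg_right hIq hI0
      _ = s.card * (P * I X) := by ring
      _ ≤ s.card * (4 * D * (9 ^ (d + 1) * e X ^ 2)) := mul_le_mul_of_nonneg_left h3 (Nat.cast_nonneg _)
      _ = (4 * D * 36 ^ (d + 1) * t * e X) ^ 2 := by
        rw [hs, Nat.cast_mul, Nat.cast_mul, Nat.cast_mul, Nat.cast_pow, Nat.cast_pow, ← hD]
        have h1 : ((144 : ℕ) : ℚ) = 144 := by norm_num
        have h4 : ((4 : ℕ) : ℚ) = 4 := by norm_num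
        have := pow_mul_pow_eq_sq_pow (d + 1)
        rw [h1, h4]
        linear_combination (16 * D ^ 2 * t ^ 2 * e X ^ 2) * this
  -- For fixed `i` and `Z`, the sets `swapPairs π ℓ X (Z.erase i)` run over the slice as `X` does,
  -- and at least a fraction `2 / 4 ^ (d + 1)` of them are affected by the exchange of `i` with its
  -- partner.
  have hIsum : 2 * s.card * P * 𝒮.card ≤ 4 ^ (d + 1) * ∑ X ∈ 𝒮, I X := by
    have h1 : ∑ X ∈ 𝒮, I X = ∑ i ∈ s, P *
        ((𝒮.filter fun X => f X ≠ f (swapAt i (π i) X)).card : ℚ) := by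
      simp only [hI]
      rw [Finset.sum_comm]
      refine Finset.sum_congr rfl fun i hi => ?_
      rw [Finset.sum_comm, ← hPc, ← nsmul_eq_mul, ← Finset.sum_const]
      refine Finset.sum_congr rfl fun Z _ => ?_
      rw [Finset.card_filter]
      push_cast
      rw [← sum_swapPairs hπ hℓ h (Z.erase i) fun X => if f X ≠ f (swapAt i (π i) X) then (1 : ℚ) else 0]
      refine Finset.sum_congr rfl fun X _ => ?_
      simp only [hφ]
      rw [swapPairs_insert (hpair i hi) hπ]
      exact if_congr ne_comm rfl rfl
    rw [h1, Finset.mul_sum]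
    calc 2 * (s.card : ℚ) * P * 𝒮.card = ∑ i ∈ s, 2 * P * 𝒮.card := by
          rw [Finset.sum_const, nsmul_eq_mul]
          ring
      _ ≤ _ := Finset.sum_le_sum fun i hi => by
          obtain ⟨X, hX, hXne⟩ := hne i hi
          have := two_mul_card_le_card_swapAt_ne hι hf hX hXne
          have : (2 : ℚ) * 𝒮.card ≤ 4 ^ (d + 1) *
            ((𝒮.filter fun X => f X ≠ f (swapAt i (π i) X)).card : ℚ) := by exact_mod_cast this
          nlinarith
  have hesum : 2 * t * P * 𝒮.card ≤ ∑ X ∈ 𝒮, e X := by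
    rcases Nat.eq_zero_or_pos t with rfl | ht
    · simp only [Nat.cast_zero, mul_zero, zero_mul]
      exact Finset.sum_nonneg fun X _ => Finset.sum_nonneg fun _ _ => abs_nonneg _
    have ht' : (0 : ℚ) < t := by exact_mod_cast ht
    have h1 : ∑ X ∈ 𝒮, I X ≤ 4 * D * 36 ^ (d + 1) * t * ∑ X ∈ 𝒮, e X := by
      rw [Finset.mul_sum]
      exact Finset.sum_le_sum fun X _ => hlow X
    -- The factor `4` comes from the density on the slice, the factor `36` from the linear bound on
    -- each cube.
    have h144 : (144 : ℚ) ^ (d + 1) = 4 ^ (d + 1) * 36 ^ (d + 1) := by rw [← mul_pow]; norm_num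
    have hDpos : 0 < D := by rw [hD]; positivity
    have h2 : (4 * D * 4 ^ (d + 1) * 36 ^ (d + 1) * t) * (2 * t * P * 𝒮.card) ≤
        (4 * D * 4 ^ (d + 1) * 36 ^ (d + 1) * t) * ∑ X ∈ 𝒮, e X := by
      calc (4 * D * 4 ^ (d + 1) * 36 ^ (d + 1) * t) * (2 * t * P * 𝒮.card)
          = 2 * s.card * P * 𝒮.card := by
            rw [hs]
            push_cast
            rw [h144, hD]
            push_cast
            ring
        _ ≤ 4 ^ (d + 1) * ∑ X ∈ 𝒮, I X := hIsum
        _ ≤ 4 ^ (d + 1) * (4 * D * 36 ^ (d + 1) * t * ∑ X ∈ 𝒮, e X) := by gcongr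
        _ = _ := by ring
    exact le_of_mul_le_mul_left h2 (by positivity)
  have hfin : ∑ X ∈ 𝒮, e X ≤ 2 * P * (M * 𝒮.card - ∑ X ∈ 𝒮, f X) := by
    calc ∑ X ∈ 𝒮, e X ≤ ∑ X ∈ 𝒮, 2 * P * (M - μ X) := Finset.sum_le_sum hup
      _ = _ := by
        rw [← Finset.mul_sum, Finset.sum_sub_distrib, hμsum, Finset.sum_const, nsmul_eq_mul]
        ring
  have : 2 * P * (t * 𝒮.card) ≤ 2 * P * (M * 𝒮.card - ∑ X ∈ 𝒮, f X) := by linarith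
  have := le_of_mul_le_mul_left this (by positivity)
  rw [← le_sub_iff_add_le, div_le_iff₀ hc𝒮]
  linarith

end Pairs

/-! ## Interpolation -/

section Interpolation

variable {ι : Type*} [DecidableEq ι]

/-- The elements of `T` in `Z`, the partners `e u` of the others, and the elements of `E`. -/
def exchangeFamily (e : ι → ι) (T E Z : Finset ι) : Finset ι := Z ∩ T ∪ (T \ Z).image e ∪ E

/-- Bit `u` of `Z` chooses between `u` and its partner `e u`. As `e` is injective and leaves `T`,
membership of any element depends on at most one bit, so `f` has degree `d` on this cube, whose
dimension exceeds `d`. -/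
theorem sum_exchangeFamily_eq_zero {d : ℕ} {f : Finset ι → ℚ} (hf : f ∈ lowDegree ι ℚ d)
    {e : ι → ι} {T : Finset ι} (E : Finset ι) (he : Set.InjOn e T) (heT : ∀ u ∈ T, e u ∉ T)
    (hT : d < T.card) : ∑ Z ∈ T.powerset, (-1) ^ Z.card * f (exchangeFamily e T E Z) = 0 := by
  have hg : (fun Z => f (exchangeFamily e T E Z)) ∈ lowDegree ι ℚ d := by
    classical
    refine lowDegree_comp hf _ fun T₂ =>
      ⟨T₂.biUnion fun k => if k ∈ T then {k} else T.filter fun u => e u = k, ?_, fun Z Z' h => ?_⟩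
    · refine Finset.card_biUnion_le.trans ?_
      rw [Finset.card_eq_sum_ones]
      refine Finset.sum_le_sum fun k _ => ?_
      split_ifs
      · simp
      · rw [Finset.card_le_one]
        intro a ha b hb
        rw [Finset.mem_filter] at ha hb
        exact he ha.1 hb.1 (ha.2.trans hb.2.symm)
    · rw [inter_eq_inter_iff] at h ⊢
      intro i hi
      have h1 : i ∈ T → (i ∈ Z ↔ i ∈ Z') := fun hiT =>
        h i (Finset.mem_biUnion.2 ⟨i, hi, by simp [hiT]⟩)
      have h2 : ∀ u ∈ T, e u = i → (u ∈ Z ↔ u ∈ Z') := by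
        rintro u hu rfl
        exact h u (Finset.mem_biUnion.2 ⟨e u, hi, by simp [heT u hu, hu]⟩)
      have h3 : (∃ u, (u ∈ T ∧ u ∉ Z) ∧ e u = i) ↔ ∃ u, (u ∈ T ∧ u ∉ Z') ∧ e u = i :=
        exists_congr fun u => by
          constructor <;> rintro ⟨⟨hu, hz⟩, hi⟩ <;> have := h2 u hu hi <;> tauto
      simp only [exchangeFamily, Finset.mem_union, Finset.mem_inter, Finset.mem_image,
        Finset.mem_sdiff, h3]
      rw [and_congr_left h1]
  simpa using sum_powerset_neg_one_pow_eq_zero hg hT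

theorem exists_injOn_mapsTo {T B : Finset ι} (h : T.card ≤ B.card) :
    ∃ e : ι → ι, Set.InjOn e T ∧ ∀ u ∈ T, e u ∈ B := by
  obtain ⟨φ⟩ : Nonempty (T ↪ B) := Function.Embedding.nonempty_of_card_le (by simpa using h)
  refine ⟨fun u => if hu : u ∈ T then φ ⟨u, hu⟩ else u, fun u hu v hv huv => ?_, fun u hu => ?_⟩
  · rw [Finset.mem_coe] at hu hv
    simp only [hu, hv, dif_pos] at huv
    simpa using φ.injective (Subtype.ext huv)
  · simp [hu]

theorem card_exchangeFamily {e : ι → ι} {T E Z : Finset ι} (he : Set.InjOn e T)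
    (heT : ∀ u ∈ T, e u ∉ T) (hE : Disjoint T E) (heE : ∀ u ∈ T, e u ∉ E) (hZ : Z ⊆ T) :
    (exchangeFamily e T E Z).card = T.card + E.card := by
  rw [exchangeFamily, Finset.card_union_of_disjoint, Finset.card_union_of_disjoint,
    Finset.card_image_of_injOn (he.mono (Finset.coe_subset.2 Finset.sdiff_subset)),
    Finset.inter_eq_left.2 hZ, Finset.card_sdiff_of_subset hZ]
  · have := Finset.card_le_card hZ
    omega
  · rw [Finset.disjoint_right]
    intro i hi
    obtain ⟨u, hu, rfl⟩ := Finset.mem_image.1 hi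
    exact fun h => heT u (Finset.sdiff_subset hu) (Finset.mem_of_mem_inter_right h)
  · rw [Finset.disjoint_left]
    intro i hi
    rcases Finset.mem_union.1 hi with h | h
    · exact Finset.disjoint_left.1 hE (Finset.mem_of_mem_inter_right h)
    · obtain ⟨u, hu, rfl⟩ := Finset.mem_image.1 h
      exact heE u (Finset.sdiff_subset hu)

/-- A function of degree `d` that vanishes on a ball of radius `d` in a slice vanishes on the
slice. -/
theorem eq_zero_of_eq_zero_on_ball {d h : ℕ} {g : Finset ι → ℚ} (hg : g ∈ lowDegree ι ℚ d)
    {X₀ : Finset ι} (hX₀ : X₀.card = h)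
    (hb : ∀ X : Finset ι, X.card = h → (X \ X₀).card ≤ d → g X = 0) {X : Finset ι} (hX : X.card = h) :
    g X = 0 := by
  induction hr : (X \ X₀).card using Nat.strong_induction_on generalizing X with
  | _ r ih =>
    rcases le_or_gt r d with hrd | hrd
    · exact hb X hX (hr.trans_le hrd)
    -- Pair `X \ X₀` with `X₀ \ X`. In the resulting cube all vertices other than `X` are closer to
    -- `X₀`, where `g` vanishes by induction, so the vanishing alternating sum reduces to the term
    -- of `X`.
    obtain ⟨e, he, heB⟩ := exists_injOn_mapsTo (T := X \ X₀) (B := X₀ \ X)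
      (Finset.card_sdiff_comm (hX.trans hX₀.symm)).le
    have heT : ∀ u ∈ X \ X₀, e u ∉ X \ X₀ := fun u hu h => by
      have h1 := Finset.mem_sdiff.1 (heB u hu)
      exact h1.2 (Finset.mem_sdiff.1 h).1
    have hs := sum_exchangeFamily_eq_zero hg (X ∩ X₀) he heT (hr.symm ▸ hrd)
    rw [Finset.sum_eq_single (X \ X₀)] at hs
    · have : exchangeFamily e (X \ X₀) (X ∩ X₀) (X \ X₀) = X := by
        rw [exchangeFamily, Finset.inter_self, Finset.sdiff_self, Finset.image_empty,
          Finset.union_empty, Finset.sdiff_union_inter]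
      rw [this] at hs
      simpa using hs
    · intro Z hZ hne
      rw [Finset.mem_powerset] at hZ
      rw [ih Z.card (by
        rw [← hr]
        exact Finset.card_lt_card (Finset.ssubset_iff_subset_ne.2 ⟨hZ, hne⟩)) (X := exchangeFamily e _ _ Z),
        mul_zero]
      · rw [card_exchangeFamily he heT (Finset.disjoint_sdiff_inter X X₀)
          (fun u hu h => (Finset.mem_sdiff.1 (heB u hu)).2 (Finset.mem_inter.1 h).1) hZ,
          Finset.card_sdiff_add_card_inter, hX]
      · congr 1
        ext i
        simp only [exchangeFamily, Finset.mem_sdiff, Finset.mem_union, Finset.mem_inter,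
          Finset.mem_image]
        constructor
        · rintro ⟨(h | ⟨u, hu, rfl⟩) | h, h0⟩
          · exact h.1
          · exact absurd (Finset.mem_sdiff.1 (heB u (Finset.mem_sdiff.2 hu.1))).1 h0
          · exact absurd h.2 h0
        · intro hi
          have := Finset.mem_sdiff.1 (hZ hi)
          exact ⟨Or.inl (Or.inl ⟨hi, this⟩), this.2⟩
    · simp

/-- Alternating sums of the extensions of sets in `S` to sets of size `h` vanish in high degree. -/
theorem sum_extension_eq_zero [Fintype ι] {d h : ℕ} {f : Finset ι → ℚ} (hf : f ∈ lowDegree ι ℚ d)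
    {S : Finset ι} (hinv : ∀ X : Finset ι, X.card = h → ∀ a ∈ X, a ∉ S → ∀ b, b ∉ X → b ∉ S →
      f X = f (insert b (X.erase a)))
    (hS : S.card ≤ h) (hSc : h ≤ Sᶜ.card) {F : Finset ι → ℚ}
    (hF : ∀ U ⊆ S, ∃ E ⊆ Sᶜ, U.card + E.card = h ∧ F U = f (U ∪ E))
    {T : Finset ι} (hTS : T ⊆ S) (hT : d < T.card) :
    ∑ U ∈ T.powerset, (-1) ^ U.card * F U = 0 := by
  have hTc := Finset.card_le_card hTS
  -- Partners outside `S` exist because `T.card ≤ S.card ≤ h ≤ Sᶜ.card`; the filler `E₀` below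
  -- brings all vertices of the cube to size `h`.
  obtain ⟨e, he, heB⟩ := exists_injOn_mapsTo (T := T) (B := Sᶜ) (by omega)
  have heS : ∀ u ∈ T, e u ∉ S := fun u hu => by simpa using heB u hu
  have hic := Finset.card_image_of_injOn he
  obtain ⟨E₀, hE₀, hE₀c⟩ : ∃ E₀ ⊆ Sᶜ \ T.image e, E₀.card = h - T.card := by
    refine Finset.exists_subset_card_eq ?_
    rw [Finset.card_sdiff_of_subset, hic]
    · omega
    · intro i hi
      obtain ⟨u, hu, rfl⟩ := Finset.mem_image.1 hi
      exact heB u hu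
  have hE₀S : ∀ i ∈ E₀, i ∉ S := fun i hi => by simpa using (Finset.mem_sdiff.1 (hE₀ hi)).1
  have heE : ∀ u ∈ T, e u ∉ E₀ := fun u hu h =>
    (Finset.mem_sdiff.1 (hE₀ h)).2 (Finset.mem_image_of_mem e hu)
  have heT : ∀ u ∈ T, e u ∉ T := fun u hu h => heS u hu (hTS h)
  rw [← sum_exchangeFamily_eq_zero hf E₀ he heT hT]
  refine Finset.sum_congr rfl fun U hU => ?_
  rw [Finset.mem_powerset] at hU
  obtain ⟨E, hES, hEc, hFU⟩ := hF U (hU.trans hTS)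
  rw [hFU]
  congr 1
  have hcard := card_exchangeFamily he heT
    (Finset.disjoint_left.2 fun i hi hi' => hE₀S i hi' (hTS hi)) heE hU
  have hdU : ∀ E' ⊆ Sᶜ, Disjoint U E' := fun E' hE' =>
    Finset.disjoint_left.2 fun i hi hi' => by
      have : i ∉ S := by simpa using hE' hi'
      exact this (hTS (hU hi))
  have hE' : (T \ U).image e ∪ E₀ ⊆ Sᶜ := by
    intro i hi
    rcases Finset.mem_union.1 hi with h | h
    · obtain ⟨u, hu, rfl⟩ := Finset.mem_image.1 h
      exact heB u (Finset.sdiff_subset hu)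
    · exact (Finset.mem_sdiff.1 (hE₀ h)).1
  have hex : exchangeFamily e T E₀ U = U ∪ ((T \ U).image e ∪ E₀) := by
    rw [exchangeFamily, Finset.inter_eq_left.2 hU, Finset.union_assoc]
  rw [hex]
  rw [hex, Finset.card_union_of_disjoint (hdU _ hE')] at hcard
  -- The vertex of the cube and the extension behind `F U` meet `S` in the same set `U`, and `f`
  -- does not distinguish equally large parts outside `S`.
  refine eq_of_exchange_invariant (F := fun E => f (U ∪ E)) (B := Sᶜ) (m := h - U.card) ?_ ?_ ?_
  · intro X hX a ha b hb hbX
    rw [Finset.mem_powersetCard] at hX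
    have haS : a ∉ S := by simpa using hX.1 ha
    have hbS : b ∉ S := by simpa using hb
    have haU : a ∉ U := fun h => haS (hTS (hU h))
    have hbU : b ∉ U := fun h => hbS (hTS (hU h))
    have := hinv (U ∪ X) (by rw [Finset.card_union_of_disjoint (hdU X hX.1)]; omega) a
      (Finset.mem_union_right _ ha) haS b (by simp [hbU, hbX]) hbS
    rw [this]
    congr 1
    rw [Finset.erase_union_distrib, Finset.erase_eq_of_notMem haU, Finset.union_insert]
  · exact Finset.mem_powersetCard.2 ⟨hES, by omega⟩
  · exact Finset.mem_powersetCard.2 ⟨hE', by omega⟩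

/-- Möbius inversion on the subsets of `Y`: after interchanging the sums, the signs of the `T` with
`U ⊆ T ⊆ Y` cancel unless `U = Y`. -/
theorem eq_sum_sum_powerset (F : Finset ι → ℚ) (Y : Finset ι) :
    F Y = ∑ T ∈ Y.powerset, ∑ U ∈ T.powerset, (-1) ^ (T.card + U.card) * F U := by
  rw [Finset.sum_comm' (t' := Y.powerset) (s' := fun U => Y.powerset.filter (U ⊆ ·))]
  · rw [Finset.sum_eq_single Y]
    · rw [Finset.sum_eq_single Y]
      · simp [← two_mul]
      · intro T hT hne
        simp only [Finset.mem_filter, Finset.mem_powerset] at hT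
        exact absurd (hT.1.antisymm hT.2) hne
      · simp
    · intro U hU hne
      rw [Finset.mem_powerset] at hU
      obtain ⟨a, haY, haU⟩ := Finset.exists_of_ssubset (Finset.ssubset_iff_subset_ne.2 ⟨hU, hne⟩)
      rw [Finset.sum_filter, ← Finset.insert_erase haY,
        Finset.sum_powerset_insert (Finset.notMem_erase a Y), ← Finset.sum_add_distrib]
      refine Finset.sum_eq_zero fun T hT => ?_
      have haT : a ∉ T := fun hh => Finset.notMem_erase a Y (Finset.mem_powerset.1 hT hh)
      have : U ⊆ insert a T ↔ U ⊆ T := by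
        rw [Finset.subset_insert_iff_of_notMem haU]
      simp only [this]
      split_ifs
      · rw [Finset.card_insert_of_notMem haT]
        ring
      · simp
    · simp
  · intro T U
    simp only [Finset.mem_powerset, Finset.mem_filter]
    exact ⟨fun h => ⟨⟨h.1, h.2⟩, h.2.trans h.1⟩, fun h => ⟨h.1.1, h.1.2⟩⟩

end Interpolation

/-! ## A language of expressions and commands, and its translation to machine programs -/

/-- Expressions. The values of `glob g` are fixed while an expression or command is evaluated;
`sum x b e` is the sum of `e` over `0 ≤ x < glob b`. -/
inductive Ex : Type
  | lit (z : ℤ)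
  | glob (g : ℕ)
  | loc (x : ℕ)
  | add (a b : Ex)
  | sub (a b : Ex)
  | inp (a : Ex)
  | arr (k : ℕ) (a : Ex)
  | ite (c a b : Ex)
  | sum (x b : ℕ) (e : Ex)
  | lett (x : ℕ) (a e : Ex)

/-- Commands, which change the memory only. -/
inductive Cmd : Type
  | wr (k : ℕ) (a v : Ex)
  | out (a v : Ex)
  | seq (p q : Cmd)
  | ite (c : Ex) (p q : Cmd)
  | rep (x b : ℕ) (p : Cmd)

/-- The address of cell `i` of array `k`, for `1 ≤ k ≤ 8`. -/
def adr (k : ℕ) (i : ℤ) : ℤ := -(8 * i) - k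

/-- The value of an expression. -/
def Ex.eval (γ : ℕ → ℤ) (μ : ℤ → ℤ) : Ex → (ℕ → ℤ) → ℤ
  | lit z, _ => z
  | glob g, _ => γ g
  | loc x, η => η x
  | add a b, η => a.eval γ μ η + b.eval γ μ η
  | sub a b, η => a.eval γ μ η - b.eval γ μ η
  | inp a, η => μ (a.eval γ μ η)
  | arr k a, η => μ (adr k (a.eval γ μ η))
  | ite c a b, η => if 0 < c.eval γ μ η then a.eval γ μ η else b.eval γ μ η
  | sum x b e, η => ∑ i ∈ Finset.range (γ b).toNat, e.eval γ μ (Function.update η x i)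
  | lett x a e, η => e.eval γ μ (Function.update η x (a.eval γ μ η))

/-- Apply `f 0`, …, `f (n - 1)` in this order. -/
def iter {α : Type*} (f : ℕ → α → α) : ℕ → α → α
  | 0, a => a
  | n + 1, a => f n (iter f n a)

/-- The effect of a command on the memory. -/
def Cmd.run (γ : ℕ → ℤ) : Cmd → (ℕ → ℤ) → (ℤ → ℤ) → ℤ → ℤ
  | wr k a v, η, μ => Function.update μ (adr k (a.eval γ μ η)) (v.eval γ μ η)
  | out a v, η, μ => Function.update μ (a.eval γ μ η) (v.eval γ μ η)
  | seq p q, η, μ => q.run γ η (p.run γ η μ)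
  | ite c p q, η, μ => if 0 < c.eval γ μ η then p.run γ η μ else q.run γ η μ
  | .rep x b p, η, μ => iter (fun i => p.run γ (Function.update η x i)) (γ b).toNat μ

/-- A bound on the running time of an expression. -/
def Ex.time (γ : ℕ → ℤ) : Ex → ℕ
  | lit _ => 1
  | glob _ => 2
  | loc _ => 2
  | add a b => a.time γ + b.time γ + 1
  | sub a b => a.time γ + b.time γ + 1
  | inp a => a.time γ + 1
  | arr _ a => a.time γ + 6
  | ite c a b => c.time γ + a.time γ + b.time γ + 1
  | sum _ b e => (γ b).toNat * (e.time γ + 5) + 9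
  | lett _ a e => a.time γ + e.time γ + 6

/-- A bound on the running time of a command. -/
def Cmd.time (γ : ℕ → ℤ) : Cmd → ℕ
  | wr _ a v => a.time γ + v.time γ + 6
  | out a v => a.time γ + v.time γ + 1
  | seq p q => p.time γ + q.time γ
  | ite c p q => c.time γ + p.time γ + q.time γ + 1
  | .rep _ b p => (γ b).toNat * (p.time γ + 4) + 8

/-- The register of a global name. -/
def gR (g : ℕ) : ℕ := 3 * g + 1
/-- The register of a local name. -/
def lR (x : ℕ) : ℕ := 3 * x + 2
/-- The temporary registers. -/
def tR (t : ℕ) : ℕ := 3 * t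

/-- Translation of an expression: the value is left in temporary register `t`. -/
def Ex.comp : Ex → ℕ → Prog
  | lit z, t => .const (tR t) z
  | glob g, t => .seq (.const (tR t) 0) (.add (tR t) (gR g) (tR t))
  | loc x, t => .seq (.const (tR t) 0) (.add (tR t) (lR x) (tR t))
  | add a b, t => .seq (.seq (a.comp t) (b.comp (t + 1))) (.add (tR t) (tR t) (tR (t + 1)))
  | sub a b, t => .seq (.seq (a.comp t) (b.comp (t + 1))) (.sub (tR t) (tR t) (tR (t + 1)))
  | inp a, t => .seq (a.comp t) (.load (tR t) (tR t))
  | arr k a, t => .seq (a.comp t) <| .seq (.add (tR t) (tR t) (tR t)) <|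
      .seq (.add (tR t) (tR t) (tR t)) <| .seq (.add (tR t) (tR t) (tR t)) <|
      .seq (.const (tR (t + 1)) (-k)) <| .seq (.sub (tR t) (tR (t + 1)) (tR t)) <|
      .load (tR t) (tR t)
  | ite c a b, t => .seq (c.comp t) (.ite (tR t) (a.comp t) (b.comp t))
  | sum x b e, t => .seq (.const (tR t) 0) <| .seq (.const (tR (t + 1)) 0) <|
      .seq (.add (tR (t + 1)) (lR x) (tR (t + 1))) <| .seq (.const (lR x) 0) <|
      .seq (.const (tR (t + 2)) 0) <| .seq (.add (tR (t + 2)) (gR b) (tR (t + 2))) <|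
      .seq (.loop (tR (t + 2)) <| .seq (e.comp (t + 3)) <|
        .seq (.add (tR t) (tR t) (tR (t + 3))) <| .seq (.const (tR (t + 3)) 1) <|
        .seq (.add (lR x) (lR x) (tR (t + 3))) (.sub (tR (t + 2)) (tR (t + 2)) (tR (t + 3)))) <|
      .seq (.const (tR (t + 3)) 0) (.add (lR x) (tR (t + 1)) (tR (t + 3)))
  | lett x a e, t => .seq (a.comp t) <| .seq (.seq (.const (tR (t + 2)) 0) <|
      .seq (.add (tR (t + 1)) (lR x) (tR (t + 2))) <| .add (lR x) (tR t) (tR (t + 2))) <|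
      .seq (e.comp (t + 2)) <| .seq (.const (tR t) 0) <| .seq (.add (lR x) (tR (t + 1)) (tR t)) <|
      .add (tR t) (tR t) (tR (t + 2))

/-- Translation of a command; it uses the temporary registers from `t` on. -/
def Cmd.comp : Cmd → ℕ → Prog
  | wr k a v, t => .seq (a.comp t) <| .seq (.add (tR t) (tR t) (tR t)) <|
      .seq (.add (tR t) (tR t) (tR t)) <| .seq (.add (tR t) (tR t) (tR t)) <|
      .seq (.const (tR (t + 1)) (-k)) <| .seq (.sub (tR t) (tR (t + 1)) (tR t)) <|
      .seq (v.comp (t + 1)) <| .store (tR t) (tR (t + 1))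
  | out a v, t => .seq (a.comp t) <| .seq (v.comp (t + 1)) <| .store (tR t) (tR (t + 1))
  | seq p q, t => .seq (p.comp t) (q.comp t)
  | ite c p q, t => .seq (c.comp t) (.ite (tR t) (p.comp t) (q.comp t))
  | .rep x b p, t => .seq (.const (tR (t + 1)) 0) <|
      .seq (.add (tR (t + 1)) (lR x) (tR (t + 1))) <| .seq (.const (lR x) 0) <|
      .seq (.const (tR (t + 2)) 0) <| .seq (.add (tR (t + 2)) (gR b) (tR (t + 2))) <|
      .seq (.loop (tR (t + 2)) <| .seq (p.comp (t + 3)) <| .seq (.const (tR (t + 3)) 1) <|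
        .seq (.add (lR x) (lR x) (tR (t + 3))) (.sub (tR (t + 2)) (tR (t + 2)) (tR (t + 3)))) <|
      .seq (.const (tR (t + 3)) 0) (.add (lR x) (tR (t + 1)) (tR (t + 3)))

/-! ### Bookkeeping of registers: global, local and temporary names occupy the residue classes mod
3. -/

namespace RamState

theorem reg_setReg_self (s : RamState) (r : ℕ) (z : ℤ) : (s.setReg r z).reg r = z := by
  simp [setReg]

theorem reg_setReg_of_ne (s : RamState) {r r' : ℕ} (z : ℤ) (h : r' ≠ r) :
    (s.setReg r z).reg r' = s.reg r' := by
  simp [setReg, h]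

theorem mem_setReg (s : RamState) (r : ℕ) (z : ℤ) : (s.setReg r z).mem = s.mem := rfl

theorem reg_setMem (s : RamState) (a z : ℤ) : (s.setMem a z).reg = s.reg := rfl

/-- The values of the global names. -/
def globals (s : RamState) (g : ℕ) : ℤ := s.reg (gR g)

/-- The values of the local names. -/
def locals (s : RamState) (x : ℕ) : ℤ := s.reg (lR x)

/-- The states agree in the named registers and in the temporary registers below `t`. -/
def Agree (t : ℕ) (s s' : RamState) : Prop := ∀ r, r % 3 ≠ 0 ∨ r < tR t → s'.reg r = s.reg r

variable {t t' : ℕ} {s s' s'' : RamState}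

theorem Agree.refl (t : ℕ) (s : RamState) : Agree t s s := fun _ _ => rfl

theorem Agree.trans (h : Agree t s s') (h' : Agree t s' s'') : Agree t s s'' :=
  fun r hr => (h' r hr).trans (h r hr)

theorem Agree.mono (h : Agree t s s') (ht : t' ≤ t) : Agree t' s s' :=
  fun r hr => h r (hr.imp_right fun hr => hr.trans_le (by simp only [tR]; omega))

theorem Agree.globals (h : Agree t s s') : s'.globals = s.globals :=
  funext fun g => h _ (Or.inl (by simp only [gR]; omega))

theorem Agree.locals (h : Agree t s s') : s'.locals = s.locals :=
  funext fun g => h _ (Or.inl (by simp only [lR]; omega))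

theorem Agree.temp (h : Agree t s s') {u : ℕ} (hu : u < t) : s'.reg (tR u) = s.reg (tR u) :=
  h _ (Or.inr (by simp only [tR]; omega))

theorem Agree.setReg (h : Agree t s s') {u : ℕ} (hu : t ≤ u) (z : ℤ) :
    Agree t s (s'.setReg (tR u) z) := by
  intro r hr
  rw [reg_setReg_of_ne, h r hr]
  simp only [tR] at *
  omega

end RamState

theorem Exec.loop_of_nonpos {r : ℕ} {P : Prog} {s : RamState} (h : s.reg r ≤ 0) :
    Exec (.loop r P) s 1 s := by
  constructor
  exact h

/-- The program halts in state `s'` after at most `T` steps. -/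
def Runs (P : Prog) (s : RamState) (T : ℕ) (s' : RamState) : Prop := ∃ T' ≤ T, Exec P s T' s'

namespace Runs

variable {P Q : Prog} {s s' s'' : RamState} {T T' : ℕ}

theorem mono (h : Runs P s T s') (hT : T ≤ T') : Runs P s T' s' := by
  obtain ⟨U, hU, h⟩ := h
  exact ⟨U, hU.trans hT, h⟩

theorem seq (h : Runs P s T s') (h' : Runs Q s' T' s'') : Runs (.seq P Q) s (T + T') s'' := by
  obtain ⟨U, hU, h⟩ := h
  obtain ⟨U', hU', h'⟩ := h'
  exact ⟨U + U', by omega, .seq h h'⟩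

theorem const (s : RamState) (r : ℕ) (z : ℤ) : Runs (.const r z) s 1 (s.setReg r z) :=
  ⟨1, le_rfl, .const s r z⟩

theorem add (s : RamState) (r a b : ℕ) : Runs (.add r a b) s 1 (s.setReg r (s.reg a + s.reg b)) :=
  ⟨1, le_rfl, .add s r a b⟩

theorem sub (s : RamState) (r a b : ℕ) : Runs (.sub r a b) s 1 (s.setReg r (s.reg a - s.reg b)) :=
  ⟨1, le_rfl, .sub s r a b⟩

theorem load (s : RamState) (r a : ℕ) : Runs (.load r a) s 1 (s.setReg r (s.mem (s.reg a))) :=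
  ⟨1, le_rfl, .load s r a⟩

theorem store (s : RamState) (a b : ℕ) : Runs (.store a b) s 1 (s.setMem (s.reg a) (s.reg b)) :=
  ⟨1, le_rfl, .store s a b⟩

theorem ite_pos {r : ℕ} (hr : 0 < s.reg r) (h : Runs P s T s') : Runs (.ite r P Q) s (T + 1) s' := by
  obtain ⟨U, hU, h⟩ := h
  exact ⟨U + 1, by omega, .ite_pos hr h⟩

theorem ite_neg {r : ℕ} (hr : s.reg r ≤ 0) (h : Runs Q s T s') : Runs (.ite r P Q) s (T + 1) s' := by
  obtain ⟨U, hU, h⟩ := h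
  exact ⟨U + 1, by omega, .ite_neg hr h⟩

/-- A loop that counts a register down, with an invariant. -/
theorem loop {r : ℕ} {n : ℕ} (Inv : ℕ → RamState → Prop) (hr : ∀ i s, i ≤ n → Inv i s → s.reg r = n - i)
    (step : ∀ i s, i < n → Inv i s → ∃ s', Runs P s T s' ∧ Inv (i + 1) s') (h0 : Inv 0 s) :
    ∃ s', Runs (.loop r P) s (n * (T + 1) + 1) s' ∧ Inv n s' := by
  have key : ∀ k i s, i + k = n → Inv i s → ∃ s', Runs (.loop r P) s (k * (T + 1) + 1) s' ∧ Inv n s' := by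
    intro k
    induction k with
    | zero =>
      intro i s hi h
      obtain rfl : i = n := by omega
      exact ⟨s, ⟨1, by omega, .loop_of_nonpos (by rw [hr i s le_rfl h]; omega)⟩, h⟩
    | succ k ih =>
      intro i s hi h
      obtain ⟨s', ⟨U, hU, h1⟩, h'⟩ := step i s (by omega) h
      obtain ⟨s'', ⟨U', hU', h2⟩, h''⟩ := ih (i + 1) s' (by omega) h'
      refine ⟨s'', ⟨U + 1 + U', ?_, .loop_step (by rw [hr i s (by omega) h]; omega) h1 h2⟩, h''⟩
      rw [add_mul]
      omega
  exact key n 0 s (by omega) h0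

end Runs

open RamState in
/-- The translation of an expression computes its value. -/
theorem Ex.runs_comp (e : Ex) (t : ℕ) (s : RamState) :
    ∃ s', Runs (e.comp t) s (e.time s.globals) s' ∧ s'.mem = s.mem ∧ Agree t s s' ∧
      s'.reg (tR t) = e.eval s.globals s.mem s.locals := by
  induction e generalizing t s with
  | lit z => exact ⟨_, .const _ _ _, rfl, (Agree.refl t s).setReg le_rfl z, reg_setReg_self _ _ _⟩
  | glob g =>
    refine ⟨_, (Runs.const _ _ _).seq (.add _ _ _ _), rfl,
      ((Agree.refl t s).setReg le_rfl _).setReg le_rfl _, ?_⟩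
    rw [reg_setReg_self, reg_setReg_self, reg_setReg_of_ne _ _ (by simp only [gR, tR]; omega), add_zero]
    rfl
  | loc x =>
    refine ⟨_, (Runs.const _ _ _).seq (.add _ _ _ _), rfl,
      ((Agree.refl t s).setReg le_rfl _).setReg le_rfl _, ?_⟩
    rw [reg_setReg_self, reg_setReg_self, reg_setReg_of_ne _ _ (by simp only [lR, tR]; omega), add_zero]
    rfl
  | add a b iha ihb =>
    obtain ⟨s1, r1, m1, a1, v1⟩ := iha t s
    obtain ⟨s2, r2, m2, a2, v2⟩ := ihb (t + 1) s1
    rw [a1.globals] at r2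
    refine ⟨_, (r1.seq r2).seq (.add _ _ _ _), by rw [mem_setReg, m2, m1],
      (a1.trans (a2.mono (by omega))).setReg le_rfl _, ?_⟩
    rw [reg_setReg_self, v2, a2.temp (by omega), v1, a1.globals, a1.locals, m1]
    rfl
  | sub a b iha ihb =>
    obtain ⟨s1, r1, m1, a1, v1⟩ := iha t s
    obtain ⟨s2, r2, m2, a2, v2⟩ := ihb (t + 1) s1
    rw [a1.globals] at r2
    refine ⟨_, (r1.seq r2).seq (.sub _ _ _ _), by rw [mem_setReg, m2, m1],
      (a1.trans (a2.mono (by omega))).setReg le_rfl _, ?_⟩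
    rw [reg_setReg_self, v2, a2.temp (by omega), v1, a1.globals, a1.locals, m1]
    rfl
  | inp a iha =>
    obtain ⟨s1, r1, m1, a1, v1⟩ := iha t s
    refine ⟨_, r1.seq (.load _ _ _), by rw [mem_setReg, m1], a1.setReg le_rfl _, ?_⟩
    rw [reg_setReg_self, v1, m1]
    rfl
  | arr k a iha =>
    obtain ⟨s1, r1, m1, a1, v1⟩ := iha t s
    refine ⟨_, (r1.seq <| (Runs.add _ _ _ _).seq <| (Runs.add _ _ _ _).seq <| (Runs.add _ _ _ _).seq <|
      (Runs.const _ _ _).seq <| (Runs.sub _ _ _ _).seq (.load _ _ _)), by simp only [mem_setReg, m1],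
      (((((a1.setReg le_rfl _).setReg le_rfl _).setReg le_rfl _).setReg (Nat.le_succ t) _).setReg
        le_rfl _).setReg le_rfl _, ?_⟩
    have hne : tR t ≠ tR (t + 1) := by simp only [tR]; omega
    simp only [reg_setReg_self, reg_setReg_of_ne _ _ hne, mem_setReg, v1, m1, Ex.eval, adr]
    congr 1
    ring
  | ite c a b ihc iha ihb =>
    obtain ⟨s1, r1, m1, a1, v1⟩ := ihc t s
    by_cases hc : 0 < c.eval s.globals s.mem s.locals
    · obtain ⟨s2, r2, m2, a2, v2⟩ := iha t s1
      rw [a1.globals] at r2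
      refine ⟨s2, (r1.seq (.ite_pos (by rwa [v1]) r2)).mono (by simp only [Ex.time]; omega),
        m2.trans m1, a1.trans a2, ?_⟩
      rw [v2, a1.globals, a1.locals, m1, Ex.eval, if_pos hc]
    · obtain ⟨s2, r2, m2, a2, v2⟩ := ihb t s1
      rw [a1.globals] at r2
      refine ⟨s2, (r1.seq (.ite_neg (by rw [v1]; omega) r2)).mono (by simp only [Ex.time]; omega),
        m2.trans m1, a1.trans a2, ?_⟩
      rw [v2, a1.globals, a1.locals, m1, Ex.eval, if_neg hc]
  | lett x a e iha ihe =>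
    obtain ⟨s1, r1, m1, a1, v1⟩ := iha t s
    have n1 : tR t ≠ tR (t + 2) := by simp only [tR]; omega
    have n2 : tR t ≠ tR (t + 1) := by simp only [tR]; omega
    have n3 : tR (t + 2) ≠ tR (t + 1) := by simp only [tR]; omega
    have l1 : ∀ u, lR x ≠ tR u := fun u => by simp only [tR, lR]; omega
    set s2 := ((s1.setReg (tR (t + 2)) 0).setReg (tR (t + 1)) (s.locals x)).setReg (lR x)
      (a.eval s.globals s.mem s.locals) with hs2
    have r2 : Runs (.seq (.const (tR (t + 2)) 0) <|
      .seq (.add (tR (t + 1)) (lR x) (tR (t + 2))) <| .add (lR x) (tR t) (tR (t + 2))) s1 3 s2 := by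
      convert (Runs.const _ _ _).seq ((Runs.add _ _ _ _).seq (Runs.add _ _ _ _)) using 1
      have : s1.reg (lR x) = s.locals x := congrFun a1.locals x
      simp only [hs2, reg_setReg_self, reg_setReg_of_ne _ _ n1, reg_setReg_of_ne _ _ n2,
        reg_setReg_of_ne _ _ n3, reg_setReg_of_ne _ _ (l1 _), v1, add_zero, this]
    obtain ⟨s3, r3, m3, a3, v3⟩ := ihe (t + 2) s2
    have g2 : s2.globals = s.globals := by
      rw [← a1.globals]
      funext g
      simp only [hs2, globals]
      rw [reg_setReg_of_ne, reg_setReg_of_ne, reg_setReg_of_ne] <;> simp only [gR, lR, tR] <;> omega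
    have l2 : s2.locals = Function.update s.locals x (a.eval s.globals s.mem s.locals) := by
      funext y
      have hy' : s1.reg (lR y) = s.locals y := congrFun a1.locals y
      simp only [hs2, RamState.locals] at hy' ⊢
      by_cases hy : y = x
      · subst hy
        rw [reg_setReg_self, Function.update_self]
      · rw [reg_setReg_of_ne, reg_setReg_of_ne, reg_setReg_of_ne, hy', Function.update_of_ne hy]
        · rfl
        all_goals
          simp only [lR, tR]
          omega
    rw [g2] at r3 v3
    rw [l2] at v3
    have hm2 : s2.mem = s.mem := by rw [hs2, mem_setReg, mem_setReg, mem_setReg, m1]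
    rw [hm2] at v3
    have k3 : s3.reg (tR (t + 1)) = s.locals x := by
      rw [a3.temp (by omega), hs2, reg_setReg_of_ne _ _ (l1 _).symm, reg_setReg_self]
    refine ⟨((s3.setReg (tR t) 0).setReg (lR x) (s.locals x)).setReg (tR t)
      (e.eval s.globals s.mem (Function.update s.locals x (a.eval s.globals s.mem s.locals))), ?_, ?_, ?_, ?_⟩
    · refine Runs.mono (T := a.time s.globals + (3 + (e.time s.globals + (1 + (1 + 1))))) ?_
        (by simp only [Ex.time]; omega)
      refine r1.seq (r2.seq (r3.seq ?_))
      convert (Runs.const _ _ _).seq ((Runs.add _ _ _ _).seq (Runs.add _ _ _ _)) using 1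
      simp only [reg_setReg_self, reg_setReg_of_ne _ _ n2.symm, reg_setReg_of_ne _ _ n1.symm, k3, v3,
        reg_setReg_of_ne _ _ (l1 _).symm, add_zero, zero_add]
    · simp only [mem_setReg]
      rw [m3, hm2]
    · intro r hr
      by_cases hx : r = lR x
      · subst hx
        rw [reg_setReg_of_ne _ _ (l1 _), reg_setReg_self]
        rfl
      · rw [reg_setReg_of_ne, reg_setReg_of_ne _ _ hx, reg_setReg_of_ne, a3 r, hs2,
          reg_setReg_of_ne _ _ hx, reg_setReg_of_ne, reg_setReg_of_ne, a1 r hr] <;>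
          simp only [tR] at * <;> omega
    · rw [reg_setReg_self]
      rfl
  | sum x b e ihe =>
    have n0 : tR t ≠ tR (t + 1) := by simp only [tR]; omega
    have n1 : tR t ≠ tR (t + 2) := by simp only [tR]; omega
    have n2 : tR (t + 1) ≠ tR (t + 2) := by simp only [tR]; omega
    have n3 : tR t ≠ tR (t + 3) := by simp only [tR]; omega
    have n4 : tR (t + 1) ≠ tR (t + 3) := by simp only [tR]; omega
    have n5 : tR (t + 2) ≠ tR (t + 3) := by simp only [tR]; omega
    have l1 : ∀ u, lR x ≠ tR u := fun u => by simp only [tR, lR]; omega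
    have g1 : ∀ u, gR b ≠ tR u := fun u => by simp only [tR, gR]; omega
    have g2 : gR b ≠ lR x := by simp only [lR, gR]; omega
    -- A negative bound stands for an empty range, but the loop counter then differs from the number
    -- of iterations; hence a separate case.
    rcases le_or_gt (s.globals b) 0 with hb | hb
    · refine ⟨_, ((Runs.const _ _ _).seq <| (Runs.const _ _ _).seq <| (Runs.add _ _ _ _).seq <|
        (Runs.const _ _ _).seq <| (Runs.const _ _ _).seq <| (Runs.add _ _ _ _).seq <|
        Runs.seq (T := 1) ⟨1, le_rfl, .loop_of_nonpos ?_⟩ <|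
        (Runs.const _ _ _).seq <| (Runs.add _ _ _ _)).mono (by simp only [Ex.time]; omega), ?_, ?_, ?_⟩
      · have hb' : s.reg (gR b) ≤ 0 := hb
        simpa only [reg_setReg_self, reg_setReg_of_ne _ _ n1, reg_setReg_of_ne _ _ (g1 _),
          reg_setReg_of_ne _ _ g2, add_zero] using hb'
      · simp only [mem_setReg]
      · intro r hr
        by_cases hx : r = lR x
        · subst hx
          simp only [reg_setReg_self, reg_setReg_of_ne _ _ (l1 _), reg_setReg_of_ne _ _ n4,
            reg_setReg_of_ne _ _ n2, reg_setReg_of_ne _ _ (l1 _).symm, add_zero]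
        · rw [reg_setReg_of_ne _ _ hx, reg_setReg_of_ne, reg_setReg_of_ne, reg_setReg_of_ne,
            reg_setReg_of_ne _ _ hx, reg_setReg_of_ne, reg_setReg_of_ne, reg_setReg_of_ne] <;>
            simp only [tR] at * <;> omega
      · simp only [reg_setReg_self, reg_setReg_of_ne _ _ (l1 _).symm, reg_setReg_of_ne _ _ n3,
            reg_setReg_of_ne _ _ n1, reg_setReg_of_ne _ _ n0, Ex.eval, Int.toNat_of_nonpos hb,
            Finset.range_zero, Finset.sum_empty]
    · have hn : ((s.globals b).toNat : ℤ) = s.globals b := Int.toNat_of_nonneg hb.le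
      set n := (s.globals b).toNat
      set f : ℕ → ℤ := fun i => e.eval s.globals s.mem (Function.update s.locals x i)
      -- After `i` rounds: register `t` holds the partial sum, `t + 1` the saved outer value of `x`,
      -- `t + 2` the number of rounds left, and `x` itself the value `i`.
      let Inv : ℕ → RamState → Prop := fun i s' => s'.mem = s.mem ∧ s'.globals = s.globals ∧
        s'.locals = Function.update s.locals x i ∧ s'.reg (tR (t + 2)) = n - i ∧
        s'.reg (tR (t + 1)) = s.locals x ∧ s'.reg (tR t) = ∑ j ∈ Finset.range i, f j ∧
        ∀ u < t, s'.reg (tR u) = s.reg (tR u)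
      obtain ⟨s3, r3, i3⟩ := Runs.loop (n := n) (T := e.time s.globals + 4) (r := tR (t + 2)) Inv
        (P := .seq (e.comp (t + 3)) <|
          .seq (.add (tR t) (tR t) (tR (t + 3))) <| .seq (.const (tR (t + 3)) 1) <|
          .seq (.add (lR x) (lR x) (tR (t + 3))) (.sub (tR (t + 2)) (tR (t + 2)) (tR (t + 3))))
        (s := (((((s.setReg (tR t) 0).setReg (tR (t + 1)) 0).setReg (tR (t + 1)) (s.locals x)).setReg
          (lR x) 0).setReg (tR (t + 2)) 0).setReg (tR (t + 2)) n) (fun i s' _ h => h.2.2.2.1) (by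
          rintro i s1 hi ⟨h1, h2, h3, h4, h5, h6, h7⟩
          obtain ⟨s2, r2, m2, a2, v2⟩ := ihe (t + 3) s1
          rw [h2] at r2 v2
          rw [h3, h1] at v2
          refine ⟨_, (r2.seq <| (Runs.add _ _ _ _).seq <| (Runs.const _ _ _).seq <|
            (Runs.add _ _ _ _).seq <| (Runs.sub _ _ _ _)), m2.trans h1, ?_, ?_, ?_, ?_, ?_, ?_⟩
          · rw [← h2, ← a2.globals]
            funext g
            simp only [globals]
            rw [reg_setReg_of_ne, reg_setReg_of_ne, reg_setReg_of_ne, reg_setReg_of_ne] <;>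
              simp only [tR, gR, lR] <;> omega
          · funext y
            simp only [locals]
            by_cases hy : y = x
            · subst hy
              have : s2.reg (lR y) = i := by
                have := congrFun (a2.locals.trans h3) y
                rwa [Function.update_self] at this
              simp only [reg_setReg_of_ne _ _ (l1 _), reg_setReg_self, this, Function.update_self]
              push_cast
              ring
            · have : s2.reg (lR y) = s.locals y := by
                have := congrFun (a2.locals.trans h3) y
                rwa [Function.update_of_ne hy] at this
              rw [reg_setReg_of_ne, reg_setReg_of_ne, reg_setReg_of_ne, reg_setReg_of_ne, this,
                Function.update_of_ne hy] <;> simp only [tR, lR] <;> omega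
          · simp only [reg_setReg_self, reg_setReg_of_ne _ _ (l1 _).symm, reg_setReg_of_ne _ _ n5,
              reg_setReg_of_ne _ _ n1.symm, a2.temp (show t + 2 < t + 3 by omega), h4]
            push_cast
            ring
          · simp only [reg_setReg_self, reg_setReg_of_ne _ _ (l1 _).symm, reg_setReg_of_ne _ _ n4,
              reg_setReg_of_ne _ _ n0.symm, reg_setReg_of_ne _ _ n2,
              a2.temp (show t + 1 < t + 3 by omega), h5]
          · simp only [reg_setReg_self, reg_setReg_of_ne _ _ (l1 _).symm, reg_setReg_of_ne _ _ n3,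
              reg_setReg_of_ne _ _ n1, a2.temp (show t < t + 3 by omega), h6, v2,
              Finset.sum_range_succ, f]
          · intro u hu
            rw [reg_setReg_of_ne, reg_setReg_of_ne, reg_setReg_of_ne, reg_setReg_of_ne,
              a2.temp (by omega), h7 u hu] <;> simp only [tR, lR] <;> omega) (by
          refine ⟨rfl, ?_, ?_, ?_, ?_, ?_, ?_⟩
          · funext g
            simp only [globals]
            rw [reg_setReg_of_ne, reg_setReg_of_ne, reg_setReg_of_ne, reg_setReg_of_ne,
              reg_setReg_of_ne, reg_setReg_of_ne] <;> simp only [tR, gR, lR] <;> omega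
          · funext y
            simp only [locals]
            by_cases hy : y = x
            · subst hy
              simp only [reg_setReg_of_ne _ _ (l1 _), reg_setReg_self, Function.update_self]
              rfl
            · rw [Function.update_of_ne hy, reg_setReg_of_ne, reg_setReg_of_ne, reg_setReg_of_ne,
                reg_setReg_of_ne, reg_setReg_of_ne, reg_setReg_of_ne]
              · rfl
              all_goals
                simp only [tR, lR]
                omega
          · simp only [reg_setReg_self]
            push_cast
            ring
          · simp only [reg_setReg_self, reg_setReg_of_ne _ _ (l1 _).symm, reg_setReg_of_ne _ _ n2]
          · simp only [reg_setReg_self, reg_setReg_of_ne _ _ (l1 _).symm, reg_setReg_of_ne _ _ n1,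
              reg_setReg_of_ne _ _ n0, Finset.range_zero, Finset.sum_empty]
          · intro u hu
            rw [reg_setReg_of_ne, reg_setReg_of_ne, reg_setReg_of_ne, reg_setReg_of_ne,
              reg_setReg_of_ne, reg_setReg_of_ne] <;> simp only [tR, lR] <;> omega)
      obtain ⟨h1, h2, h3, h4, h5, h6, h7⟩ := i3
      refine ⟨(s3.setReg (tR (t + 3)) 0).setReg (lR x) (s.locals x), ?_, h1, ?_, ?_⟩
      · refine Runs.mono (T := 1 + (1 + (1 + (1 + (1 + (1 + (n * (e.time s.globals + 4 + 1) + 1 + (1 + 1))))))))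
          ?_ (show _ ≤ n * (e.time s.globals + 4 + 1) + 9 by omega)
        refine (Runs.const _ _ _).seq <| (Runs.const _ _ _).seq <| (Runs.add _ _ _ _).seq <|
          (Runs.const _ _ _).seq <| (Runs.const _ _ _).seq <| (Runs.add _ _ _ _).seq <| Runs.seq (s' := s3) ?_ <|
          (Runs.const s3 _ _).seq ?_
        · convert r3 using 1
          simp only [reg_setReg_self, reg_setReg_of_ne _ _ (g1 _), reg_setReg_of_ne _ _ g2,
            reg_setReg_of_ne _ _ (l1 _), add_zero, hn]
          rfl
        · convert Runs.add _ _ _ _ using 1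
          simp only [reg_setReg_self, reg_setReg_of_ne _ _ n4, h5, add_zero]
      · intro r hr
        by_cases hx : r = lR x
        · subst hx
          rw [reg_setReg_self]
          rfl
        · rw [reg_setReg_of_ne _ _ hx, reg_setReg_of_ne _ _ (by simp only [tR] at *; omega)]
          rcases Nat.lt_or_ge (r % 3) 1 with hr0 | hr0
          · have hrt : r = tR (r / 3) := by simp only [tR]; omega
            rw [hrt]
            exact h7 _ (by simp only [tR] at hr; omega)
          · rcases Nat.lt_or_ge (r % 3) 2 with hr1 | hr1
            · have hrt : r = gR (r / 3) := by simp only [gR]; omega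
              rw [hrt]
              exact congrFun h2 _
            · have hrt : r = lR (r / 3) := by simp only [lR]; omega
              have := congrFun h3 (r / 3)
              rw [Function.update_of_ne (by rintro h; exact hx (by rw [hrt, h]))] at this
              rw [hrt]
              exact this
      · rw [reg_setReg_of_ne _ _ (l1 _).symm, reg_setReg_of_ne _ _ n3, h6]
        rfl

open RamState in
/-- The translation of a command has the effect of the command. -/
theorem Cmd.runs_comp (c : Cmd) (t : ℕ) (s : RamState) :
    ∃ s', Runs (c.comp t) s (c.time s.globals) s' ∧ Agree t s s' ∧
      s'.mem = c.run s.globals s.locals s.mem := by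
  induction c generalizing t s with
  | wr k a v =>
    obtain ⟨s1, r1, m1, a1, v1⟩ := a.runs_comp t s
    have hne : tR t ≠ tR (t + 1) := by simp only [tR]; omega
    obtain ⟨s2, rr2, m2, a2, v2⟩ : ∃ s2, Runs (.seq (a.comp t) <| .seq (.add (tR t) (tR t) (tR t)) <|
        .seq (.add (tR t) (tR t) (tR t)) <| .seq (.add (tR t) (tR t) (tR t)) <|
        .seq (.const (tR (t + 1)) (-k)) <| (.sub (tR t) (tR (t + 1)) (tR t))) s (a.time s.globals + 5) s2 ∧
        s2.mem = s.mem ∧ Agree t s s2 ∧ s2.reg (tR t) = adr k (a.eval s.globals s.mem s.locals) := by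
      refine ⟨_, (r1.seq <| (Runs.add _ _ _ _).seq <| (Runs.add _ _ _ _).seq <| (Runs.add _ _ _ _).seq <|
        (Runs.const _ _ _).seq (Runs.sub _ _ _ _)), by simp only [mem_setReg, m1],
        ((((a1.setReg le_rfl _).setReg le_rfl _).setReg le_rfl _).setReg (Nat.le_succ t) _).setReg
          le_rfl _, ?_⟩
      simp only [reg_setReg_self, reg_setReg_of_ne _ _ hne, v1, adr]
      ring
    obtain ⟨s3, r3, m3, a3, v3⟩ := v.runs_comp (t + 1) s2
    rw [a2.globals] at r3 v3
    rw [a2.locals, m2] at v3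
    refine ⟨s3.setMem (s3.reg (tR t)) (s3.reg (tR (t + 1))), ?_, fun r hr => ?_, ?_⟩
    -- The address computation was run as a program of its own. Its execution is taken apart and
    -- nested anew, since the translation continues inside the last component.
    · obtain ⟨T, hT, h⟩ := rr2
      cases h with
      | seq x1 h => cases h with
      | seq x2 h => cases h with
      | seq x3 h => cases h with
      | seq x4 h => cases h with
      | seq x5 h =>
        obtain ⟨U, hU, r3⟩ := r3
        exact ⟨_, by simp only [Cmd.time]; omega,
          .seq x1 (.seq x2 (.seq x3 (.seq x4 (.seq x5 (.seq h (.seq r3 (.store _ _ _)))))))⟩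
    · rw [reg_setMem]
      exact (a2.trans (a3.mono (Nat.le_succ t))) r hr
    · rw [v3, a3.temp (Nat.lt_succ_self t), v2, RamState.setMem, m3, m2]
      rfl
  | out a v =>
    obtain ⟨s1, r1, m1, a1, v1⟩ := a.runs_comp t s
    obtain ⟨s3, r3, m3, a3, v3⟩ := v.runs_comp (t + 1) s1
    rw [a1.globals] at r3 v3
    rw [a1.locals, m1] at v3
    refine ⟨_, r1.seq (r3.seq (.store _ _ _)), fun r hr => ?_, ?_⟩
    · rw [reg_setMem]
      exact (a1.trans (a3.mono (Nat.le_succ t))) r hr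
    · rw [v3, a3.temp (Nat.lt_succ_self t), v1, RamState.setMem, m3, m1]
      rfl
  | seq p q ihp ihq =>
    obtain ⟨s1, r1, a1, m1⟩ := ihp t s
    obtain ⟨s2, r2, a2, m2⟩ := ihq t s1
    rw [a1.globals] at r2 m2
    exact ⟨s2, r1.seq r2, a1.trans a2, by rw [m2, m1, a1.locals]; rfl⟩
  | ite c p q ihp ihq =>
    obtain ⟨s1, r1, m1, a1, v1⟩ := c.runs_comp t s
    by_cases hc : 0 < c.eval s.globals s.mem s.locals
    · obtain ⟨s2, r2, a2, m2⟩ := ihp t s1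
      rw [a1.globals] at r2 m2
      refine ⟨s2, (r1.seq (.ite_pos (by rwa [v1]) r2)).mono (by simp only [Cmd.time]; omega),
        a1.trans a2, ?_⟩
      rw [m2, a1.locals, m1, Cmd.run, if_pos hc]
    · obtain ⟨s2, r2, a2, m2⟩ := ihq t s1
      rw [a1.globals] at r2 m2
      refine ⟨s2, (r1.seq (.ite_neg (by rw [v1]; omega) r2)).mono (by simp only [Cmd.time]; omega),
        a1.trans a2, ?_⟩
      rw [m2, a1.locals, m1, Cmd.run, if_neg hc]
  | rep x b p ihp =>
    have n2 : tR (t + 1) ≠ tR (t + 2) := by simp only [tR]; omega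
    have n4 : tR (t + 1) ≠ tR (t + 3) := by simp only [tR]; omega
    have n5 : tR (t + 2) ≠ tR (t + 3) := by simp only [tR]; omega
    have l1 : ∀ u, lR x ≠ tR u := fun u => by simp only [tR, lR]; omega
    have g1 : ∀ u, gR b ≠ tR u := fun u => by simp only [tR, gR]; omega
    have g2 : gR b ≠ lR x := by simp only [lR, gR]; omega
    rcases le_or_gt (s.globals b) 0 with hb | hb
    · refine ⟨_, ((Runs.const _ _ _).seq <| (Runs.add _ _ _ _).seq <|
        (Runs.const _ _ _).seq <| (Runs.const _ _ _).seq <| (Runs.add _ _ _ _).seq <|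
        Runs.seq (T := 1) ⟨1, le_rfl, .loop_of_nonpos ?_⟩ <|
        (Runs.const _ _ _).seq <| (Runs.add _ _ _ _)).mono (by simp only [Cmd.time]; omega), ?_, ?_⟩
      · have hb' : s.reg (gR b) ≤ 0 := hb
        simpa only [reg_setReg_self, reg_setReg_of_ne _ _ (g1 _),
          reg_setReg_of_ne _ _ g2, add_zero] using hb'
      · intro r hr
        by_cases hx : r = lR x
        · subst hx
          simp only [reg_setReg_self, reg_setReg_of_ne _ _ (l1 _), reg_setReg_of_ne _ _ n4,
            reg_setReg_of_ne _ _ n2, reg_setReg_of_ne _ _ (l1 _).symm, add_zero]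
        · rw [reg_setReg_of_ne _ _ hx, reg_setReg_of_ne, reg_setReg_of_ne, reg_setReg_of_ne,
            reg_setReg_of_ne _ _ hx, reg_setReg_of_ne, reg_setReg_of_ne] <;>
            simp only [tR] at * <;> omega
      · simp only [mem_setReg, Cmd.run, Int.toNat_of_nonpos hb, iter]
    · have hn : ((s.globals b).toNat : ℤ) = s.globals b := Int.toNat_of_nonneg hb.le
      set n := (s.globals b).toNat with hn'
      let f : ℕ → (ℤ → ℤ) → ℤ → ℤ := fun i => p.run s.globals (Function.update s.locals x i)
      let Inv : ℕ → RamState → Prop := fun i s' => s'.mem = iter f i s.mem ∧ s'.globals = s.globals ∧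
        s'.locals = Function.update s.locals x i ∧ s'.reg (tR (t + 2)) = n - i ∧
        s'.reg (tR (t + 1)) = s.locals x ∧ ∀ u ≤ t, s'.reg (tR u) = s.reg (tR u)
      obtain ⟨s3, r3, i3⟩ := Runs.loop (n := n) (T := p.time s.globals + 3) (r := tR (t + 2)) Inv
        (P := .seq (p.comp (t + 3)) <| .seq (.const (tR (t + 3)) 1) <|
          .seq (.add (lR x) (lR x) (tR (t + 3))) (.sub (tR (t + 2)) (tR (t + 2)) (tR (t + 3))))
        (s := ((((s.setReg (tR (t + 1)) 0).setReg (tR (t + 1)) (s.locals x)).setReg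
          (lR x) 0).setReg (tR (t + 2)) 0).setReg (tR (t + 2)) n) (fun i s' _ h => h.2.2.2.1) (by
          rintro i s1 hi ⟨h1, h2, h3, h4, h5, h7⟩
          obtain ⟨s2, r2, a2, m2⟩ := ihp (t + 3) s1
          rw [h2] at r2 m2
          rw [h3, h1] at m2
          refine ⟨_, (r2.seq <| (Runs.const _ _ _).seq <|
            (Runs.add _ _ _ _).seq <| (Runs.sub _ _ _ _)), m2, ?_, ?_, ?_, ?_, ?_⟩
          · rw [← h2, ← a2.globals]
            funext g
            simp only [globals]
            rw [reg_setReg_of_ne, reg_setReg_of_ne, reg_setReg_of_ne] <;>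
              simp only [tR, gR, lR] <;> omega
          · funext y
            simp only [locals]
            by_cases hy : y = x
            · subst hy
              have : s2.reg (lR y) = i := by
                have := congrFun (a2.locals.trans h3) y
                rwa [Function.update_self] at this
              simp only [reg_setReg_of_ne _ _ (l1 _), reg_setReg_self, this, Function.update_self]
              push_cast
              ring
            · have : s2.reg (lR y) = s.locals y := by
                have := congrFun (a2.locals.trans h3) y
                rwa [Function.update_of_ne hy] at this
              rw [reg_setReg_of_ne, reg_setReg_of_ne, reg_setReg_of_ne, this,
                Function.update_of_ne hy] <;> simp only [tR, lR] <;> omega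
          · simp only [reg_setReg_self, reg_setReg_of_ne _ _ (l1 _).symm, reg_setReg_of_ne _ _ n5,
              a2.temp (show t + 2 < t + 3 by omega), h4]
            push_cast
            ring
          · simp only [reg_setReg_of_ne _ _ (l1 _).symm, reg_setReg_of_ne _ _ n4,
              reg_setReg_of_ne _ _ n2, a2.temp (show t + 1 < t + 3 by omega), h5]
          · intro u hu
            rw [reg_setReg_of_ne, reg_setReg_of_ne, reg_setReg_of_ne,
              a2.temp (by omega), h7 u hu] <;> simp only [tR, lR] <;> omega) (by
          refine ⟨rfl, ?_, ?_, ?_, ?_, ?_⟩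
          · funext g
            simp only [globals]
            rw [reg_setReg_of_ne, reg_setReg_of_ne, reg_setReg_of_ne, reg_setReg_of_ne,
              reg_setReg_of_ne] <;> simp only [tR, gR, lR] <;> omega
          · funext y
            simp only [locals]
            by_cases hy : y = x
            · subst hy
              simp only [reg_setReg_of_ne _ _ (l1 _), reg_setReg_self, Function.update_self]
              rfl
            · rw [Function.update_of_ne hy, reg_setReg_of_ne, reg_setReg_of_ne, reg_setReg_of_ne,
                reg_setReg_of_ne, reg_setReg_of_ne]
              · rfl
              all_goals
                simp only [tR, lR]
                omega
          · simp only [reg_setReg_self]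
            push_cast
            ring
          · simp only [reg_setReg_self, reg_setReg_of_ne _ _ (l1 _).symm, reg_setReg_of_ne _ _ n2]
          · intro u hu
            rw [reg_setReg_of_ne, reg_setReg_of_ne, reg_setReg_of_ne, reg_setReg_of_ne,
              reg_setReg_of_ne] <;> simp only [tR, lR] <;> omega)
      obtain ⟨h1, h2, h3, h4, h5, h7⟩ := i3
      refine ⟨(s3.setReg (tR (t + 3)) 0).setReg (lR x) (s.locals x), ?_, ?_, h1⟩
      · refine Runs.mono (T := 1 + (1 + (1 + (1 + (1 + (n * (p.time s.globals + 3 + 1) + 1 + (1 + 1)))))))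
          ?_ (show _ ≤ n * (p.time s.globals + 3 + 1) + 8 by omega)
        refine (Runs.const _ _ _).seq <| (Runs.add _ _ _ _).seq <|
          (Runs.const _ _ _).seq <| (Runs.const _ _ _).seq <| (Runs.add _ _ _ _).seq <| Runs.seq (s' := s3) ?_ <|
          (Runs.const s3 _ _).seq ?_
        · convert r3 using 1
          simp only [reg_setReg_self, reg_setReg_of_ne _ _ (g1 _), reg_setReg_of_ne _ _ g2,
            reg_setReg_of_ne _ _ (l1 _), add_zero, hn]
          rfl
        · convert Runs.add _ _ _ _ using 1
          simp only [reg_setReg_self, reg_setReg_of_ne _ _ n4, h5, add_zero]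
      · intro r hr
        by_cases hx : r = lR x
        · subst hx
          rw [reg_setReg_self]
          rfl
        · rw [reg_setReg_of_ne _ _ hx, reg_setReg_of_ne _ _ (by simp only [tR] at *; omega)]
          rcases Nat.lt_or_ge (r % 3) 1 with hr0 | hr0
          · have hrt : r = tR (r / 3) := by simp only [tR]; omega
            rw [hrt]
            exact h7 _ (by simp only [tR] at hr; omega)
          · rcases Nat.lt_or_ge (r % 3) 2 with hr1 | hr1
            · have hrt : r = gR (r / 3) := by simp only [gR]; omega
              rw [hrt]
              exact congrFun h2 _
            · have hrt : r = lR (r / 3) := by simp only [lR]; omega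
              have := congrFun h3 (r / 3)
              rw [Function.update_of_ne (by rintro h; exact hx (by rw [hrt, h]))] at this
              rw [hrt]
              exact this

/-! ### Polynomial time bounds -/

/-- The names that bound a sum in an expression. -/
def Ex.bounds : Ex → List ℕ
  | lit _ | glob _ | loc _ => []
  | add a b | sub a b | lett _ a b => a.bounds ++ b.bounds
  | inp a | arr _ a => a.bounds
  | ite c a b => c.bounds ++ a.bounds ++ b.bounds
  | sum _ b e => b :: e.bounds

/-- The names that bound a loop or a sum in a command. -/
def Cmd.bounds : Cmd → List ℕ
  | wr _ a v | out a v => a.bounds ++ v.bounds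
  | seq p q => p.bounds ++ q.bounds
  | ite c p q => c.bounds ++ p.bounds ++ q.bounds
  | .rep _ b p => b :: p.bounds

/-- A coefficient and an exponent for a polynomial time bound. -/
def Ex.size : Ex → ℕ
  | lit _ | glob _ | loc _ => 2
  | add a b | sub a b | lett _ a b => a.size + b.size + 6
  | inp a | arr _ a => a.size + 6
  | ite c a b => c.size + a.size + b.size + 1
  | sum _ _ e => e.size + 14

/-- A coefficient for a polynomial time bound. -/
def Cmd.size : Cmd → ℕ
  | wr _ a v | out a v => a.size + v.size + 6
  | seq p q => p.size + q.size
  | ite c p q => c.size + p.size + q.size + 1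
  | .rep _ _ p => p.size + 12

/-- `size` is coefficient and exponent at once: each nested sum contributes at most one more factor
`X + 1`. For a fixed expression this is a polynomial of fixed degree in the loop bounds. -/
theorem Ex.time_le (e : Ex) (γ : ℕ → ℤ) (X : ℕ) (h : ∀ b ∈ e.bounds, γ b ≤ X) :
    e.time γ ≤ e.size * (X + 1) ^ e.size := by
  have one : ∀ k, 1 ≤ (X + 1) ^ k := fun k => Nat.one_le_pow _ _ (Nat.succ_pos X)
  have mono : ∀ {k l}, k ≤ l → (X + 1) ^ k ≤ (X + 1) ^ l := fun h => Nat.pow_le_pow_right (Nat.succ_pos X) h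
  induction e with
  | lit | glob | loc => simp only [Ex.time, Ex.size]; nlinarith [one 2]
  | add a b iha ihb | sub a b iha ihb | lett _ a b iha ihb =>
    simp only [Ex.bounds, List.mem_append] at h
    have h1 := iha fun x hx => h x (Or.inl hx)
    have h2 := ihb fun x hx => h x (Or.inr hx)
    simp only [Ex.time, Ex.size]
    nlinarith [Nat.mul_le_mul_left a.size (mono (show a.size ≤ a.size + b.size + 6 by omega)),
      Nat.mul_le_mul_left b.size (mono (show b.size ≤ a.size + b.size + 6 by omega)),
      one (a.size + b.size + 6)]
  | inp a ih | arr _ a ih =>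
    have h1 := ih h
    simp only [Ex.time, Ex.size]
    nlinarith [Nat.mul_le_mul_left a.size (mono (show a.size ≤ a.size + 6 by omega)), one (a.size + 6)]
  | ite c a b ihc iha ihb =>
    simp only [Ex.bounds, List.mem_append] at h
    have h0 := ihc fun x hx => h x (Or.inl (Or.inl hx))
    have h1 := iha fun x hx => h x (Or.inl (Or.inr hx))
    have h2 := ihb fun x hx => h x (Or.inr hx)
    simp only [Ex.time, Ex.size]
    nlinarith [Nat.mul_le_mul_left a.size (mono (show a.size ≤ c.size + a.size + b.size + 1 by omega)),
      Nat.mul_le_mul_left b.size (mono (show b.size ≤ c.size + a.size + b.size + 1 by omega)),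
      Nat.mul_le_mul_left c.size (mono (show c.size ≤ c.size + a.size + b.size + 1 by omega)),
      one (c.size + a.size + b.size + 1)]
  | sum x b e ih =>
    simp only [Ex.bounds, List.mem_cons] at h
    have h1 := ih fun x hx => h x (Or.inr hx)
    have h2 := h b (Or.inl rfl)
    have h3 : (γ b).toNat ≤ X := by omega
    simp only [Ex.time, Ex.size]
    calc (γ b).toNat * (e.time γ + 5) + 9
        ≤ X * (e.size * (X + 1) ^ e.size + 5) + 9 := by gcongr
      _ ≤ X * (e.size * (X + 1) ^ e.size + 5 * (X + 1) ^ e.size) + 9 * (X + 1) ^ e.size := by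
        have := one e.size
        gcongr <;> omega
      _ ≤ (e.size + 14) * (X + 1) ^ (e.size + 1) := by
        rw [pow_succ]
        generalize (X + 1) ^ e.size = p
        nlinarith [Nat.zero_le (p * X), Nat.zero_le (p * e.size)]
      _ ≤ _ := Nat.mul_le_mul_left _ (mono (by omega))

theorem Cmd.time_le (c : Cmd) (γ : ℕ → ℤ) (X : ℕ) (h : ∀ b ∈ c.bounds, γ b ≤ X) :
    c.time γ ≤ c.size * (X + 1) ^ c.size := by
  have one : ∀ k, 1 ≤ (X + 1) ^ k := fun k => Nat.one_le_pow _ _ (Nat.succ_pos X)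
  have mono : ∀ {k l}, k ≤ l → (X + 1) ^ k ≤ (X + 1) ^ l := fun h => Nat.pow_le_pow_right (Nat.succ_pos X) h
  induction c with
  | wr _ a b | out a b =>
    simp only [Cmd.bounds, List.mem_append] at h
    have h1 := a.time_le γ X fun x hx => h x (Or.inl hx)
    have h2 := b.time_le γ X fun x hx => h x (Or.inr hx)
    simp only [Cmd.time, Cmd.size]
    nlinarith [Nat.mul_le_mul_left a.size (mono (show a.size ≤ a.size + b.size + 6 by omega)),
      Nat.mul_le_mul_left b.size (mono (show b.size ≤ a.size + b.size + 6 by omega)),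
      one (a.size + b.size + 6)]
  | seq a b iha ihb =>
    simp only [Cmd.bounds, List.mem_append] at h
    have h1 := iha fun x hx => h x (Or.inl hx)
    have h2 := ihb fun x hx => h x (Or.inr hx)
    simp only [Cmd.time, Cmd.size]
    nlinarith [Nat.mul_le_mul_left a.size (mono (show a.size ≤ a.size + b.size by omega)),
      Nat.mul_le_mul_left b.size (mono (show b.size ≤ a.size + b.size by omega)),
      one (a.size + b.size)]
  | ite c a b iha ihb =>
    simp only [Cmd.bounds, List.mem_append] at h
    have h0 := c.time_le γ X fun x hx => h x (Or.inl (Or.inl hx))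
    have h1 := iha fun x hx => h x (Or.inl (Or.inr hx))
    have h2 := ihb fun x hx => h x (Or.inr hx)
    simp only [Cmd.time, Cmd.size]
    nlinarith [Nat.mul_le_mul_left a.size (mono (show a.size ≤ c.size + a.size + b.size + 1 by omega)),
      Nat.mul_le_mul_left b.size (mono (show b.size ≤ c.size + a.size + b.size + 1 by omega)),
      Nat.mul_le_mul_left c.size (mono (show c.size ≤ c.size + a.size + b.size + 1 by omega)),
      one (c.size + a.size + b.size + 1)]
  | rep x b e ih =>
    simp only [Cmd.bounds, List.mem_cons] at h
    have h1 := ih fun x hx => h x (Or.inr hx)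
    have h2 := h b (Or.inl rfl)
    have h3 : (γ b).toNat ≤ X := by omega
    simp only [Cmd.time, Cmd.size]
    calc (γ b).toNat * (e.time γ + 4) + 8
        ≤ X * (e.size * (X + 1) ^ e.size + 4) + 8 := by gcongr
      _ ≤ X * (e.size * (X + 1) ^ e.size + 4 * (X + 1) ^ e.size) + 8 * (X + 1) ^ e.size := by
        have := one e.size
        gcongr <;> omega
      _ ≤ (e.size + 12) * (X + 1) ^ (e.size + 1) := by
        rw [pow_succ]
        generalize (X + 1) ^ e.size = p
        nlinarith [Nat.zero_le (p * X), Nat.zero_le (p * e.size)]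
      _ ≤ _ := Nat.mul_le_mul_left _ (mono (by omega))

/-! ## Derived expressions -/

open Classical in
/-- The truth value of a proposition, as a number. -/
noncomputable def ind (P : Prop) : ℤ := if P then 1 else 0

theorem ind_pos {P : Prop} : 0 < ind P ↔ P := by
  unfold ind
  split_ifs with h <;> simp [h]

theorem ind_congr {P Q : Prop} (h : P ↔ Q) : ind P = ind Q := by rw [propext h]

theorem ind_nonneg (P : Prop) : 0 ≤ ind P := by
  unfold ind
  split_ifs <;> simp

theorem ind_of {P : Prop} (h : P) : ind P = 1 := if_pos h

theorem ind_of_not {P : Prop} (h : ¬P) : ind P = 0 := if_neg h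

theorem ind_inj {P Q : Prop} : ind P = ind Q ↔ (P ↔ Q) := by
  unfold ind
  split_ifs with h h' h' <;> simp [h, h']

namespace Ex

/-- `a < b` -/
def lt (a b : Ex) : Ex := ite (sub b a) (lit 1) (lit 0)
/-- `a ≤ b` -/
def le (a b : Ex) : Ex := ite (sub a b) (lit 0) (lit 1)
/-- negation -/
def not (a : Ex) : Ex := ite a (lit 0) (lit 1)
/-- conjunction -/
def and (a b : Ex) : Ex := ite a b (lit 0)
/-- disjunction -/
def or (a b : Ex) : Ex := ite a (lit 1) b
/-- `a = b` -/
def eq (a b : Ex) : Ex := and (le a b) (le b a)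
/-- There is `x < glob b` with `e`. -/
def ex (x b : ℕ) (e : Ex) : Ex := ite (sum x b e) (lit 1) (lit 0)
/-- The product of `a` and `c`, where `0 ≤ a ≤ glob b`. -/
def mul (b x : ℕ) (a c : Ex) : Ex := sum x b (ite (lt (loc x) a) c (lit 0))
/-- The quotient of `a` by `p`, where it is at most `glob b`. -/
def div (b x y : ℕ) (a p : Ex) : Ex := sum x b (le (mul b y (add (loc x) (lit 1)) p) a)

section Eval

variable {γ η : ℕ → ℤ} {μ : ℤ → ℤ} {a b c e p : Ex} {P Q : Prop}

theorem eval_lt : (lt a b).eval γ μ η = ind (a.eval γ μ η < b.eval γ μ η) := by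
  simp only [lt, eval, sub_pos]
  unfold ind
  split_ifs <;> rfl

theorem eval_le : (le a b).eval γ μ η = ind (a.eval γ μ η ≤ b.eval γ μ η) := by
  by_cases h : a.eval γ μ η ≤ b.eval γ μ η
  · simp [le, eval, ind, h, not_lt.2 h]
  · simp [le, eval, ind, h, not_le.1 h]

theorem eval_not (ha : a.eval γ μ η = ind P) : (not a).eval γ μ η = ind (¬P) := by
  by_cases h : P <;> simp [not, eval, ha, ind, h]

theorem eval_and (ha : a.eval γ μ η = ind P) (hb : b.eval γ μ η = ind Q) :
    (and a b).eval γ μ η = ind (P ∧ Q) := by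
  by_cases h : P <;> by_cases h' : Q <;> simp [and, eval, ha, hb, ind, h, h']

theorem eval_or (ha : a.eval γ μ η = ind P) (hb : b.eval γ μ η = ind Q) :
    (or a b).eval γ μ η = ind (P ∨ Q) := by
  by_cases h : P <;> by_cases h' : Q <;> simp [or, eval, ha, hb, ind, h, h']

theorem eval_eq : (eq a b).eval γ μ η = ind (a.eval γ μ η = b.eval γ μ η) :=
  (eval_and eval_le eval_le).trans (ind_congr le_antisymm_iff.symm)

theorem eval_ite (hc : c.eval γ μ η = ind P) [Decidable P] :
    (ite c a b).eval γ μ η = if P then a.eval γ μ η else b.eval γ μ η := by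
  by_cases h : P <;> simp [eval, hc, ind, h]

theorem eval_ex {x g n : ℕ} {R : ℕ → Prop} (hn : γ g = n)
    (h : ∀ i < n, e.eval γ μ (Function.update η x i) = ind (R i)) :
    (ex x g e).eval γ μ η = ind (∃ i < n, R i) := by
  simp only [ex, eval, hn, Int.toNat_natCast]
  rw [Finset.sum_congr rfl fun i hi => h i (Finset.mem_range.1 hi)]
  have : 0 < ∑ i ∈ Finset.range n, ind (R i) ↔ ∃ i < n, R i := by
    rw [Finset.sum_pos_iff_of_nonneg fun _ _ => ind_nonneg _]
    simp [ind_pos]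
  by_cases hR : ∃ i < n, R i
  · rw [if_pos (this.2 hR), ind_of hR]
  · rw [if_neg (mt this.1 hR), ind_of_not hR]

theorem eval_sum {x g n : ℕ} {f : ℕ → ℤ} (hn : γ g = n)
    (h : ∀ i < n, e.eval γ μ (Function.update η x i) = f i) :
    (sum x g e).eval γ μ η = ∑ i ∈ Finset.range n, f i := by
  simp only [eval, hn, Int.toNat_natCast]
  exact Finset.sum_congr rfl fun i hi => h i (Finset.mem_range.1 hi)

theorem eval_mul {x g n A : ℕ} {C : ℤ} (hn : γ g = n) (hA : A ≤ n)
    (ha : ∀ i < n, a.eval γ μ (Function.update η x i) = A)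
    (hc : ∀ i < n, c.eval γ μ (Function.update η x i) = C) :
    (mul g x a c).eval γ μ η = A * C := by
  rw [mul, eval_sum hn (f := fun i => if i < A then C else 0)]
  · rw [← Finset.sum_filter, Finset.sum_const, nsmul_eq_mul]
    have : (Finset.range n).filter (· < A) = Finset.range A := by
      ext i
      simp only [Finset.mem_filter, Finset.mem_range]
      omega
    rw [this, Finset.card_range]
  · intro i hi
    rw [eval_ite (P := i < A)]
    · simp only [hc i hi, eval]
    · rw [eval_lt, ha i hi]
      simp [eval]

theorem card_filter_mul_le {n A p : ℕ} (hp : 0 < p) (hA : A / p ≤ n) :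
    ((Finset.range n).filter fun u => (u + 1) * p ≤ A).card = A / p := by
  have : (Finset.range n).filter (fun u => (u + 1) * p ≤ A) = Finset.range (A / p) := by
    ext u
    simp only [Finset.mem_filter, Finset.mem_range, ← Nat.le_div_iff_mul_le hp]
    omega
  rw [this, Finset.card_range]

theorem sum_ind {n : ℕ} (R : ℕ → Prop) [DecidablePred R] :
    ∑ i ∈ Finset.range n, ind (R i) = ((Finset.range n).filter R).card := by
  rw [Finset.card_filter]
  push_cast
  refine Finset.sum_congr rfl fun i _ => ?_
  unfold ind
  congr

/-- The quotient is the number of `u` with `(u + 1) * B ≤ A`, which needs only multiplication by a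
counter. The hypotheses on updated environments say that the loop variables capture nothing in `a`
and `p`. -/
theorem eval_div {x y g n A B : ℕ} (hxy : x ≠ y) (hn : γ g = n) (hB : 0 < B) (hA : A / B ≤ n)
    (ha : ∀ i, a.eval γ μ (Function.update η x i) = A)
    (hp : ∀ i j, p.eval γ μ (Function.update (Function.update η x i) y j) = B) :
    (div g x y a p).eval γ μ η = ((A / B : ℕ) : ℤ) := by
  rw [div, eval_sum hn (f := fun u => ind ((u + 1) * B ≤ A)), sum_ind, card_filter_mul_le hB hA]
  intro u hu
  rw [eval_le, ha, eval_mul (A := u + 1) (C := B) hn (by omega) _ fun j _ => hp u j]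
  · norm_cast
  · intro j _
    simp [eval, hxy]

end Eval

end Ex

/-! ## The context of the algorithm -/

/-- The values of the global names: `d`, `n`, `2 n`, `2 ^ d` and `(2 n) ^ d`. -/
structure Ctx (d n : ℕ) (γ : ℕ → ℤ) : Prop where
  g0 : γ 0 = d
  g1 : γ 1 = n
  g3 : γ 3 = (2 * n : ℕ)
  g4 : γ 4 = (2 ^ d : ℕ)
  g5 : γ 5 = ((2 * n) ^ d : ℕ)

/-- Digit `j` of the number `v` in base `2 n`. -/
def digit (n v j : ℕ) : ℕ := v / (2 * n) ^ j % (2 * n)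

/-- The set of at most `d` elements with the code `v`. -/
def codeSet (d n v : ℕ) : Finset (Fin n) := Finset.univ.filter fun i => ∃ k < d, digit n v k = i

namespace Ex

/-- Digit `loc j` of `loc v`. -/
def dig (j v : ℕ) : Ex :=
  lett 90 (div 5 91 92 (loc v) (arr 1 (loc j)))
    (sub (loc 90) (mul 5 93 (div 5 91 92 (loc 90) (glob 3)) (glob 3)))

/-- `loc i` is an element of the set with code `loc v`. -/
def mem (i v : ℕ) : Ex := ex 80 0 (eq (dig 80 v) (loc i))

variable {d n : ℕ} {γ η : ℕ → ℤ} {μ : ℤ → ℤ}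

/-- A remainder is computed as `q - q / (2 n) * (2 n)` for `q = v / (2 n) ^ j`. The names from 90 on
are scratch, hence the bounds on `j` and `v`. -/
theorem eval_dig (hγ : Ctx d n γ) (hn : 0 < n) (hμ : ∀ j ≤ d, μ (adr 1 j) = ((2 * n) ^ j : ℕ)) {j v : ℕ}
    (hj : j < 90) (hv : v < 90) {jj vv : ℕ} (hjj : η j = jj) (hvv : η v = vv) (hjd : jj < d)
    (hvN : vv < (2 * n) ^ d) : (dig j v).eval γ μ η = digit n vv jj := by
  have hp : 0 < (2 * n) ^ jj := by positivity
  have h1 : (div 5 91 92 (loc v) (arr 1 (loc j))).eval γ μ η = ((vv / (2 * n) ^ jj : ℕ) : ℤ) := by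
    refine eval_div (by norm_num) hγ.g5 hp ((Nat.div_le_self _ _).trans hvN.le) (fun i => ?_) fun i k => ?_
    · simp [eval, Function.update_of_ne (show v ≠ 91 by omega), hvv]
    · simp [eval, Function.update_of_ne (show j ≠ 91 by omega),
        Function.update_of_ne (show j ≠ 92 by omega), hjj, hμ jj hjd.le]
  set q := vv / (2 * n) ^ jj with hq
  have hqN : q ≤ (2 * n) ^ d := (Nat.div_le_self _ _).trans hvN.le
  have hqN' : q / (2 * n) ≤ (2 * n) ^ d := (Nat.div_le_self _ _).trans hqN
  rw [dig, eval, h1, eval, eval_mul (A := q / (2 * n)) (C := (2 * n : ℕ)) hγ.g5 hqN']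
  · simp only [eval, Function.update_self]
    rw [digit, ← hq]
    have := Nat.div_add_mod q (2 * n)
    push_cast
    have h2 : ((2 * n : ℕ) : ℤ) * (q / (2 * n) : ℕ) + (q % (2 * n) : ℕ) = q := by exact_mod_cast this
    push_cast at h2
    linarith
  · intro i _
    refine eval_div (by norm_num) hγ.g5 (by omega) hqN' (fun i => ?_) fun i k => ?_
    · simp [eval]
    · simp [eval, hγ.g3]
  · intro i _
    simp [eval, hγ.g3]

theorem eval_mem (hγ : Ctx d n γ) (hn : 0 < n) (hμ : ∀ j ≤ d, μ (adr 1 j) = ((2 * n) ^ j : ℕ)) {i v : ℕ}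
    (hi : i < 80) (hv : v < 80) {ii : Fin n} {vv : ℕ} (hii : η i = (ii : ℕ)) (hvv : η v = vv)
    (hvN : vv < (2 * n) ^ d) : (mem i v).eval γ μ η = ind (ii ∈ codeSet d n vv) := by
  rw [mem, eval_ex (R := fun k => digit n vv k = ii) hγ.g0]
  · simp [codeSet]
  · intro k hk
    rw [eval_eq, eval_dig hγ hn hμ (by norm_num) (by omega) (Function.update_self _ _ _)
      (by rw [Function.update_of_ne (by omega), hvv]) hk hvN]
    rw [eval, Function.update_of_ne (by omega), hii]
    norm_cast

end Ex

/-! ## The value of an assignment from the table of literal patterns -/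

/-- The assignment that is `-1` on `X` and `1` elsewhere. -/
def signs {n : ℕ} (X : Finset (Fin n)) : Fin n → ℤˣ := fun i => if i ∈ X then -1 else 1

/-- The value of the assignment that is `-1` on `X` and `1` elsewhere. -/
def CSP.setVal {d n : ℕ} (I : CSP d n) (X : Finset (Fin n)) : ℕ := I.val (signs X)

/-- The literal, a number below `2 n`, for a variable and a sign. -/
def literal {n : ℕ} (i : Fin n) (s : Bool) : Fin (2 * n) :=
  ⟨i + if s then n else 0, by have := i.2; split_ifs <;> omega⟩

/-- The code of the literals that the pattern `b` of the constraint `C` requires. -/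
def Constraint.key {d n : ℕ} (C : Constraint d n) (b : ℕ) : ℕ :=
  finFunctionFinEquiv fun j : Fin d => literal (C.scope j) (b.testBit j)

/-- The number of constraints and patterns with code `v`. -/
def patternCount {d n : ℕ} (l : List (Constraint d n)) (v : ℕ) : ℕ :=
  (l.map fun C => ∑ b ∈ Finset.range (2 ^ d), if pattern d b ∈ C.pred ∧ C.key b = v then 1 else 0).sum

/-- The assignment given by `X` falsifies the literal `l`. -/
def Falsifies {n : ℕ} (X : Finset (Fin n)) (l : ℕ) : Prop :=
  ∃ i : Fin n, (l = i ∧ i ∈ X) ∨ (l = i + n ∧ i ∉ X)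

/-- Literal `i` demands the value `1` of variable `i` and literal `i + n` the value `-1`, in
accordance with the bits of `pattern`. -/
theorem falsifies_literal {n : ℕ} {X : Finset (Fin n)} {i : Fin n} {s : Bool} :
    Falsifies X (literal i s) ↔ (decide (i ∈ X) ≠ s) := by
  have hi := i.2
  cases s
  · simp only [Falsifies, literal, Bool.false_eq_true, if_false, add_zero]
    constructor
    · rintro ⟨j, ⟨h, hj⟩ | ⟨h, hj⟩⟩
      · rw [Fin.ext h]; simpa using hj
      · omega
    · intro h
      exact ⟨i, Or.inl ⟨rfl, by simpa using h⟩⟩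
  · simp only [Falsifies, literal, if_true]
    constructor
    · rintro ⟨j, ⟨h, hj⟩ | ⟨h, hj⟩⟩
      · omega
      · rw [Fin.ext (show (i : ℕ) = j by omega)]; simpa using hj
    · intro h
      exact ⟨i, Or.inr ⟨rfl, by simpa using h⟩⟩

theorem digit_finFunctionFinEquiv {d n : ℕ} (f : Fin d → Fin (2 * n)) (j : Fin d) :
    digit n (finFunctionFinEquiv f) j = f j := by
  have := congrArg Fin.val (congrFun (finFunctionFinEquiv.symm_apply_apply f) j)
  rwa [finFunctionFinEquiv_symm_apply_val] at this

theorem Constraint.key_lt {d n : ℕ} (C : Constraint d n) (b : ℕ) : C.key b < (2 * n) ^ d :=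
  Fin.is_lt _

theorem Constraint.digit_key {d n : ℕ} (C : Constraint d n) (b : ℕ) (j : Fin d) :
    digit n (C.key b) j = literal (C.scope j) (b.testBit j) := by
  rw [Constraint.key, digit_finFunctionFinEquiv]

theorem pattern_injOn (d : ℕ) : Set.InjOn (pattern d) (Finset.range (2 ^ d) : Finset ℕ) := by
  intro a ha b hb h
  rw [Finset.mem_coe, Finset.mem_range] at ha hb
  refine Nat.eq_of_testBit_eq fun j => ?_
  rcases lt_or_ge j d with hj | hj
  · have := congrFun h ⟨j, hj⟩
    simp only [pattern] at this
    cases h1 : a.testBit j <;> cases h2 : b.testBit j <;> simp_all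
  · rw [Nat.testBit_lt_two_pow (ha.trans_le (Nat.pow_le_pow_right (by norm_num) hj)),
      Nat.testBit_lt_two_pow (hb.trans_le (Nat.pow_le_pow_right (by norm_num) hj))]

theorem exists_pattern_eq (d : ℕ) (p : Fin d → ℤˣ) : ∃ b < 2 ^ d, pattern d b = p := by
  have hc : (Finset.image (pattern d) (Finset.range (2 ^ d))) = Finset.univ := by
    rw [← Finset.card_eq_iff_eq_univ, Finset.card_image_of_injOn (pattern_injOn d)]
    simp
  have := Finset.mem_univ p
  rw [← hc] at this
  simpa using this

theorem pattern_eq_iff {d n : ℕ} (C : Constraint d n) (X : Finset (Fin n)) (b : ℕ) :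
    pattern d b = (fun j => signs X (C.scope j)) ↔
      ¬∃ j < d, Falsifies X (digit n (C.key b) j) := by
  push Not
  rw [funext_iff]
  have : ∀ j : Fin d, pattern d b j = signs X (C.scope j) ↔ ¬Falsifies X (digit n (C.key b) j) := by
    intro j
    rw [C.digit_key, falsifies_literal]
    simp only [pattern, signs]
    by_cases h : C.scope j ∈ X <;> cases b.testBit j <;> simp [h]
  simp only [this]
  exact ⟨fun h j hj => h ⟨j, hj⟩, fun h j => h j j.2⟩

open Classical in
/-- The value of an assignment is the number of patterns none of whose literals it falsifies. -/
theorem CSP.setVal_eq_sum {d n : ℕ} (I : CSP d n) (X : Finset (Fin n)) :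
    I.setVal X = ∑ v ∈ Finset.range ((2 * n) ^ d),
      if ∃ j < d, Falsifies X (digit n v j) then 0 else patternCount I.constraints v := by
  obtain ⟨l⟩ := I
  simp only [CSP.setVal, CSP.val]
  induction l with
  | nil => simp [patternCount]
  | cons C l ih =>
    simp only [patternCount] at ih
    simp only [patternCount, List.countP_cons, List.map_cons, List.sum_cons]
    rw [ih]
    have : ∀ v, (if ∃ j < d, Falsifies X (digit n v j) then 0 else
        ∑ b ∈ Finset.range (2 ^ d), (if pattern d b ∈ C.pred ∧ C.key b = v then 1 else 0) +
          (l.map fun C => ∑ b ∈ Finset.range (2 ^ d), if pattern d b ∈ C.pred ∧ C.key b = v then 1 else 0).sum) =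
        (∑ b ∈ Finset.range (2 ^ d), if C.key b = v then (if pattern d b ∈ C.pred ∧
          ¬∃ j < d, Falsifies X (digit n (C.key b) j) then 1 else 0) else 0) +
        if ∃ j < d, Falsifies X (digit n v j) then 0 else
          (l.map fun C => ∑ b ∈ Finset.range (2 ^ d), if pattern d b ∈ C.pred ∧ C.key b = v then 1 else 0).sum := by
      intro v
      by_cases h : ∃ j < d, Falsifies X (digit n v j)
      · rw [if_pos h, if_pos h, add_zero, Finset.sum_eq_zero]
        intro b _
        split_ifs with h1 h2
        · exact absurd (h1 ▸ h) h2.2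
        · rfl
        · rfl
      · rw [if_neg h, if_neg h]
        congr 1
        refine Finset.sum_congr rfl fun b _ => ?_
        by_cases h1 : C.key b = v
        · subst h1
          simp only [h, and_true, not_false_eq_true, if_true]
        · simp [h1]
    rw [Finset.sum_congr rfl fun v _ => this v, Finset.sum_add_distrib, add_comm]
    congr 1
    rw [Finset.sum_comm]
    have h2 : ∀ b ∈ Finset.range (2 ^ d), (∑ v ∈ Finset.range ((2 * n) ^ d), if C.key b = v then
        (if pattern d b ∈ C.pred ∧ ¬∃ j < d, Falsifies X (digit n (C.key b) j) then 1 else 0) else 0) =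
        if pattern d b ∈ C.pred ∧ pattern d b = (fun j => signs X (C.scope j)) then 1 else 0 := by
      intro b _
      rw [Finset.sum_ite_eq, if_pos (Finset.mem_range.2 (C.key_lt b))]
      exact if_congr (and_congr_right fun _ => (pattern_eq_iff C X b).symm) rfl rfl
    rw [Finset.sum_congr rfl h2]
    -- Exactly one of the `2 ^ d` patterns is the restriction of the assignment to the scope, so a
    -- satisfied constraint is counted once.
    obtain ⟨b₀, hb₀, he⟩ := exists_pattern_eq d fun j => signs X (C.scope j)
    rw [Finset.sum_eq_single b₀]
    · simp [he]
    · intro b hb hne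
      rw [if_neg]
      rintro ⟨_, h⟩
      exact hne (pattern_injOn d hb (by simpa using hb₀) (h.trans he.symm))
    · simp [hb₀]

namespace Ex

/-- The value of the assignment that is `-1` at `i` if and only if `y` holds for `loc 30 = i`. -/
def val (y : Ex) : Ex :=
  sum 20 5 <| ite
    (ex 21 0 <| lett 22 (dig 21 20) <| ite (lt (loc 22) (glob 1)) (lett 30 (loc 22) y)
      (lett 30 (sub (loc 22) (glob 1)) (not y)))
    (lit 0) (arr 4 (loc 20))

/-- The tables in the memory: the powers of `2 n` and `2`, the numbers of patterns, and `n / 2`. -/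
structure _root_.Tables {d n : ℕ} (I : CSP d n) (μ : ℤ → ℤ) : Prop where
  pow : ∀ j ≤ d, μ (adr 1 j) = ((2 * n) ^ j : ℕ)
  two : ∀ j ≤ d, μ (adr 2 j) = (2 ^ j : ℕ)
  count : ∀ v < (2 * n) ^ d, μ (adr 4 v) = patternCount I.constraints v
  half : μ (adr 6 2) = (n / 2 : ℕ)

variable {d n : ℕ} {γ η : ℕ → ℤ} {μ : ℤ → ℤ} {I : CSP d n}

/-- Only the table of counts is read, so an evaluation costs nothing per constraint. The set may be
described by any expression in `loc 30` and names below 20, which the evaluation leaves alone. -/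
theorem eval_val (hγ : Ctx d n γ) (hn : 0 < n) (hμ : Tables I μ) {y : Ex} {X : Finset (Fin n)}
    (hy : ∀ η' : ℕ → ℤ, (∀ x < 20, η' x = η x) → ∀ i : Fin n, η' 30 = (i : ℕ) →
      y.eval γ μ η' = ind (i ∈ X)) :
    (val y).eval γ μ η = I.setVal X := by
  classical
  rw [I.setVal_eq_sum, val, eval_sum hγ.g5 (f := fun v => if ∃ j < d, Falsifies X (digit n v j) then 0
    else (patternCount I.constraints v : ℤ))]
  · push_cast
    rfl
  intro v hv
  rw [eval_ite (P := ∃ j < d, Falsifies X (digit n v j))]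
  · simp only [eval, Function.update_self, hμ.count v hv]
  refine eval_ex hγ.g0 fun j hj => ?_
  rw [eval, eval_dig hγ hn hμ.pow (by norm_num) (by norm_num) (Function.update_self _ _ _)
    (by simp) hj hv, eval_ite eval_lt]
  set l := digit n v j with hl
  have hl2 : l < 2 * n := Nat.mod_lt _ (by omega)
  simp only [eval, Function.update_self, hγ.g1]
  split_ifs with h
  · have h' : l < n := by exact_mod_cast h
    rw [hy _ (fun x hx => ?_) ⟨l, h'⟩ (Function.update_self _ _ _)]
    · refine ind_congr ⟨fun h => ⟨_, Or.inl ⟨rfl, h⟩⟩, ?_⟩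
      rintro ⟨i, ⟨h1, hi⟩ | ⟨h1, hi⟩⟩
      · exact (Fin.ext h1 : (⟨l, h'⟩ : Fin n) = i) ▸ hi
      · omega
    · rw [Function.update_of_ne, Function.update_of_ne, Function.update_of_ne, Function.update_of_ne] <;> omega
  · have h' : n ≤ l := by exact_mod_cast not_lt.1 h
    rw [eval_not (hy _ (fun x hx => ?_) ⟨l - n, by omega⟩ ?_)]
    · refine ind_congr ⟨fun h => ⟨_, Or.inr ⟨by simp only; omega, h⟩⟩, ?_⟩
      rintro ⟨i, ⟨h1, hi⟩ | ⟨h1, hi⟩⟩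
      · omega
      · convert hi
        omega
    · rw [Function.update_self]
      push_cast [h']
      rfl
    · rw [Function.update_of_ne, Function.update_of_ne, Function.update_of_ne, Function.update_of_ne] <;> omega

end Ex

/-! ## Assignments as sets -/

section Value

variable {d n : ℕ}

theorem CSP.setVal_mem_lowDegree (I : CSP d n) :
    (fun X => (I.setVal X : ℚ)) ∈ lowDegree (Fin n) ℚ d := by
  obtain ⟨l⟩ := I
  induction l with
  | nil => simpa [CSP.setVal, CSP.val] using const_mem_lowDegree (ι := Fin n) d (0 : ℚ)
  | cons C l ih =>
    have h : (fun X : Finset (Fin n) => if (fun j => signs X (C.scope j)) ∈ C.pred then (1 : ℚ) else 0) ∈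
        lowDegree (Fin n) ℚ d := by
      refine mem_lowDegree_of_dependsOn (Finset.univ.image C.scope)
        (Finset.card_image_le.trans (by simp)) fun X Y e => ?_
      rw [inter_eq_inter_iff] at e
      have : (fun j => signs X (C.scope j)) = fun j => signs Y (C.scope j) := by
        funext j
        have := e (C.scope j) (Finset.mem_image_of_mem _ (Finset.mem_univ j))
        simp only [signs, this]
      rw [this]
    convert add_mem ih h using 1
    funext X
    simp only [CSP.setVal, CSP.val, List.countP_cons, Pi.add_apply, decide_eq_true_eq]
    push_cast
    rfl

/-- The set of coordinates at which an assignment is `-1`. -/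
def negSet (x : Fin n → ℤˣ) : Finset (Fin n) := Finset.univ.filter fun i => x i = -1

theorem signs_negSet (x : Fin n → ℤˣ) : signs (negSet x) = x := by
  funext i
  rcases Int.units_eq_one_or (x i) with h | h <;> simp [signs, negSet, h]

theorem negSet_signs (X : Finset (Fin n)) : negSet (signs X) = X := by
  ext i
  by_cases h : i ∈ X <;> simp [signs, negSet, h]

theorem sum_signs (X : Finset (Fin n)) : ∑ i, (signs X i : ℤ) = n - 2 * X.card := by
  have : ∀ i, ((signs X i : ℤˣ) : ℤ) = 1 - 2 * if i ∈ X then 1 else 0 := fun i => by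
    by_cases h : i ∈ X <;> simp [signs, h]
  simp only [this]
  simp [Finset.sum_sub_distrib, mul_comm]

theorem signs_mem_bisections {h : ℕ} (hn : n = 2 * h) {X : Finset (Fin n)} :
    signs X ∈ bisections n ↔ X.card = h := by
  rw [bisections, Finset.mem_filter, sum_signs]
  simp only [Finset.mem_univ, true_and]
  omega

theorem sum_bisections {h : ℕ} (hn : n = 2 * h) (F : (Fin n → ℤˣ) → ℚ) :
    ∑ x ∈ bisections n, F x = ∑ X ∈ Finset.univ.powersetCard h, F (signs X) := by
  refine Finset.sum_nbij' negSet signs (fun x hx => ?_) (fun X hX => ?_) (fun x _ => signs_negSet x)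
    (fun X _ => negSet_signs X) fun x _ => by rw [signs_negSet]
  · rw [Finset.mem_powersetCard_univ, ← signs_mem_bisections hn, signs_negSet]
    exact hx
  · exact (signs_mem_bisections hn).2 (Finset.mem_powersetCard_univ.1 hX)

theorem CSP.avg_eq {h : ℕ} (hn : n = 2 * h) (I : CSP d n) :
    I.avg = (∑ X ∈ Finset.univ.powersetCard h, (I.setVal X : ℚ)) /
      (Finset.univ.powersetCard h : Finset (Finset (Fin n))).card := by
  rw [CSP.avg, sum_bisections hn]
  congr 1
  have := sum_bisections hn fun _ => 1
  simpa using this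

theorem CSP.setVal_le_opt {h : ℕ} (hn : n = 2 * h) (I : CSP d n) {X : Finset (Fin n)} (hX : X.card = h) :
    I.setVal X ≤ I.opt :=
  Finset.le_sup (f := I.val) ((signs_mem_bisections hn).2 hX)

/-! ## Pairs of variables that are not interchangeable -/

/-- The set of the first `n / 2` elements, without the set with code `u` and with the set with
code `v`. -/
def ballSet (d n u v : ℕ) : Finset (Fin n) :=
  codeSet d n v ∪ (Finset.univ.filter (fun i : Fin n => (i : ℕ) < n / 2) \ codeSet d n u)

/-- Exchanging `a` and `b` changes the value of a bisection close to the first `n / 2` elements. -/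
def Distinguishes (I : CSP d n) (a b : Fin n) : Prop :=
  ∃ u < (2 * n) ^ d, ∃ v < (2 * n) ^ d, (ballSet d n u v).card = n / 2 ∧
    I.setVal (ballSet d n u v) ≠ I.setVal (swapAt a b (ballSet d n u v))

theorem card_codeSet_le (v : ℕ) : (codeSet d n v).card ≤ d := by
  have : (codeSet d n v).image Fin.val ⊆ (Finset.range d).image (digit n v) := by
    intro i hi
    obtain ⟨j, hj, rfl⟩ := Finset.mem_image.1 hi
    obtain ⟨k, hk, h⟩ := (Finset.mem_filter.1 hj).2
    exact Finset.mem_image.2 ⟨k, Finset.mem_range.2 hk, h⟩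
  have h1 := Finset.card_le_card this
  rw [Finset.card_image_of_injective _ Fin.val_injective] at h1
  exact h1.trans (Finset.card_image_le.trans (by simp))

theorem exists_codeSet_eq (hn : 0 < n) {T : Finset (Fin n)} (hT : T.card ≤ d) :
    ∃ v < (2 * n) ^ d, codeSet d n v = T := by
  -- The digit `n` is no variable and pads the codes of sets with fewer than `d` elements.
  let f : Fin d → Fin (2 * n) := fun k =>
    if hk : (k : ℕ) < T.card then ⟨T.orderEmbOfFin rfl ⟨k, hk⟩, by omega⟩ else ⟨n, by omega⟩
  refine ⟨finFunctionFinEquiv f, Fin.is_lt _, ?_⟩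
  ext i
  simp only [codeSet, Finset.mem_filter, Finset.mem_univ, true_and]
  constructor
  · rintro ⟨k, hk, h⟩
    rw [show k = (⟨k, hk⟩ : Fin d) from rfl, digit_finFunctionFinEquiv] at h
    simp only [f] at h
    split_ifs at h with hc
    · have h2 : T.orderEmbOfFin rfl ⟨k, hc⟩ = i := Fin.ext h
      rw [← h2]
      exact Finset.orderEmbOfFin_mem _ _ _
    · simp only at h
      omega
  · intro hi
    have : i ∈ Set.range (T.orderEmbOfFin rfl) := by rwa [Finset.range_orderEmbOfFin]
    obtain ⟨k, rfl⟩ := this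
    refine ⟨k, k.2.trans_le hT, ?_⟩
    rw [show (k : ℕ) = (⟨k, k.2.trans_le hT⟩ : Fin d) from rfl, digit_finFunctionFinEquiv]
    simp [f]

theorem swapAt_mem_lowDegree {f : Finset (Fin n) → ℚ} (hf : f ∈ lowDegree (Fin n) ℚ d) (a b : Fin n) :
    (fun X => f (swapAt a b X)) ∈ lowDegree (Fin n) ℚ d :=
  lowDegree_comp hf _ fun T => ⟨T.image (Equiv.swap a b), Finset.card_image_le, fun Z Z' e => by
    rw [inter_eq_inter_iff] at e ⊢
    intro i hi
    rw [mem_swapAt, mem_swapAt]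
    exact e _ (Finset.mem_image_of_mem _ hi)⟩

/-- The change of value under the exchange has degree `d` in `X`. `Distinguishes` inspects it on the
ball of radius `d` around the first `n / 2` variables, and vanishing there forces vanishing on the
whole slice. -/
theorem setVal_swapAt_eq (hn : 0 < n) {h : ℕ} (hnh : n = 2 * h) (I : CSP d n) {a b : Fin n}
    (hab : ¬Distinguishes I a b) {X : Finset (Fin n)} (hX : X.card = h) :
    I.setVal X = I.setVal (swapAt a b X) := by
  set X₀ := Finset.univ.filter (fun i : Fin n => (i : ℕ) < n / 2) with hX₀
  have hc : X₀.card = h := by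
    rw [hX₀, Fin.card_filter_val_lt]
    omega
  have key := eq_zero_of_eq_zero_on_ball
    (sub_mem I.setVal_mem_lowDegree (swapAt_mem_lowDegree I.setVal_mem_lowDegree a b)) hc (fun X hX hd => ?_) hX
  · simp only [Pi.sub_apply, sub_eq_zero] at key
    exact_mod_cast key
  -- A set in the ball is given by what it adds to the centre and what it removes, each of at most
  -- `d` elements because the two sets have the same size.
  · obtain ⟨v, hv, hv'⟩ := exists_codeSet_eq hn hd
    have hd' : (X₀ \ X).card ≤ d := by rwa [← Finset.card_sdiff_comm (hX.trans hc.symm)]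
    obtain ⟨u, hu, hu'⟩ := exists_codeSet_eq hn hd'
    have hb : ballSet d n u v = X := by
      rw [ballSet, hu', hv', ← hX₀, sdiff_sdiff_right_self, Finset.inf_eq_inter, Finset.inter_comm,
        Finset.sdiff_union_inter]
    by_contra hne
    refine hab ⟨u, hu, v, hv, by rw [hb]; omega, ?_⟩
    rw [hb]
    intro e
    simp only [Pi.sub_apply, e, sub_self, not_true] at hne

theorem Distinguishes.ne {I : CSP d n} {a b : Fin n} (h : Distinguishes I a b) : a ≠ b := by
  rintro rfl
  obtain ⟨u, _, v, _, _, h⟩ := h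
  exact h (by rw [swapAt_eq_self Iff.rfl])

/-- Many disjoint pairs of variables that are not interchangeable force a large optimum. -/
theorem avg_add_le_opt {h t : ℕ} (hnh : n = 2 * h) (I : CSP (d + 1) n) {π : Fin n → Fin n}
    (hπ : Function.Involutive π) {S : Finset (Fin n)} (hS : ∀ i, i ∈ S ↔ π i ≠ i)
    (hD : ∀ i ∈ S, Distinguishes I i (π i))
    (hc : 2 * (4 * (d + 1) * 144 ^ (d + 1) * t ^ 2) ≤ S.card) : I.avg + t ≤ I.opt := by
  -- Each pair is represented by its smaller element, so the representatives make up at least half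
  -- of `S`; the smaller element is also the label of both below.
  obtain ⟨s, hs, hsc⟩ : ∃ s ⊆ S.filter fun k => k < π k, s.card = 4 * (d + 1) * 144 ^ (d + 1) * t ^ 2 := by
    refine Finset.exists_subset_card_eq ?_
    have : S ⊆ S.filter (fun k => k < π k) ∪ (S.filter fun k => k < π k).image π := by
      intro k hk
      rcases lt_or_gt_of_ne ((hS k).1 hk) with h | h
      · refine Finset.mem_union_right _ (Finset.mem_image.2 ⟨π k, Finset.mem_filter.2 ⟨?_, ?_⟩, hπ k⟩)
        · rw [hS, hπ k]
          exact h.ne'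
        · rwa [hπ k]
      · exact Finset.mem_union_left _ (Finset.mem_filter.2 ⟨hk, h⟩)
    have h1 := (Finset.card_le_card this).trans (Finset.card_union_le _ _)
    have h2 := Finset.card_image_le (s := S.filter fun k => k < π k) (f := π)
    omega
  have hlt : ∀ i ∈ s, i ∈ S ∧ i < π i := fun i hi => Finset.mem_filter.1 (hs hi)
  obtain ⟨X, hX, hle⟩ := exists_average_add_le (ℓ := fun k => min k (π k)) (t := t)
    (by rw [Fintype.card_fin, hnh]) I.setVal_mem_lowDegree
    (fun X Y hne => by
      have hne' : ((I.setVal X : ℤ) - I.setVal Y) ≠ 0 := fun h => hne (by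
        have : (I.setVal X : ℤ) = I.setVal Y := by omega
        exact_mod_cast this)
      have : 1 ≤ ((I.setVal X : ℤ) - I.setVal Y) ^ 2 := by
        have := sq_pos_of_ne_zero hne'
        omega
      exact_mod_cast this) hπ
    (fun k => by simp only [hπ k, min_comm]) s hsc
    (fun i hi k => by
      have := (hlt i hi).2
      constructor
      · intro h
        rcases min_choice k (π k) with h' | h'
        · exact Or.inl (h'.symm.trans h)
        · right
          rw [← h, h', hπ k]
      · rintro (rfl | rfl)
        · exact min_eq_left this.le
        · simp only [hπ i]
          exact min_eq_right this.le)
    (fun i hi => by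
      obtain ⟨u, _, v, _, hcard, hne⟩ := hD i (hlt i hi).1
      exact ⟨_, hcard.trans (by omega), by exact_mod_cast hne⟩)
  rw [I.avg_eq hnh]
  exact hle.trans (by exact_mod_cast I.setVal_le_opt hnh hX)

/-! ## The kernel -/

/-- Extend `U ⊆ S` to a set of size `h` by the first elements outside `S`. -/
def extendSet (S : Finset (Fin n)) (h : ℕ) (U : Finset (Fin n)) : Finset (Fin n) :=
  U ∪ Finset.univ.filter fun i => i ∉ S ∧ U.card + (Finset.univ.filter fun j => j < i ∧ j ∉ S).card < h

/-- Ranks are strictly increasing on `B` and hence run exactly through the numbers below `B.card`.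
This gives `extendSet` the right size. -/
theorem card_filter_rank_lt (B : Finset (Fin n)) {k : ℕ} (hk : k ≤ B.card) :
    (B.filter fun i => (B.filter (· < i)).card < k).card = k := by
  have hmono : ∀ i ∈ B, ∀ j, i < j → (B.filter (· < i)).card < (B.filter (· < j)).card := by
    intro i hi j hij
    refine Finset.card_lt_card (Finset.ssubset_iff_of_subset (fun l hl => ?_) |>.2 ⟨i, ?_, ?_⟩)
    · rw [Finset.mem_filter] at hl ⊢
      exact ⟨hl.1, hl.2.trans hij⟩
    · exact Finset.mem_filter.2 ⟨hi, hij⟩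
    · simp
  have hinj : Set.InjOn (fun i => (B.filter (· < i)).card) B := by
    intro i hi j hj e
    rcases lt_trichotomy i j with h | h | h
    · exact absurd e (hmono i hi j h).ne
    · exact h
    · exact absurd e (hmono j hj i h).ne'
  have himg : B.image (fun i => (B.filter (· < i)).card) = Finset.range B.card := by
    refine Finset.eq_of_subset_of_card_le (fun r hr => ?_) ?_
    · obtain ⟨i, hi, rfl⟩ := Finset.mem_image.1 hr
      rw [Finset.mem_range]
      refine Finset.card_lt_card (Finset.ssubset_iff_of_subset (Finset.filter_subset _ _) |>.2 ⟨i, hi, ?_⟩)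
      simp
    · rw [Finset.card_image_of_injOn hinj, Finset.card_range]
  have h1 : (B.filter fun i => (B.filter (· < i)).card < k).image (fun i => (B.filter (· < i)).card) =
      Finset.range k := by
    ext r
    rw [Finset.mem_image, Finset.mem_range]
    constructor
    · rintro ⟨i, hi, rfl⟩
      exact (Finset.mem_filter.1 hi).2
    · intro hr
      have : r ∈ B.image (fun i => (B.filter (· < i)).card) := by
        rw [himg, Finset.mem_range]
        omega
      obtain ⟨i, hi, rfl⟩ := Finset.mem_image.1 this
      exact ⟨i, Finset.mem_filter.2 ⟨hi, hr⟩, rfl⟩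
  rw [← Finset.card_image_of_injOn (hinj.mono (Finset.coe_subset.2 (Finset.filter_subset _ _))), h1,
    Finset.card_range]

/-- The coefficient of the monomial `W` of the kernel on `S`, times `2 ^ d`. -/
def CSP.coef (I : CSP d n) (S : Finset (Fin n)) (W : Finset (Fin n)) : ℤ :=
  ∑ T ∈ S.powerset.filter (·.card ≤ d), if W ⊆ T then ∑ U ∈ T.powerset,
    (-1) ^ (W.card + T.card + U.card) * (2 ^ (d - T.card) * I.setVal (extendSet S (n / 2) U)) else 0

/-- The alternating sums of high order that have to vanish for a kernel on `S`. -/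
def CSP.IsJunta (I : CSP d n) (S : Finset (Fin n)) : Prop :=
  (∀ T ⊆ S, d < T.card → ∑ U ∈ T.powerset, (-1) ^ U.card * (I.setVal (extendSet S (n / 2) U) : ℚ) = 0) ∧
    ∀ X : Finset (Fin n), X.card = n / 2 → I.setVal (extendSet S (n / 2) (X ∩ S)) = I.setVal X

/-- Nothing is left to extend, so this is the plain vanishing of high alternating sums. It covers
small `n`, where the marked set could exceed `n / 2`. -/
theorem CSP.isJunta_univ (I : CSP d n) : I.IsJunta Finset.univ := by
  have : ∀ U : Finset (Fin n), extendSet Finset.univ (n / 2) U = U := fun U => by simp [extendSet]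
  refine ⟨fun T _ hT => ?_, fun X _ => ?_⟩
  · simp only [this]
    simpa using sum_powerset_neg_one_pow_eq_zero I.setVal_mem_lowDegree hT
  · rw [this, Finset.inter_univ]

/-- Any two variables outside `S` are interchangeable, so only the size of `X \ S` matters, and that
is fixed by `X ∩ S`. The canonical extension therefore has the value of `X`, and the high
alternating sums vanish by `sum_extension_eq_zero`, where `S.card ≤ h` provides enough partners
outside `S`. -/
theorem CSP.isJunta_of_forall (hn : 0 < n) {h : ℕ} (hnh : n = 2 * h) (I : CSP d n) {S : Finset (Fin n)}
    (hS : S.card ≤ h) (hD : ∀ a ∉ S, ∀ b ∉ S, ¬Distinguishes I a b) : I.IsJunta S := by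
  have hh : n / 2 = h := by omega
  have hSc : h ≤ Sᶜ.card := by
    rw [Finset.card_compl, Fintype.card_fin]
    omega
  have hinv : ∀ X : Finset (Fin n), X.card = h → ∀ a ∈ X, a ∉ S → ∀ b, b ∉ X → b ∉ S →
      (I.setVal X : ℚ) = I.setVal (insert b (X.erase a)) := by
    intro X hX a ha haS b hb hbS
    rw [setVal_swapAt_eq hn hnh I (hD a haS b hbS) hX, swapAt_eq_insert_erase ha hb]
  have hext : ∀ U : Finset (Fin n), U.card ≤ h → ∃ E ⊆ Sᶜ, U.card + E.card = h ∧ extendSet S h U = U ∪ E := by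
    intro U hUh
    refine ⟨_, ?_, ?_, rfl⟩
    · intro i hi
      simpa using (Finset.mem_filter.1 hi).2.1
    · have hr := card_filter_rank_lt Sᶜ (k := h - U.card) (by omega)
      have : (Finset.univ.filter fun i => i ∉ S ∧
          U.card + (Finset.univ.filter fun j => j < i ∧ j ∉ S).card < h) =
          Sᶜ.filter fun i => (Sᶜ.filter (· < i)).card < h - U.card := by
        ext i
        have : Sᶜ.filter (· < i) = Finset.univ.filter fun j => j < i ∧ j ∉ S := by
          ext j
          simp [and_comm]
        rw [Finset.mem_filter, Finset.mem_filter, this]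
        simp only [Finset.mem_univ, true_and, Finset.mem_compl]
        constructor <;> rintro ⟨h1, h2⟩ <;> exact ⟨h1, by omega⟩
      rw [this, hr]
      omega
  rw [IsJunta, hh]
  constructor
  · intro T hTS hT
    refine sum_extension_eq_zero I.setVal_mem_lowDegree hinv hS hSc (fun U hU => ?_) hTS hT
    obtain ⟨E, hE, hc, he⟩ := hext U ((Finset.card_le_card hU).trans hS)
    exact ⟨E, hE, hc, by rw [he]⟩
  · intro X hX
    obtain ⟨E, hE, hc, he⟩ := hext (X ∩ S) ((Finset.card_le_card Finset.inter_subset_left).trans hX.le)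
    rw [he]
    have hXS : X ∩ S ∪ X \ S = X := by rw [Finset.union_comm, Finset.sdiff_union_inter]
    conv_rhs => rw [← hXS]
    have hcX := Finset.card_inter_add_card_sdiff X S
    refine eq_of_exchange_invariant (F := fun E => I.setVal (X ∩ S ∪ E)) (B := Sᶜ) (m := h - (X ∩ S).card)
      ?_ (Finset.mem_powersetCard.2 ⟨hE, by omega⟩) (Finset.mem_powersetCard.2 ⟨fun i hi => ?_, by omega⟩)
    · intro Y hY a ha b hb hbY
      rw [Finset.mem_powersetCard] at hY
      have haS : a ∉ S := by simpa using hY.1 ha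
      have hbS : b ∉ S := by simpa using hb
      have hdis : Disjoint (X ∩ S) Y := Finset.disjoint_left.2 fun i hi hi' => by
        have : i ∉ S := by simpa using hY.1 hi'
        exact this (Finset.mem_inter.1 hi).2
      have hmem : a ∉ X ∩ S := fun h => haS (Finset.mem_inter.1 h).2
      have := hinv (X ∩ S ∪ Y) (by rw [Finset.card_union_of_disjoint hdis]; omega) a
        (Finset.mem_union_right _ ha) haS b
        (fun h => (Finset.mem_union.1 h).elim (fun h => hbS (Finset.mem_inter.1 h).2) hbY) hbS
      have this : I.setVal (X ∩ S ∪ Y) = I.setVal (insert b ((X ∩ S ∪ Y).erase a)) := by exact_mod_cast this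
      rw [this]
      congr 1
      rw [Finset.erase_union_distrib, Finset.erase_eq_of_notMem hmem, Finset.union_insert]
    · simpa using (Finset.mem_sdiff.1 hi).2

/-- By Möbius inversion the value is the sum of `c T` times the indicator of `T ⊆ X`, and this
indicator is the product of `(1 - x_i) / 2` over `i ∈ T`. Expanding gives the coefficients;
multiplying by `2 ^ d` clears the denominators `2 ^ T.card`. -/
theorem CSP.sum_coef_mul {I : CSP d n} {S : Finset (Fin n)} (hI : I.IsJunta S)
    {X : Finset (Fin n)} (hX : X.card = n / 2) :
    ∑ W ∈ S.powerset.filter (·.card ≤ d), (I.coef S W : ℚ) * ∏ i ∈ W, ((signs X i : ℤ) : ℚ) =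
      2 ^ d * I.setVal X := by
  set 𝒯 := S.powerset.filter (·.card ≤ d) with h𝒯
  set F : Finset (Fin n) → ℚ := fun U => I.setVal (extendSet S (n / 2) U) with hF
  set c : Finset (Fin n) → ℚ := fun T => ∑ U ∈ T.powerset, (-1) ^ (T.card + U.card) * F U with hc
  have hprod : ∀ T : Finset (Fin n), ∑ W ∈ T.powerset, (-1) ^ W.card * ∏ i ∈ W, ((signs X i : ℤ) : ℚ) =
      if T ⊆ X then 2 ^ T.card else 0 := by
    intro T
    have h1 : ∑ W ∈ T.powerset, (-1) ^ W.card * ∏ i ∈ W, ((signs X i : ℤ) : ℚ) =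
        ∏ i ∈ T, (1 - ((signs X i : ℤ) : ℚ)) := by
      simp only [sub_eq_add_neg, Finset.prod_one_add, Finset.prod_neg]
    rw [h1]
    split_ifs with hTX
    · rw [Finset.prod_congr rfl (g := fun _ => 2), Finset.prod_const]
      intro i hi
      simp [signs, hTX hi]
      norm_num
    · obtain ⟨i, hi, hiX⟩ := Finset.not_subset.1 hTX
      exact Finset.prod_eq_zero hi (by simp [signs, hiX])
  have hcoef : ∀ W, (I.coef S W : ℚ) = ∑ T ∈ 𝒯, if W ⊆ T then (-1) ^ W.card * (2 ^ (d - T.card) * c T) else 0 := by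
    intro W
    rw [CSP.coef]
    push_cast
    refine Finset.sum_congr rfl fun T _ => ?_
    split_ifs
    · simp only [hc, Finset.mul_sum, hF]
      refine Finset.sum_congr rfl fun U _ => ?_
      rw [pow_add, pow_add, pow_add]
      ring
    · rfl
  have hstep : ∀ T ∈ 𝒯, ∑ W ∈ 𝒯, (if W ⊆ T then (-1) ^ W.card * (2 ^ (d - T.card) * c T) else 0) *
      ∏ i ∈ W, ((signs X i : ℤ) : ℚ) = if T ⊆ X then 2 ^ d * c T else 0 := by
    intro T hT
    rw [h𝒯, Finset.mem_filter, Finset.mem_powerset] at hT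
    have h1 : 𝒯.filter (· ⊆ T) = T.powerset := by
      ext W
      simp only [h𝒯, Finset.mem_filter, Finset.mem_powerset]
      exact ⟨fun h => h.2, fun h => ⟨⟨h.trans hT.1, (Finset.card_le_card h).trans hT.2⟩, h⟩⟩
    have h2 : ∀ W, (if W ⊆ T then (-1) ^ W.card * (2 ^ (d - T.card) * c T) else 0) *
        ∏ i ∈ W, ((signs X i : ℤ) : ℚ) = if W ⊆ T then
          2 ^ (d - T.card) * c T * ((-1) ^ W.card * ∏ i ∈ W, ((signs X i : ℤ) : ℚ)) else 0 := by
      intro W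
      split_ifs
      · ring
      · simp
    simp only [h2]
    rw [← Finset.sum_filter, h1, ← Finset.mul_sum, hprod]
    split_ifs
    · have : (2 : ℚ) ^ d = 2 ^ (d - T.card) * 2 ^ T.card := by rw [← pow_add, Nat.sub_add_cancel hT.2]
      rw [this]
      ring
    · simp
  calc ∑ W ∈ 𝒯, (I.coef S W : ℚ) * ∏ i ∈ W, ((signs X i : ℤ) : ℚ)
      = ∑ T ∈ 𝒯, ∑ W ∈ 𝒯, (if W ⊆ T then (-1) ^ W.card * (2 ^ (d - T.card) * c T) else 0) *
          ∏ i ∈ W, ((signs X i : ℤ) : ℚ) := by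
        rw [Finset.sum_comm]
        exact Finset.sum_congr rfl fun W _ => by rw [hcoef, Finset.sum_mul]
    _ = ∑ T ∈ 𝒯, if T ⊆ X then 2 ^ d * c T else 0 := Finset.sum_congr rfl hstep
    _ = 2 ^ d * ∑ T ∈ (X ∩ S).powerset, c T := by
        rw [← Finset.sum_filter, Finset.mul_sum]
        -- The inversion runs over all subsets of `X ∩ S`, the kernel only over those of size at
        -- most `d`; the junta property kills the other `c T`.
        refine Finset.sum_subset (fun T hT => ?_) fun T hT hT' => ?_
        · simp only [h𝒯, Finset.mem_filter, Finset.mem_powerset] at hT ⊢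
          exact Finset.subset_inter hT.2 hT.1.1
        · simp only [h𝒯, Finset.mem_filter, Finset.mem_powerset] at hT hT'
          have hTX := hT.trans Finset.inter_subset_left
          have hTS := hT.trans Finset.inter_subset_right
          have hd : d < T.card := by
            by_contra hle
            exact hT' ⟨⟨hTS, not_lt.1 hle⟩, hTX⟩
          have := hI.1 T hTS hd
          simp only [hc, pow_add, mul_assoc, ← Finset.mul_sum, hF, this, mul_zero]
    _ = 2 ^ d * I.setVal X := by
        rw [← eq_sum_sum_powerset F (X ∩ S)]
        simp only [hF, hI.2 X hX]

/-! ### Canonical codes of sets, and the kernel they enumerate -/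

/-- The code `v` is the least one of its set, and this set is contained in `S`. -/
def ValidCode (d : ℕ) (S : Finset (Fin n)) (v : ℕ) : Prop :=
  (¬∃ u < (2 * n) ^ d, u < v ∧ ¬∃ i, ¬(i ∈ codeSet d n u ↔ i ∈ codeSet d n v)) ∧
    ¬∃ i, i ∈ codeSet d n v ∧ i ∉ S

/-- The nested negations in `ValidCode` copy the expression that tests it, since the language has
the existential quantifier only. Least codes are needed because reordering, repetition and padding
give a set many codes. -/
theorem validCode_iff {S : Finset (Fin n)} {v : ℕ} (hv : v < (2 * n) ^ d) :
    ValidCode d S v ↔ (∀ u < v, codeSet d n u ≠ codeSet d n v) ∧ codeSet d n v ⊆ S := by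
  unfold ValidCode
  push Not
  refine and_congr ⟨fun h u hu e => ?_, fun h u hu huv => ?_⟩ Iff.rfl
  · obtain ⟨i, hi⟩ := h u (hu.trans hv) hu
    simp [e] at hi
  · by_contra hc
    push Not at hc
    exact h u huv (Finset.ext fun i => by have := hc i; tauto)

theorem codeSet_injOn {S : Finset (Fin n)} {u v : ℕ} (hu : u < (2 * n) ^ d) (hv : v < (2 * n) ^ d)
    (h : ValidCode d S u) (h' : ValidCode d S v) (e : codeSet d n u = codeSet d n v) : u = v := by
  rw [validCode_iff hu] at h
  rw [validCode_iff hv] at h'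
  rcases lt_trichotomy u v with hl | hl | hl
  · exact absurd e (h'.1 u hl)
  · exact hl
  · exact absurd e.symm (h.1 v hl)

theorem exists_validCode (hn : 0 < n) {S T : Finset (Fin n)} (hTS : T ⊆ S) (hT : T.card ≤ d) :
    ∃ v < (2 * n) ^ d, ValidCode d S v ∧ codeSet d n v = T := by
  classical
  have hex := exists_codeSet_eq hn hT
  refine ⟨Nat.find hex, (Nat.find_spec hex).1, ?_, (Nat.find_spec hex).2⟩
  rw [validCode_iff (Nat.find_spec hex).1, (Nat.find_spec hex).2]
  exact ⟨fun u hu e => Nat.find_min hex hu ⟨hu.trans (Nat.find_spec hex).1, e⟩, hTS⟩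

-- Least codes are in bijection with the subsets of `S` of size at most `d`; this is how the program
-- sums over sets.
open Classical in
theorem sum_validCode {R : Type*} [AddCommMonoid R] (hn : 0 < n) (S : Finset (Fin n))
    (g : Finset (Fin n) → R) :
    ∑ v ∈ Finset.range ((2 * n) ^ d), (if ValidCode d S v then g (codeSet d n v) else 0) =
      ∑ T ∈ S.powerset.filter (·.card ≤ d), g T := by
  rw [← Finset.sum_filter]
  refine Finset.sum_bij (fun v _ => codeSet d n v) (fun v hv => ?_) (fun u hu v hv e => ?_)
    (fun T hT => ?_) fun _ _ => rfl
  · rw [Finset.mem_filter, Finset.mem_range] at hv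
    rw [Finset.mem_filter, Finset.mem_powerset]
    exact ⟨((validCode_iff hv.1).1 hv.2).2, card_codeSet_le v⟩
  · rw [Finset.mem_filter, Finset.mem_range] at hu hv
    exact codeSet_injOn hu.1 hv.1 hu.2 hv.2 e
  · rw [Finset.mem_filter, Finset.mem_powerset] at hT
    obtain ⟨v, hv, h1, h2⟩ := exists_validCode hn hT.1 hT.2
    exact ⟨v, Finset.mem_filter.2 ⟨Finset.mem_range.2 hv, h1⟩, h2⟩

/-- The elements of a set in increasing order. -/
def elems (T : Finset (Fin n)) : List (Fin n) := (List.finRange n).filter (· ∈ T)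

theorem mem_elems {T : Finset (Fin n)} {i : Fin n} : i ∈ elems T ↔ i ∈ T := by
  simp [elems]

theorem elems_pairwise (T : Finset (Fin n)) : (elems T).Pairwise (· < ·) :=
  (List.pairwise_lt_finRange n).filter _

theorem elems_toFinset (T : Finset (Fin n)) : (elems T).toFinset = T := by
  ext i
  simp [mem_elems]

theorem elems_nodup (T : Finset (Fin n)) : (elems T).Nodup := (elems_pairwise T).imp fun h => h.ne

theorem length_elems (T : Finset (Fin n)) : (elems T).length = T.card := by
  rw [← List.toFinset_card_of_nodup (elems_nodup T), elems_toFinset]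

open Classical in
/-- The kernel on the set `S`. -/
noncomputable def CSP.kernel (I : CSP d n) (S : Finset (Fin n)) : Kernel n where
  vars := elems S
  denom := 2 ^ d
  terms := ((List.range ((2 * n) ^ d)).filter (ValidCode d S ·)).map fun v =>
    (I.coef S (codeSet d n v), elems (codeSet d n v))

theorem CSP.kernel_isKernelOf (hn : 0 < n) {h : ℕ} (hnh : n = 2 * h) {I : CSP d n} {S : Finset (Fin n)}
    (hI : I.IsJunta S) : (I.kernel S).IsKernelOf I := by
  classical
  have hterm : ∀ p ∈ (I.kernel S).terms, ∃ v < (2 * n) ^ d, ValidCode d S v ∧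
      p = (I.coef S (codeSet d n v), elems (codeSet d n v)) := by
    intro p hp
    simp only [CSP.kernel, List.mem_map, List.mem_filter, List.mem_range, decide_eq_true_eq] at hp
    obtain ⟨v, ⟨hv, hv'⟩, rfl⟩ := hp
    exact ⟨v, hv, hv', rfl⟩
  refine ⟨by simp [CSP.kernel], fun p hp => ?_, ?_, fun p hp => ?_, fun p hp i hi => ?_, fun x hx => ?_⟩
  · obtain ⟨v, _, _, rfl⟩ := hterm p hp
    exact elems_pairwise _
  · simp only [CSP.kernel, List.map_map]
    refine List.Nodup.map_on (fun u hu v hv e => ?_) (List.nodup_range.filter _)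
    simp only [List.mem_filter, List.mem_range, decide_eq_true_eq] at hu hv
    refine codeSet_injOn hu.1 hv.1 hu.2 hv.2 ?_
    have := congrArg List.toFinset e
    simpa only [Function.comp_apply, elems_toFinset] using this
  · obtain ⟨v, _, _, rfl⟩ := hterm p hp
    simp only [length_elems]
    exact card_codeSet_le v
  · obtain ⟨v, hv, hv', rfl⟩ := hterm p hp
    rw [mem_elems] at hi
    exact mem_elems.2 (((validCode_iff hv).1 hv').2 hi)
  · have hX : (negSet x).card = n / 2 := by
      rw [← signs_negSet x, signs_mem_bisections hnh] at hx
      omega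
    have hsum := CSP.sum_coef_mul hI hX
    rw [signs_negSet, CSP.setVal, signs_negSet] at hsum
    have : ((I.kernel S).terms.map fun p => (p.1 : ℚ) * (p.2.map fun i => ((x i : ℤ) : ℚ)).prod).sum =
        ∑ W ∈ S.powerset.filter (·.card ≤ d), (I.coef S W : ℚ) * ∏ i ∈ W, ((x i : ℤ) : ℚ) := by
      rw [← sum_validCode hn, ← Finset.sum_filter]
      simp only [CSP.kernel, List.map_map]
      rw [← List.sum_toFinset _ (List.nodup_range.filter _)]
      rw [List.toFinset_filter, List.toFinset_range]
      simp only [decide_eq_true_eq]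
      refine Finset.sum_congr rfl fun v _ => ?_
      simp only [Function.comp_apply]
      rw [← List.prod_toFinset _ (elems_nodup _), elems_toFinset]
    rw [Kernel.eval, this, hsum]
    simp [CSP.kernel]

end Value

/-! ## The expressions of the algorithm -/

namespace Ex

/-- The element `loc i` is in the set that `ballSet` assigns to `loc 3` and `loc 4`. -/
def ballMem (i : ℕ) : Ex := or (mem i 4) (and (lt (loc i) (arr 6 (lit 2))) (not (mem i 3)))

/-- `loc 30`, with `loc 1` and `loc 2` exchanged. -/
def swap : Ex := ite (eq (loc 30) (loc 1)) (loc 2) (ite (eq (loc 30) (loc 2)) (loc 1) (loc 30))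

/-- The variables `loc 1` and `loc 2` are not interchangeable. -/
def distinguishes : Ex := ex 3 5 <| ex 4 5 <|
  and (eq (sum 30 1 (ballMem 30)) (arr 6 (lit 2)))
    (not (eq (val (ballMem 30)) (val (lett 31 swap (ballMem 31)))))

/-- `loc v` is a valid code of a set of marked variables. -/
def valid (v : ℕ) : Ex :=
  and (not (ex 41 5 (and (lt (loc 41) (loc v)) (not (ex 42 1 (not (eq (mem 42 41) (mem 42 v))))))))
    (not (ex 42 1 (and (mem 42 v) (not (arr 5 (loc 42))))))

/-- The set with code `loc u` is contained in the set with code `loc v`. -/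
def subset (u v : ℕ) : Ex := not (ex 42 1 (and (mem 42 u) (not (mem 42 v))))

/-- The number of elements of the set with code `loc v`. -/
def card (v : ℕ) : Ex := sum 44 1 (mem 44 v)

/-- `loc 30` is in the extension of the set with code `loc 7` to a set of size `n / 2`. -/
def extend : Ex := or (mem 30 7) <| and (not (arr 5 (loc 30))) <|
  lt (add (card 7) (sum 45 1 (and (lt (loc 45) (loc 30)) (not (arr 5 (loc 45)))))) (arr 6 (lit 2))

/-- `e` is odd. -/
def odd (x : ℕ) (e : Ex) : Ex := ex x 4 (eq (add (add (loc x) (loc x)) (lit 1)) e)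

/-- One term of a coefficient of the kernel. -/
def coefTerm : Ex := mul 4 47 (arr 2 (sub (glob 0) (card 6))) (val extend)

/-- The coefficient in the kernel of the set with code `loc 5`. -/
def coef : Ex := sum 6 5 <| ite (and (valid 6) (subset 5 6))
  (sum 7 5 <| ite (and (valid 7) (subset 7 6))
    (ite (odd 46 (add (add (card 5) (card 6)) (card 7))) (sub (lit 0) coefTerm) coefTerm) (lit 0))
  (lit 0)

end Ex

/-- The globals and the memory describe the instance `I` and the set `S` of marked variables. -/
structure Setting {d n : ℕ} (I : CSP d n) (S : Finset (Fin n)) (γ : ℕ → ℤ) (μ : ℤ → ℤ) : Prop where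
  pos : 0 < n
  ctx : Ctx d n γ
  tables : Tables I μ
  marks : ∀ i : Fin n, μ (adr 5 (i : ℕ)) = ind (i ∈ S)

namespace Ex

variable {d n : ℕ} {γ η : ℕ → ℤ} {μ : ℤ → ℤ} {I : CSP d n} {S : Finset (Fin n)} {e : Ex}

theorem eval_ex_fin (hγ : Ctx d n γ) {x : ℕ} {R : Fin n → Prop}
    (h : ∀ i : Fin n, e.eval γ μ (Function.update η x (i : ℕ)) = ind (R i)) :
    (ex x 1 e).eval γ μ η = ind (∃ i, R i) := by
  rw [eval_ex (R := fun i => ∃ hi : i < n, R ⟨i, hi⟩) hγ.g1 fun i hi => ?_]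
  · refine ind_congr ⟨?_, fun ⟨i, hi⟩ => ⟨i, i.2, i.2, hi⟩⟩
    rintro ⟨i, _, hi, h⟩
    exact ⟨_, h⟩
  · rw [h ⟨i, hi⟩]
    exact ind_congr ⟨fun h => ⟨hi, h⟩, fun ⟨_, h⟩ => h⟩

theorem eval_sum_fin (hγ : Ctx d n γ) {x : ℕ} {R : Fin n → Prop} [DecidablePred R]
    (h : ∀ i : Fin n, e.eval γ μ (Function.update η x (i : ℕ)) = ind (R i)) :
    (sum x 1 e).eval γ μ η = ((Finset.univ.filter R).card : ℕ) := by
  simp only [eval, hγ.g1, Int.toNat_natCast]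
  rw [Finset.sum_range fun i => e.eval γ μ (Function.update η x i), Finset.sum_congr rfl fun i _ => h i,
    Finset.card_filter]
  push_cast
  refine Finset.sum_congr rfl fun i _ => ?_
  unfold ind
  congr

theorem eval_ballMem (h : Setting I S γ μ) {i u v : ℕ} {ii : Fin n} (hi : i < 80) (hii : η i = (ii : ℕ))
    (hu : η 3 = u) (hv : η 4 = v) (huN : u < (2 * n) ^ d) (hvN : v < (2 * n) ^ d) :
    (ballMem i).eval γ μ η = ind (ii ∈ ballSet d n u v) := by
  rw [ballMem, eval_or (eval_mem h.ctx h.pos h.tables.pow hi (by norm_num) hii hv hvN) (eval_and eval_lt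
    (eval_not (eval_mem h.ctx h.pos h.tables.pow hi (by norm_num) hii hu huN)))]
  simp only [eval, hii, h.tables.half, Nat.cast_lt]
  exact ind_congr (by simp [ballSet])

theorem eval_swap {i a b : Fin n} (hi : η 30 = (i : ℕ)) (ha : η 1 = (a : ℕ)) (hb : η 2 = (b : ℕ)) :
    swap.eval γ μ η = (Equiv.swap a b i : ℕ) := by
  classical
  rw [swap, eval_ite eval_eq, eval_ite eval_eq]
  simp only [eval, hi, ha, hb, Nat.cast_inj, Fin.val_inj, Equiv.swap_apply_def]
  split_ifs <;> rfl

theorem eval_distinguishes (h : Setting I S γ μ) {a b : Fin n} (ha : η 1 = (a : ℕ)) (hb : η 2 = (b : ℕ)) :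
    distinguishes.eval γ μ η = ind (Distinguishes I a b) := by
  refine (eval_ex h.ctx.g5 fun u hu => eval_ex h.ctx.g5 fun v hv => ?_)
  refine eval_and ?_ (eval_not ?_ (P := I.setVal (ballSet d n u v) = I.setVal (swapAt a b (ballSet d n u v))))
  · rw [eval_eq, eval_sum_fin h.ctx (R := fun i => i ∈ ballSet d n u v) fun i => ?_]
    · simp only [eval, h.tables.half, Nat.cast_inj, Finset.filter_univ_mem]
    · exact eval_ballMem h (by norm_num) (by simp) (by simp) (by simp) hu hv
  · rw [eval_eq, eval_val h.ctx h.pos h.tables (X := ballSet d n u v) fun η' hη i hi => ?_,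
      eval_val h.ctx h.pos h.tables (X := swapAt a b (ballSet d n u v)) fun η' hη i hi => ?_]
    · simp only [Nat.cast_inj]
    · have h1 : η' 1 = (a : ℕ) := by rw [hη 1 (by norm_num)]; simpa using ha
      have h2 : η' 2 = (b : ℕ) := by rw [hη 2 (by norm_num)]; simpa using hb
      have h3 : η' 3 = u := by rw [hη 3 (by norm_num)]; simp
      have h4 : η' 4 = v := by rw [hη 4 (by norm_num)]; simp
      -- Membership of `i` in the exchanged set is membership of the exchanged `i` in the original
      -- one.
      rw [eval, eval_swap hi h1 h2, mem_swapAt]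
      exact eval_ballMem h (by norm_num) (by simp) (by simpa using h3) (by simpa using h4) hu hv
    · exact eval_ballMem h (by norm_num) hi (by rw [hη 3 (by norm_num)]; simp)
        (by rw [hη 4 (by norm_num)]; simp) hu hv

theorem eval_valid (h : Setting I S γ μ) {v vv : ℕ} (hv : v < 40) (hvv : η v = vv)
    (hvN : vv < (2 * n) ^ d) : (valid v).eval γ μ η = ind (ValidCode d S vv) := by
  refine eval_and (eval_not (eval_ex h.ctx.g5 fun u hu => eval_and ?_ (eval_not (eval_ex_fin h.ctx
    fun i => eval_not (P := i ∈ codeSet d n u ↔ i ∈ codeSet d n vv) ?_)))) (eval_not (eval_ex_fin h.ctx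
      fun i => eval_and (eval_mem h.ctx h.pos h.tables.pow (by norm_num) (by omega) (by simp) ?_ hvN)
        (eval_not ?_)))
  · rw [eval_lt]
    simp [eval, Function.update_of_ne (show v ≠ 41 by omega), hvv]
  · rw [eval_eq, eval_mem h.ctx h.pos h.tables.pow (ii := i) (by norm_num) (by norm_num) (by simp) (by simp) hu,
      eval_mem h.ctx h.pos h.tables.pow (ii := i) (by norm_num) (by omega) (by simp)
        (by rw [Function.update_of_ne (by omega), Function.update_of_ne (by omega), hvv]) hvN]
    exact ind_congr ind_inj
  · rw [Function.update_of_ne (by omega), hvv]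
  · simp only [eval, Function.update_self, h.marks]

theorem eval_subset (h : Setting I S γ μ) {u v uu vv : ℕ} (hu : u < 40) (hv : v < 40) (huu : η u = uu)
    (hvv : η v = vv) (huN : uu < (2 * n) ^ d) (hvN : vv < (2 * n) ^ d) :
    (subset u v).eval γ μ η = ind (codeSet d n uu ⊆ codeSet d n vv) := by
  rw [subset, eval_not (eval_ex_fin h.ctx (R := fun i => i ∈ codeSet d n uu ∧ ¬i ∈ codeSet d n vv)
    fun i => eval_and (eval_mem h.ctx h.pos h.tables.pow (by norm_num) (by omega) (by simp) ?_ huN)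
    (eval_not (eval_mem h.ctx h.pos h.tables.pow (by norm_num) (by omega) (by simp) ?_ hvN)))]
  · refine ind_congr ?_
    push Not
    rfl
  · rw [Function.update_of_ne (by omega), huu]
  · rw [Function.update_of_ne (by omega), hvv]

theorem eval_card (h : Setting I S γ μ) {v vv : ℕ} (hv : v < 40) (hvv : η v = vv)
    (hvN : vv < (2 * n) ^ d) : (card v).eval γ μ η = (codeSet d n vv).card := by
  rw [card, eval_sum_fin h.ctx (R := fun i => i ∈ codeSet d n vv) fun i =>
    eval_mem h.ctx h.pos h.tables.pow (by norm_num) (by omega) (by simp)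
      (by rw [Function.update_of_ne (by omega), hvv]) hvN, Finset.filter_univ_mem]

theorem eval_extend (h : Setting I S γ μ) {i : Fin n} {u : ℕ} (hi : η 30 = (i : ℕ)) (hu : η 7 = u)
    (huN : u < (2 * n) ^ d) :
    extend.eval γ μ η = ind (i ∈ extendSet S (n / 2) (codeSet d n u)) := by
  rw [extend, eval_or (eval_mem h.ctx h.pos h.tables.pow (by norm_num) (by norm_num) hi hu huN)
    (eval_and (eval_not (P := i ∈ S) ?_) eval_lt), eval, eval_card h (by norm_num) hu huN,
    eval_sum_fin h.ctx (R := fun j => j < i ∧ j ∉ S) fun j => eval_and ?_ (eval_not ?_)]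
  · simp only [eval, h.tables.half]
    refine ind_congr ?_
    norm_cast
    simp [extendSet]
  · rw [eval_lt]
    simp [eval, hi]
  · simp only [eval, Function.update_self, h.marks]
  · simp only [eval, hi, h.marks]

theorem eval_odd (hγ : Ctx d n γ) {x A : ℕ} (hA : A ≤ 2 * 2 ^ d)
    (he : ∀ i, e.eval γ μ (Function.update η x i) = A) : (odd x e).eval γ μ η = ind (A % 2 = 1) := by
  rw [odd, eval_ex (R := fun i => i + i + 1 = A) hγ.g4 fun i _ => ?_]
  · exact ind_congr ⟨fun ⟨i, _, h⟩ => by omega, fun h => ⟨A / 2, by omega, by omega⟩⟩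
  · rw [eval_eq, he]
    simp only [eval, Function.update_self]
    norm_cast

theorem eval_coefTerm (h : Setting I S γ μ) {t u : ℕ} (ht : η 6 = t) (hu : η 7 = u)
    (htN : t < (2 * n) ^ d) (huN : u < (2 * n) ^ d) : coefTerm.eval γ μ η =
      2 ^ (d - (codeSet d n t).card) * I.setVal (extendSet S (n / 2) (codeSet d n u)) := by
  rw [coefTerm, eval_mul (A := 2 ^ (d - (codeSet d n t).card))
    (C := I.setVal (extendSet S (n / 2) (codeSet d n u))) h.ctx.g4
    (Nat.pow_le_pow_right (by norm_num) (Nat.sub_le _ _)) (fun i _ => ?_) (fun i _ => ?_)]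
  · push_cast
    rfl
  · rw [eval, eval, eval_card h (by norm_num) (by simpa using ht) htN, eval, h.ctx.g0,
      ← Nat.cast_sub (card_codeSet_le t), h.tables.two _ (Nat.sub_le _ _)]
  · exact eval_val h.ctx h.pos h.tables fun η' hη i hi => eval_extend h hi
      (by rw [hη 7 (by norm_num)]; simpa using hu) huN

/-- The sign of a term is the parity of a sum of three cardinalities, at most `3 * d`; a search
below `2 ^ d` decides it. -/
theorem three_mul_le_two_pow (d : ℕ) : 3 * d ≤ 2 * 2 ^ d := by
  induction d with
  | zero => simp
  | succ d ih =>
    rcases Nat.eq_zero_or_pos d with rfl | hd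
    · norm_num
    · have := Nat.pow_le_pow_right (show 0 < 2 by norm_num) hd
      rw [pow_succ]
      omega

theorem eval_coef (h : Setting I S γ μ) {w : ℕ} (hw : η 5 = w) (hwN : w < (2 * n) ^ d) :
    coef.eval γ μ η = I.coef S (codeSet d n w) := by
  classical
  rw [coef, eval_sum h.ctx.g5 (f := fun t => if ValidCode d S t then if codeSet d n w ⊆ codeSet d n t then
    ∑ U ∈ (codeSet d n t).powerset, (-1) ^ ((codeSet d n w).card + (codeSet d n t).card + U.card) *
      (2 ^ (d - (codeSet d n t).card) * (I.setVal (extendSet S (n / 2) U) : ℤ)) else 0 else 0)]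
  · rw [sum_validCode h.pos S fun T => if codeSet d n w ⊆ T then
      ∑ U ∈ T.powerset, (-1) ^ ((codeSet d n w).card + T.card + U.card) *
        (2 ^ (d - T.card) * (I.setVal (extendSet S (n / 2) U) : ℤ)) else 0]
    rfl
  intro t ht
  rw [eval_ite (eval_and (eval_valid h (by norm_num) (by simp) ht) (eval_subset h (by norm_num) (by norm_num)
    (by simpa using hw) (by simp) hwN ht)), ite_and]
  refine if_ctx_congr Iff.rfl (fun hv => if_ctx_congr Iff.rfl (fun _ => ?_) fun _ => rfl) fun _ => rfl
  rw [eval_sum h.ctx.g5 (f := fun u => if ValidCode d S u then if codeSet d n u ⊆ codeSet d n t then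
    (-1) ^ ((codeSet d n w).card + (codeSet d n t).card + (codeSet d n u).card) *
      (2 ^ (d - (codeSet d n t).card) * (I.setVal (extendSet S (n / 2) (codeSet d n u)) : ℤ)) else 0 else 0)]
  · rw [sum_validCode h.pos S fun U => if U ⊆ codeSet d n t then
      (-1) ^ ((codeSet d n w).card + (codeSet d n t).card + U.card) *
        (2 ^ (d - (codeSet d n t).card) * (I.setVal (extendSet S (n / 2) U) : ℤ)) else 0,
      -- A subset of `codeSet d n t` lies in `S` and has at most `d` elements automatically, so the
      -- double condition leaves its full powerset.
      ← Finset.sum_filter]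
    refine Finset.sum_congr (Finset.ext fun U => ?_) fun _ _ => rfl
    simp only [Finset.mem_filter, Finset.mem_powerset]
    exact ⟨fun h => h.2, fun hU => ⟨⟨hU.trans ((validCode_iff ht).1 hv).2,
      (Finset.card_le_card hU).trans (card_codeSet_le t)⟩, hU⟩⟩
  intro u hu
  rw [eval_ite (eval_and (eval_valid h (by norm_num) (by simp) hu) (eval_subset h (by norm_num) (by norm_num)
    (by simp) (by simp) hu ht)), ite_and]
  refine if_ctx_congr Iff.rfl (fun _ => if_ctx_congr Iff.rfl (fun _ => ?_) fun _ => rfl) fun _ => rfl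
  have hc := eval_coefTerm (η := Function.update (Function.update η 6 t) 7 u) h (by simp) (by simp) ht hu
  rw [eval_ite (eval_odd (A := (codeSet d n w).card + (codeSet d n t).card + (codeSet d n u).card)
    h.ctx ?_ fun i => ?_), eval, hc, eval]
  · rcases Nat.mod_two_eq_zero_or_one ((codeSet d n w).card + (codeSet d n t).card + (codeSet d n u).card)
      with h0 | h0
    · rw [if_neg (by omega), (Nat.even_iff.2 h0).neg_one_pow, one_mul]
    · rw [if_pos h0, (Nat.odd_iff.2 h0).neg_one_pow]
      ring
  · have h1 := card_codeSet_le (d := d) (n := n) w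
    have h2 := card_codeSet_le (d := d) (n := n) t
    have h3 := card_codeSet_le (d := d) (n := n) u
    have := three_mul_le_two_pow d
    omega
  · simp only [eval]
    rw [eval_card h (by norm_num) (by simpa using hw) hwN, eval_card h (by norm_num) (by simp) ht,
      eval_card h (by norm_num) (by simp) hu]
    push_cast
    rfl

end Ex

/-! ## The commands of the algorithm -/

theorem iter_induction {α : Type*} {f : ℕ → α → α} {n : ℕ} {a : α} (Inv : ℕ → α → Prop) (h0 : Inv 0 a)
    (step : ∀ i < n, ∀ a, Inv i a → Inv (i + 1) (f i a)) : Inv n (iter f n a) := by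
  induction n with
  | zero => exact h0
  | succ n ih => exact step n (Nat.lt_succ_self n) _ (ih fun i hi => step i (hi.trans (Nat.lt_succ_self n)))

/-- The memories agree except at the cells of array `k`. -/
def Frame (k : ℕ) (μ μ' : ℤ → ℤ) : Prop := ∀ x, (∀ i : ℕ, x ≠ adr k i) → μ' x = μ x

namespace Frame

variable {k l : ℕ} {μ μ' μ'' : ℤ → ℤ}

theorem refl (k : ℕ) (μ : ℤ → ℤ) : Frame k μ μ := fun _ _ => rfl

theorem trans (h : Frame k μ μ') (h' : Frame k μ' μ'') : Frame k μ μ'' :=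
  fun x hx => (h' x hx).trans (h x hx)

theorem update (h : Frame k μ μ') (i : ℕ) (z : ℤ) : Frame k μ (Function.update μ' (adr k i) z) :=
  fun x hx => by rw [Function.update_of_ne (hx i), h x hx]

theorem arr (h : Frame k μ μ') (i : ℤ) (hne : l ≠ k := by norm_num) (hl : l ≤ 7 := by norm_num)
    (hk : k ≤ 7 := by norm_num) : μ' (adr l i) = μ (adr l i) :=
  h _ fun j => by simp only [adr]; omega

theorem inp (h : Frame k μ μ') {x : ℤ} (hx : 0 ≤ x) (hk : 1 ≤ k := by norm_num) : μ' x = μ x :=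
  h _ fun j => by simp only [adr]; omega

end Frame

theorem adr_inj {k : ℕ} {i j : ℤ} : adr k i = adr k j ↔ i = j := by
  simp only [adr]
  omega

namespace Cmd

open Ex (lit glob loc add sub inp arr)

/-- Store the powers of a number in array `k`, given an expression for the next power. -/
def powers (k : ℕ) (e : Ex) : Cmd :=
  seq (wr k (lit 0) (lit 1)) (.rep 50 0 (wr k (add (loc 50) (lit 1)) e))

/-- Store the multiples of the powers of `2 n`. -/
def multiples : Cmd := .rep 50 0 <| .rep 51 3 <| wr 3 (add (.mul 0 52 (loc 50) (glob 3)) (loc 51))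
  (.mul 3 53 (loc 51) (arr 1 (loc 50)))

/-- Store the tables of the powers of `2` and `2 n` and of the multiples of the latter. -/
def tables : Cmd :=
  seq (powers 2 (add (arr 2 (loc 50)) (arr 2 (loc 50)))) (seq (powers 1 (.sum 51 3 (arr 1 (loc 50)))) multiples)

/-- The address of the constraint `loc 50`. -/
def base : Ex := add (add (lit 4) (.sum 57 0 (loc 50))) (.sum 57 4 (loc 50))

/-- The code of the pattern `loc 51` of the constraint `loc 50`. -/
def key : Ex := .sum 52 0 <| arr 3 <| add (add (.mul 0 53 (loc 52) (glob 3)) (inp (add base (loc 52))))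
  (.ite (.odd 56 (.div 4 54 55 (loc 51) (arr 2 (loc 52)))) (glob 1) (lit 0))

/-- Count the patterns of the constraint `loc 50`. -/
def countPatterns : Cmd :=
  .rep 51 4 (wr 4 key (add (arr 4 key) (inp (add (add base (glob 0)) (loc 51)))))

variable {γ η : ℕ → ℤ} {μ : ℤ → ℤ} {d n : ℕ}

theorem run_powers {k B : ℕ} {e : Ex} (hd : γ 0 = d) (he : ∀ j < d, ∀ μ' : ℤ → ℤ,
    Frame k μ μ' → μ' (adr k j) = (B ^ j : ℕ) → e.eval γ μ' (Function.update η 50 j) = (B ^ (j + 1) : ℕ)) :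
    Frame k μ ((powers k e).run γ η μ) ∧ ∀ j ≤ d, (powers k e).run γ η μ (adr k j) = (B ^ j : ℕ) := by
  simp only [powers, run, hd, Int.toNat_natCast]
  refine iter_induction (fun i μ' => Frame k μ μ' ∧ ∀ j ≤ i, μ' (adr k j) = (B ^ j : ℕ))
    ⟨(Frame.refl k μ).update 0 _, fun j hj => ?_⟩ ?_
  · obtain rfl : j = 0 := by omega
    simp [Ex.eval]
  · rintro i hi μ' ⟨h1, h2⟩
    have hv := he i hi μ' h1 (h2 i le_rfl)
    have ha : (add (loc 50) (lit 1)).eval γ μ' (Function.update η 50 i) = ((i + 1 : ℕ) : ℤ) := by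
      simp [Ex.eval]
    simp only [hv, ha]
    refine ⟨h1.update _ _, fun j hj => ?_⟩
    rcases Nat.lt_or_ge i j with h | h
    · obtain rfl : j = i + 1 := by omega
      rw [Function.update_self]
    · rw [Function.update_of_ne, h2 j h]
      rw [Ne, adr_inj]
      omega

/-- Cell `2 n J + L` holds `L * (2 n) ^ J`. With this table the code of a literal tuple is a sum of
`d` lookups, without a loop of length `n` for each constraint; the time bound, linear in `m` with a
factor depending on `d` only, rests on this. -/
theorem run_multiples (h0 : γ 0 = d) (h3 : γ 3 = (2 * n : ℕ)) (h1 : ∀ j ≤ d, μ (adr 1 j) = ((2 * n) ^ j : ℕ)) :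
    Frame 3 μ (multiples.run γ η μ) ∧
    ∀ i < d * (2 * n), multiples.run γ η μ (adr 3 i) = (i % (2 * n) * (2 * n) ^ (i / (2 * n)) : ℕ) := by
  rw [multiples, run, h0, Int.toNat_natCast]
  refine iter_induction (fun J μ' => Frame 3 μ μ' ∧ ∀ i < J * (2 * n), μ' (adr 3 i) =
      (i % (2 * n) * (2 * n) ^ (i / (2 * n)) : ℕ)) ⟨Frame.refl _ _, fun i hi => by simp at hi⟩ ?_
  rintro J hJ μ' hμ'
  rw [run, h3, Int.toNat_natCast]
  have := iter_induction (n := 2 * n) (a := μ') (f := fun i =>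
      (wr 3 (add (.mul 0 52 (loc 50) (glob 3)) (loc 51)) (.mul 3 53 (loc 51) (arr 1 (loc 50)))).run γ
        (Function.update (Function.update η 50 J) 51 i))
    (fun L μ' => Frame 3 μ μ' ∧ ∀ i < J * (2 * n) + L, μ' (adr 3 i) =
      (i % (2 * n) * (2 * n) ^ (i / (2 * n)) : ℕ)) hμ' ?_
  · rwa [← add_one_mul] at this
  rintro L hL μ' ⟨f, h2⟩
  have hJ' : (J * (2 * n) + L) / (2 * n) = J ∧ (J * (2 * n) + L) % (2 * n) = L := by
    rw [mul_comm, Nat.mul_add_div (by omega), Nat.mul_add_mod, Nat.div_eq_of_lt hL, Nat.mod_eq_of_lt hL]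
    exact ⟨add_zero J, rfl⟩
  rw [run, show (add (.mul 0 52 (loc 50) (glob 3)) (loc 51)).eval γ μ'
    (Function.update (Function.update η 50 J) 51 L) = ((J * (2 * n) + L : ℕ) : ℤ) by
      rw [Ex.eval, Ex.eval_mul (A := J) (C := (2 * n : ℕ)) h0 hJ.le (fun i _ => by simp [Ex.eval])
        (fun i _ => by simp [Ex.eval, h3])]
      simp [Ex.eval],
    Ex.eval_mul (A := L) (C := ((2 * n) ^ J : ℕ)) h3 hL.le (fun i _ => by simp [Ex.eval])
        (fun i _ => by
          rw [← h1 J hJ.le, ← f.arr J]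
          simp [Ex.eval])]
  refine ⟨f.update _ _, fun i hi => ?_⟩
  rcases Nat.lt_or_ge i (J * (2 * n) + L) with h | h
  · rw [Function.update_of_ne, h2 i h]
    rw [Ne, adr_inj]
    omega
  · obtain rfl : i = J * (2 * n) + L := by omega
    rw [Function.update_self, hJ'.1, hJ'.2]
    push_cast
    rfl

theorem run_tables (h0 : γ 0 = d) (h3 : γ 3 = (2 * n : ℕ)) :
    (∀ x, (∀ i : ℕ, x ≠ adr 1 i ∧ x ≠ adr 2 i ∧ x ≠ adr 3 i) → tables.run γ η μ x = μ x) ∧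
    (∀ j ≤ d, tables.run γ η μ (adr 1 j) = ((2 * n) ^ j : ℕ)) ∧
    (∀ j ≤ d, tables.run γ η μ (adr 2 j) = (2 ^ j : ℕ)) ∧
    ∀ i < d * (2 * n), tables.run γ η μ (adr 3 i) = (i % (2 * n) * (2 * n) ^ (i / (2 * n)) : ℕ) := by
  obtain ⟨f1, p1⟩ := run_powers (μ := μ) (η := η) (k := 2) (B := 2)
    (e := add (arr 2 (loc 50)) (arr 2 (loc 50))) h0 fun j _ μ' _ h => by
      simp only [Ex.eval, Function.update_self, h, pow_succ]
      push_cast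
      ring
  obtain ⟨f2, p2⟩ := run_powers (μ := (powers 2 (add (arr 2 (loc 50)) (arr 2 (loc 50)))).run γ η μ) (η := η)
    (k := 1) (B := 2 * n) (e := .sum 51 3 (arr 1 (loc 50))) h0 fun j _ μ' _ h => by
      rw [Ex.eval_sum h3 (f := fun _ => ((2 * n) ^ j : ℕ))]
      · simp [pow_succ, mul_comm]
      · intro i _
        simpa [Ex.eval] using h
  obtain ⟨f3, p3⟩ := run_multiples (η := η) h0 h3 p2
  rw [tables, run, run]
  refine ⟨fun x hx => ?_, fun j hj => ?_, fun j hj => ?_, p3⟩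
  · rw [f3 x fun i => (hx i).2.2, f2 x fun i => (hx i).1, f1 x fun i => (hx i).2.1]
  · rw [f3.arr, p2 j hj]
  · rw [f3.arr, f2.arr, p1 j hj]

/-! ### Reading the constraints -/

/-- The input is stored from address `0` on. -/
structure _root_.Input (I : CSP d n) (t : ℤ) (μ : ℤ → ℤ) : Prop where
  arity : μ 0 = d
  vars : μ 1 = n
  size : μ 2 = I.size
  param : μ 3 = t
  scope : ∀ (c : ℕ) (hc : c < I.constraints.length) (j : Fin d),
    μ ((4 + c * d + c * 2 ^ d + j : ℕ) : ℤ) = ((I.constraints[c].scope j : ℕ) : ℤ)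
  bit : ∀ (c : ℕ) (hc : c < I.constraints.length), ∀ b < 2 ^ d,
    μ ((4 + c * d + c * 2 ^ d + d + b : ℕ) : ℤ) = if pattern d b ∈ I.constraints[c].pred then 1 else 0

theorem _root_.Input.congr {I : CSP d n} {t : ℤ} {μ' : ℤ → ℤ} (h : Input I t μ)
    (e : ∀ x, 0 ≤ x → μ' x = μ x) : Input I t μ' where
  arity := by rw [e _ le_rfl, h.arity]
  vars := by rw [e _ (by norm_num), h.vars]
  size := by rw [e _ (by norm_num), h.size]
  param := by rw [e _ (by norm_num), h.param]
  scope c hc j := by rw [e _ (by positivity), h.scope c hc j]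
  bit c hc b hb := by rw [e _ (by positivity), h.bit c hc b hb]

theorem _root_.List.getElem?_flatMap_of_length {α β : Type*} {f : α → List β} {L : ℕ} (l : List α)
    (hL : ∀ a, (f a).length = L) (c : ℕ) (hc : c < l.length) {r : ℕ} (hr : r < L) :
    (l.flatMap f)[c * L + r]? = (f l[c])[r]? := by
  induction l generalizing c with
  | nil => simp at hc
  | cons a l ih =>
    rw [List.flatMap_cons]
    cases c with
    | zero => rw [List.getElem?_append_left (by rw [hL]; omega)]; simp
    | succ c =>
      rw [List.getElem?_append_right (by rw [hL, add_mul]; omega), hL,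
        show (c + 1) * L + r - L = c * L + r by rw [add_mul]; omega, ih c (by simpa using hc)]
      simp

theorem _root_.input_init (I : CSP d n) (t : ℤ) : Input I t (RamState.init (I.encode t)).mem := by
  have hmem : ∀ a : ℕ, (RamState.init (I.encode t)).mem a = (I.encode t)[a]?.getD 0 := fun a => by
    simp [RamState.init]
  have hL : ∀ C : Constraint d n, C.encode.length = d + 2 ^ d := fun C => by simp [Constraint.encode]
  have hget : ∀ (c : ℕ) (hc : c < I.constraints.length) (r : ℕ), r < d + 2 ^ d →
      (I.encode t)[4 + c * d + c * 2 ^ d + r]? = I.constraints[c].encode[r]? := by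
    intro c hc r hr
    rw [CSP.encode, List.getElem?_append_right (by simp; omega),
      ← List.getElem?_flatMap_of_length _ hL c hc hr]
    congr 1
    simp only [List.length_cons, List.length_nil]
    rw [mul_add]
    omega
  refine ⟨hmem 0, hmem 1, hmem 2, hmem 3, fun c hc j => ?_, fun c hc b hb => ?_⟩
  · rw [hmem, hget c hc j (j.2.trans_le (Nat.le_add_right _ _)), Constraint.encode, List.getElem?_append_left (by simp)]
    simp
  · rw [hmem, add_assoc (4 + c * d + c * 2 ^ d), hget c hc _ (by omega), Constraint.encode,
      List.getElem?_append_right (by simp)]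
    simp [hb]

theorem eval_base (hγ : Ctx d n γ) {c : ℕ} (hc : η 50 = c) :
    base.eval γ μ η = ((4 + c * d + c * 2 ^ d : ℕ) : ℤ) := by
  rw [base, Ex.eval, Ex.eval, Ex.eval_sum hγ.g0 (f := fun _ => (c : ℤ)) (fun i _ => by simpa [Ex.eval] using hc),
    Ex.eval_sum hγ.g4 (f := fun _ => (c : ℤ)) (fun i _ => by simpa [Ex.eval] using hc)]
  simp [Ex.eval]
  ring

theorem eval_key (hγ : Ctx d n γ) {I : CSP d n} {t : ℤ} (hI : Input I t μ)
    (h2 : ∀ j ≤ d, μ (adr 2 j) = (2 ^ j : ℕ))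
    (h3 : ∀ i < d * (2 * n), μ (adr 3 i) = (i % (2 * n) * (2 * n) ^ (i / (2 * n)) : ℕ))
    {c b : ℕ} (hc : c < I.constraints.length) (hb : b < 2 ^ d) (ec : η 50 = c) (eb : η 51 = b) :
    key.eval γ μ η = I.constraints[c].key b := by
  have hterm : ∀ j : Fin d, (arr 3 <| add (add (.mul 0 53 (loc 52) (glob 3)) (inp (add base (loc 52))))
      (.ite (.odd 56 (.div 4 54 55 (loc 51) (arr 2 (loc 52)))) (glob 1) (lit 0))).eval γ μ
        (Function.update η 52 (j : ℕ)) =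
      ((literal (I.constraints[c].scope j) (b.testBit j) * (2 * n) ^ (j : ℕ) : ℕ) : ℤ) := by
    intro j
    have e1 : (Ex.mul 0 53 (loc 52) (glob 3)).eval γ μ (Function.update η 52 (j : ℕ)) = (j * (2 * n) : ℕ) := by
      rw [Ex.eval_mul (A := j) (C := (2 * n : ℕ)) hγ.g0 j.2.le (fun i _ => by simp [Ex.eval])
          (fun i _ => by simp [Ex.eval, hγ.g3])]
      push_cast
      rfl
    have e2 : (inp (add base (loc 52))).eval γ μ (Function.update η 52 (j : ℕ)) =
        ((I.constraints[c].scope j : ℕ) : ℤ) := by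
      rw [← hI.scope c hc j, Ex.eval, Ex.eval, eval_base hγ (c := c) (by simpa using ec)]
      simp [Ex.eval]
    have e3 : (Ex.odd 56 (.div 4 54 55 (loc 51) (arr 2 (loc 52)))).eval γ μ (Function.update η 52 (j : ℕ)) =
        ind (b.testBit j = true) := by
      have hle : b / 2 ^ (j : ℕ) ≤ 2 ^ d := (Nat.div_le_self _ _).trans hb.le
      rw [Ex.eval_odd (A := b / 2 ^ (j : ℕ)) hγ (by omega) fun i => ?_]
      · rw [Nat.testBit_eq_decide_div_mod_eq, decide_eq_true_eq]
      · refine Ex.eval_div (by norm_num) hγ.g4 (by positivity) hle (fun i => ?_) fun i k => ?_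
        · simpa [Ex.eval] using eb
        · simp [Ex.eval, h2 _ j.2.le]
    have e4 : (add (add (.mul 0 53 (loc 52) (glob 3)) (inp (add base (loc 52))))
        (.ite (.odd 56 (.div 4 54 55 (loc 51) (arr 2 (loc 52)))) (glob 1) (lit 0))).eval γ μ
        (Function.update η 52 (j : ℕ)) =
        ((j * (2 * n) + literal (I.constraints[c].scope j) (b.testBit j) : ℕ) : ℤ) := by
      rw [Ex.eval, Ex.eval, e1, e2, Ex.eval_ite e3, literal]
      simp only [Ex.eval, hγ.g1]
      push_cast
      ring
    have hl := (literal (I.constraints[c].scope j) (b.testBit j)).2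
    rw [Ex.eval, e4, h3]
    · rw [mul_comm (j : ℕ), Nat.mul_add_div (by omega), Nat.mul_add_mod, Nat.div_eq_of_lt hl,
        Nat.mod_eq_of_lt hl, add_zero]
    · have : (j + 1) * (2 * n) ≤ d * (2 * n) := Nat.mul_le_mul_right _ j.2
      rw [add_mul] at this
      omega
  rw [key, Ex.eval, hγ.g0, Int.toNat_natCast, Finset.sum_range, Finset.sum_congr rfl fun j _ => hterm j,
    Constraint.key, finFunctionFinEquiv_apply]
  push_cast
  rfl

/-- The single pass over the input: for each constraint and pattern, the bit of the truth table is
added to the cell of the literals it requires. Array 4 relies on unused memory being zero. -/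
theorem run_rep_countPatterns (hγ : Ctx d n γ) {I : CSP d n} {t : ℤ} (hI : Input I t μ)
    (h2 : ∀ j ≤ d, μ (adr 2 j) = (2 ^ j : ℕ))
    (h3 : ∀ i < d * (2 * n), μ (adr 3 i) = (i % (2 * n) * (2 * n) ^ (i / (2 * n)) : ℕ))
    (h4 : ∀ v : ℕ, μ (adr 4 v) = 0) (hs : γ 2 = I.size) :
    Frame 4 μ ((Cmd.rep 50 2 countPatterns).run γ η μ) ∧
      ∀ v : ℕ, (Cmd.rep 50 2 countPatterns).run γ η μ (adr 4 v) = patternCount I.constraints v := by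
  rw [run, hs, Int.toNat_natCast]
  have := iter_induction (n := I.size) (a := μ)
    (f := fun i => countPatterns.run γ (Function.update η 50 i))
    (fun c μ' => Frame 4 μ μ' ∧ ∀ v : ℕ, μ' (adr 4 v) = patternCount (I.constraints.take c) v)
    ⟨Frame.refl _ _, fun v => by simp [patternCount, h4]⟩ ?_
  · rwa [CSP.size, List.take_length] at this
  rintro c hc μ' ⟨f, hv⟩
  have hc' : c < I.constraints.length := hc
  rw [countPatterns, run, hγ.g4, Int.toNat_natCast]
  have := iter_induction (n := 2 ^ d) (a := μ')
    (f := fun i => (wr 4 key (add (arr 4 key) (inp (add (add base (glob 0)) (loc 51))))).run γ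
      (Function.update (Function.update η 50 c) 51 i))
    (fun B μ' => Frame 4 μ μ' ∧ ∀ v : ℕ, μ' (adr 4 v) = (patternCount (I.constraints.take c) v +
      ∑ b ∈ Finset.range B, if pattern d b ∈ I.constraints[c].pred ∧ I.constraints[c].key b = v then 1 else 0 : ℕ))
    ⟨f, by simpa using hv⟩ ?_
  · convert this using 5 with v
    rw [List.take_succ_eq_append_getElem hc', patternCount, patternCount, List.map_append, List.sum_append]
    simp
  rintro b hb μ' ⟨f, hv⟩
  have hI' := hI.congr fun x hx => f.inp hx
  have ek : key.eval γ μ' (Function.update (Function.update η 50 c) 51 b) = I.constraints[c].key b :=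
    eval_key hγ hI' (fun j hj => by rw [f.arr, h2 j hj]) (fun i hi => by rw [f.arr, h3 i hi]) hc' hb
      (by simp) (by simp)
  have eb : (inp (add (add base (glob 0)) (loc 51))).eval γ μ' (Function.update (Function.update η 50 c) 51 b) =
      if pattern d b ∈ I.constraints[c].pred then 1 else 0 := by
    have := eval_base (μ := μ') (η := Function.update (Function.update η 50 c) 51 b) hγ (c := c) (by simp)
    rw [← hI'.bit c hc' b hb]
    simp only [Ex.eval, this, hγ.g0, Function.update_self]
    push_cast
    rfl
  rw [run, Ex.eval, eb, Ex.eval, ek, hv]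
  refine ⟨f.update _ _, fun v => ?_⟩
  rw [Finset.sum_range_succ]
  by_cases h : I.constraints[c].key b = v
  · subst h
    rw [Function.update_self]
    simp only [and_true]
    push_cast
    ring
  · rw [Function.update_of_ne, hv v]
    · simp [h]
    · rw [Ne, adr_inj]
      exact_mod_cast Ne.symm h

end Cmd

/-! ## Threshold, marking of variables, and output -/

/-- The number of pairs of variables that the algorithm looks for. -/
def threshold (d n : ℕ) (t : ℤ) : ℕ := d * (min t.toNat ((2 * n) ^ d) * (min t.toNat ((2 * n) ^ d) * (4 * 144 ^ d)))

namespace Cmd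

open Ex (lit glob loc add sub inp arr)

/-- Compute `4 * 144 ^ d * τ ^ 2 * d`, where `τ` is the parameter, between `0` and `(2 n) ^ d`. -/
def thresholdEx : Ex := .sum 50 0 <| .sum 51 5 <| .ite (.lt (loc 51) (inp (lit 3)))
  (.sum 52 5 <| .ite (.lt (loc 52) (inp (lit 3)))
    (add (add (arr 7 (glob 0)) (arr 7 (glob 0))) (add (arr 7 (glob 0)) (arr 7 (glob 0)))) (lit 0)) (lit 0)

/-- Compute the threshold `q` and `n / 2`, find out whether `n ≤ 4 q`, and if so mark all variables. -/
def setup : Cmd :=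
  seq (powers 7 (.sum 51 6 (arr 7 (loc 50)))) <|
  seq (wr 6 (lit 1) thresholdEx) <|
  seq (wr 6 (lit 2) (.div 1 50 51 (glob 1) (lit 2))) <|
  seq (wr 6 (lit 3) (.le (glob 1) (add (add (arr 6 (lit 1)) (arr 6 (lit 1))) (add (arr 6 (lit 1)) (arr 6 (lit 1)))))) <|
  .rep 1 1 (wr 5 (loc 1) (arr 6 (lit 3)))

/-- Mark `loc 1` and `loc 2` if they are unmarked and not interchangeable. -/
def markPair : Cmd :=
  .ite (.and (.not (arr 5 (loc 1))) (.and (.not (arr 5 (loc 2))) .distinguishes))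
    (seq (wr 5 (loc 1) (lit 1)) (wr 5 (loc 2) (lit 1))) (wr 5 (loc 1) (arr 5 (loc 1)))

/-- Mark pairs of variables that are not interchangeable, as long as there are any. -/
def greedy : Cmd := .rep 1 1 (.rep 2 1 markPair)

variable {γ η : ℕ → ℤ} {μ : ℤ → ℤ} {d n : ℕ} {I : CSP d n} {S : Finset (Fin n)} {t : ℤ}

theorem run_seq (p q : Cmd) : (seq p q).run γ η μ = q.run γ η (p.run γ η μ) := rfl

theorem run_ite (c : Ex) (p q : Cmd) :
    (ite c p q).run γ η μ = if 0 < c.eval γ μ η then p.run γ η μ else q.run γ η μ := rfl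

theorem sum_ite_cast_lt (N : ℕ) (t c : ℤ) :
    ∑ i ∈ Finset.range N, (if (i : ℤ) < t then c else 0) = (min t.toNat N : ℕ) * c := by
  rw [← Finset.sum_filter, Finset.sum_const, nsmul_eq_mul]
  congr 2
  rw [← Finset.card_range (min t.toNat N)]
  congr 1
  ext i
  simp only [Finset.mem_filter, Finset.mem_range]
  omega

theorem eval_thresholdEx (hγ : Ctx d n γ) (ht : μ 3 = t) (h7 : μ (adr 7 d) = (144 ^ d : ℕ)) :
    thresholdEx.eval γ μ η = threshold d n t := by
  rw [thresholdEx, Ex.eval_sum hγ.g0 (f := fun _ => (min t.toNat ((2 * n) ^ d) : ℕ) *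
    ((min t.toNat ((2 * n) ^ d) : ℕ) * (4 * 144 ^ d : ℤ)))]
  · simp only [Finset.sum_const, Finset.card_range, nsmul_eq_mul, threshold]
    push_cast
    rfl
  intro _ _
  rw [Ex.eval_sum hγ.g5 (f := fun i => if (i : ℤ) < t then (min t.toNat ((2 * n) ^ d) : ℕ) *
    (4 * 144 ^ d : ℤ) else 0), sum_ite_cast_lt]
  intro i _
  rw [Ex.eval_ite (P := (i : ℤ) < t) (by rw [Ex.eval_lt]; simp [Ex.eval, ht])]
  refine if_congr Iff.rfl ?_ rfl
  rw [Ex.eval_sum hγ.g5 (f := fun i => if (i : ℤ) < t then (4 * 144 ^ d : ℤ) else 0), sum_ite_cast_lt]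
  intro j _
  rw [Ex.eval_ite (P := (j : ℤ) < t) (by rw [Ex.eval_lt]; simp [Ex.eval, ht])]
  refine if_congr Iff.rfl ?_ rfl
  simp only [Ex.eval, hγ.g0, h7]
  push_cast
  ring

theorem run_setup (hn : 0 < n) (hγ : Ctx d n γ) (h6 : γ 6 = 144) (hI : Input I t μ)
    (h1 : ∀ j ≤ d, μ (adr 1 j) = ((2 * n) ^ j : ℕ)) (h2 : ∀ j ≤ d, μ (adr 2 j) = (2 ^ j : ℕ))
    (h4 : ∀ v : ℕ, μ (adr 4 v) = patternCount I.constraints v) :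
    Setting I (Finset.univ.filter fun _ => n ≤ 4 * threshold d n t) γ (setup.run γ η μ) ∧
      setup.run γ η μ (adr 6 1) = threshold d n t ∧
      setup.run γ η μ (adr 6 3) = ind (n ≤ 4 * threshold d n t) := by
  obtain ⟨f1, p1⟩ := run_powers (μ := μ) (η := η) (k := 7) (B := 144) (e := .sum 51 6 (arr 7 (loc 50))) hγ.g0
    fun j _ μ' _ h => by
      rw [Ex.eval_sum (n := 144) h6 (f := fun _ => (144 ^ j : ℕ))]
      · simp [pow_succ, mul_comm]
      · intro i _
        simpa [Ex.eval] using h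
  have q1 := eval_thresholdEx (η := η) (t := t) hγ (by rw [f1.inp (by norm_num), hI.param]) (p1 d le_rfl)
  rw [setup, run_seq, run_seq, run_seq, run_seq]
  set μ₁ := (powers 7 (.sum 51 6 (arr 7 (loc 50)))).run γ η μ
  set μ₂ := (wr 6 (lit 1) thresholdEx).run γ η μ₁ with e2
  have f2 : Frame 6 μ₁ μ₂ := (Frame.refl 6 μ₁).update 1 _
  have p2 : μ₂ (adr 6 1) = threshold d n t := by
    rw [e2, run, Ex.eval, Function.update_self, q1]
  set μ₃ := (wr 6 (lit 2) (.div 1 50 51 (glob 1) (lit 2))).run γ η μ₂ with e3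
  have f3 : Frame 6 μ₂ μ₃ := (Frame.refl 6 μ₂).update 2 _
  have p3 : μ₃ (adr 6 2) = (n / 2 : ℕ) := by
    rw [e3, run, Ex.eval, Function.update_self]
    exact Ex.eval_div (by norm_num) hγ.g1 (by norm_num) (Nat.div_le_self _ _)
      (fun i => by simp [Ex.eval, hγ.g1]) fun i j => rfl
  have p3' : μ₃ (adr 6 1) = threshold d n t := by
    rw [e3, run, Ex.eval, Function.update_of_ne (by norm_num [adr]), p2]
  set μ₄ := (wr 6 (lit 3) (.le (glob 1)
    (add (add (arr 6 (lit 1)) (arr 6 (lit 1))) (add (arr 6 (lit 1)) (arr 6 (lit 1)))))).run γ η μ₃ with e4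
  have f4 : Frame 6 μ₃ μ₄ := (Frame.refl 6 μ₃).update 3 _
  have p4 : μ₄ (adr 6 3) = ind (n ≤ 4 * threshold d n t) := by
    rw [e4, run, Ex.eval, Function.update_self, Ex.eval_le]
    simp only [Ex.eval, hγ.g1, p3']
    refine ind_congr ?_
    norm_cast
    -- The machine tests `n ≤ (q + q) + (q + q)`.
    omega
  have p4' : μ₄ (adr 6 1) = threshold d n t := by
    rw [e4, run, Ex.eval, Function.update_of_ne (by norm_num [adr]), p3']
  have p4'' : μ₄ (adr 6 2) = (n / 2 : ℕ) := by
    rw [e4, run, Ex.eval, Function.update_of_ne (by norm_num [adr]), p3]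
  obtain ⟨f5, p5⟩ : Frame 5 μ₄ ((Cmd.rep 1 1 (wr 5 (loc 1) (arr 6 (lit 3)))).run γ η μ₄) ∧
      ∀ i < n, (Cmd.rep 1 1 (wr 5 (loc 1) (arr 6 (lit 3)))).run γ η μ₄ (adr 5 i) =
        ind (n ≤ 4 * threshold d n t) := by
    rw [run, hγ.g1, Int.toNat_natCast]
    refine iter_induction (fun i μ' => Frame 5 μ₄ μ' ∧ ∀ j < i, μ' (adr 5 j) = ind (n ≤ 4 * threshold d n t))
      ⟨Frame.refl _ _, fun j hj => by simp at hj⟩ ?_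
    rintro i hi μ' ⟨f, hj⟩
    rw [run, Ex.eval, Function.update_self, Ex.eval, Ex.eval, f.arr, p4]
    refine ⟨f.update _ _, fun j hj' => ?_⟩
    rcases Nat.lt_or_ge j i with h | h
    · rw [Function.update_of_ne, hj j h]
      rw [Ne, adr_inj]
      omega
    · obtain rfl : j = i := by omega
      rw [Function.update_self]
  refine ⟨⟨hn, hγ, ⟨fun j hj => ?_, fun j hj => ?_, fun v _ => ?_, ?_⟩, fun i => ?_⟩, ?_, ?_⟩
  · rw [f5.arr, f4.arr, f3.arr, f2.arr, f1.arr, h1 j hj]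
  · rw [f5.arr, f4.arr, f3.arr, f2.arr, f1.arr, h2 j hj]
  · rw [f5.arr, f4.arr, f3.arr, f2.arr, f1.arr, h4]
  · rw [f5.arr, p4'']
  · rw [p5 i i.2]
    exact ind_congr (by simp only [Finset.mem_filter, Finset.mem_univ, true_and])
  · rw [f5.arr, p4']
  · rw [f5.arr, p4]

theorem run_markPair (h : Setting I S γ μ) {a b : Fin n} (ha : η 1 = (a : ℕ)) (hb : η 2 = (b : ℕ)) :
    ∃ S', Setting I S' γ (markPair.run γ η μ) ∧ Frame 5 μ (markPair.run γ η μ) ∧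
      ((S' = S ∧ ¬(a ∉ S ∧ b ∉ S ∧ Distinguishes I a b)) ∨
        (S' = insert a (insert b S) ∧ a ∉ S ∧ b ∉ S ∧ Distinguishes I a b)) := by
  have hc : (Ex.and (.not (arr 5 (loc 1))) (.and (.not (arr 5 (loc 2))) .distinguishes)).eval γ μ η =
      ind (a ∉ S ∧ b ∉ S ∧ Distinguishes I a b) :=
    Ex.eval_and (Ex.eval_not (by simp only [Ex.eval, ha, h.marks]))
      (Ex.eval_and (Ex.eval_not (by simp only [Ex.eval, hb, h.marks])) (Ex.eval_distinguishes h ha hb))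
  rw [markPair, run_ite, hc]
  by_cases hp : a ∉ S ∧ b ∉ S ∧ Distinguishes I a b
  · rw [if_pos (ind_pos.2 hp)]
    simp only [run, Ex.eval, ha, hb]
    have f : Frame 5 μ (Function.update (Function.update μ (adr 5 (a : ℕ)) 1) (adr 5 (b : ℕ)) 1) :=
      ((Frame.refl 5 μ).update _ _).update _ _
    refine ⟨_, ⟨h.pos, h.ctx, ⟨fun j hj => ?_, fun j hj => ?_, fun v hv => ?_, ?_⟩, fun i => ?_⟩, f,
      Or.inr ⟨rfl, hp⟩⟩
    · rw [f.arr, h.tables.pow j hj]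
    · rw [f.arr, h.tables.two j hj]
    · rw [f.arr, h.tables.count v hv]
    · rw [f.arr, h.tables.half]
    · by_cases hib : i = b
      · subst hib
        rw [Function.update_self, ind_of (by simp)]
      · rw [Function.update_of_ne (by rw [Ne, adr_inj]; exact_mod_cast fun h => hib (Fin.ext h))]
        by_cases hia : i = a
        · subst hia
          rw [Function.update_self, ind_of (by simp)]
        · rw [Function.update_of_ne (by rw [Ne, adr_inj]; exact_mod_cast fun h => hia (Fin.ext h)), h.marks]
          exact ind_congr (by simp [hia, hib])
  · rw [if_neg (by rwa [ind_pos]), show (wr 5 (loc 1) (arr 5 (loc 1))).run γ η μ = μ from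
      Function.update_eq_self _ _]
    exact ⟨S, h, Frame.refl _ _, Or.inl ⟨rfl, hp⟩⟩

/-- One scan suffices: `Distinguishes` does not refer to the marks, and marks are never removed, so
a pair that was passed over stays harmless. `P` is any property that marking such a pair preserves;
it is applied to the matching and, for small `n`, to the set of all variables. -/
theorem run_greedy (P : Finset (Fin n) → Prop) (hS : P S) (hP : ∀ S a b, P S → a ∉ S → b ∉ S →
    Distinguishes I a b → P (insert a (insert b S))) (h : Setting I S γ μ) :
    ∃ S', P S' ∧ Setting I S' γ (greedy.run γ η μ) ∧ Frame 5 μ (greedy.run γ η μ) ∧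
      ∀ a ∉ S', ∀ b ∉ S', ¬Distinguishes I a b := by
  rw [greedy, run, h.ctx.g1, Int.toNat_natCast]
  have := iter_induction (n := n) (a := μ)
    (f := fun i => (Cmd.rep 2 1 markPair).run γ (Function.update η 1 i))
    (fun A μ' => ∃ S', P S' ∧ Setting I S' γ μ' ∧ Frame 5 μ μ' ∧
      ∀ a : Fin n, (a : ℕ) < A → a ∉ S' → ∀ b ∉ S', ¬Distinguishes I a b)
    ⟨S, hS, h, Frame.refl _ _, fun a ha => by simp at ha⟩ ?_
  · obtain ⟨S', h1, h2, h3, h4⟩ := this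
    exact ⟨S', h1, h2, h3, fun a => h4 a a.2⟩
  rintro A hA μ' ⟨S', hS', hs, f, hd⟩
  rw [run, h.ctx.g1, Int.toNat_natCast]
  have := iter_induction (n := n) (a := μ')
    (f := fun i => markPair.run γ (Function.update (Function.update η 1 A) 2 i))
    (fun B μ' => ∃ S', P S' ∧ Setting I S' γ μ' ∧ Frame 5 μ μ' ∧
      ∀ a b : Fin n, (a : ℕ) < A ∨ ((a : ℕ) = A ∧ (b : ℕ) < B) → a ∉ S' → b ∉ S' → ¬Distinguishes I a b)
    ⟨S', hS', hs, f, fun a b h ha hb => hd a (by omega) ha b hb⟩ ?_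
  · obtain ⟨S', h1, h2, h3, h4⟩ := this
    exact ⟨S', h1, h2, h3, fun a ha ha' b hb => h4 a b (by omega) ha' hb⟩
  rintro B hB μ' ⟨S', hS', hs, f, hd⟩
  obtain ⟨S'', hs', f', h'⟩ := run_markPair (η := Function.update (Function.update η 1 A) 2 B)
    (a := ⟨A, hA⟩) (b := ⟨B, hB⟩) hs (by simp) (by simp)
  have hnew : ∀ a b : Fin n, (a : ℕ) < A ∨ ((a : ℕ) = A ∧ (b : ℕ) < B + 1) →
      ((a : ℕ) < A ∨ ((a : ℕ) = A ∧ (b : ℕ) < B)) ∨ (a = ⟨A, hA⟩ ∧ b = ⟨B, hB⟩) := by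
    intro a b h
    simp only [Fin.ext_iff]
    omega
  refine ⟨S'', ?_, hs', f.trans f', fun a b hab ha hb => ?_⟩
  · rcases h' with ⟨rfl, _⟩ | ⟨rfl, h⟩
    · exact hS'
    · exact hP _ _ _ hS' h.1 h.2.1 h.2.2
  · rcases h' with ⟨rfl, hn⟩ | ⟨rfl, h⟩
    · rcases hnew a b hab with h | ⟨rfl, rfl⟩
      · exact hd a b h ha hb
      · exact fun hD => hn ⟨ha, hb, hD⟩
    · simp only [Finset.mem_insert, not_or] at ha hb
      rcases hnew a b hab with h | ⟨rfl, rfl⟩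
      · exact hd a b h ha.2.2 hb.2.2
      · exact absurd rfl ha.1

/-! ### Output -/

/-- Append a number to the output. -/
def emit (e : Ex) : Cmd := seq (out (arr 6 (lit 5)) e) (wr 6 (lit 5) (add (arr 6 (lit 5)) (lit 1)))

/-- Do nothing. -/
def skip : Cmd := wr 6 (lit 5) (arr 6 (lit 5))

/-- Append the variables `loc 1` with a property to the output. -/
def emitVars (c : Ex) : Cmd := .rep 1 1 (.ite c (emit (loc 1)) skip)

/-- Output the kernel on the set of marked variables. -/
def emitKernel : Cmd :=
  seq (emit (lit 0)) <| seq (emit (.sum 40 1 (arr 5 (loc 40)))) <| seq (emitVars (arr 5 (loc 1))) <|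
  seq (emit (glob 4)) <| seq (emit (.sum 5 5 (.valid 5))) <|
  .rep 5 5 <| .ite (.valid 5) (seq (emit .coef) <| seq (emit (.card 5)) (emitVars (.mem 1 5))) skip

/-- Output the answer. -/
def answer : Cmd := seq (wr 6 (lit 5) (lit 0)) <|
  .ite (.and (.not (arr 6 (lit 3))) (.le (add (arr 6 (lit 1)) (arr 6 (lit 1))) (.sum 50 1 (arr 5 (loc 50)))))
    (emit (lit 1)) emitKernel

/-- The list `w` has been written to the memory `μ₀`, which is otherwise unchanged at negative addresses. -/
structure _root_.Emitted (w : List ℤ) (μ₀ μ : ℤ → ℤ) : Prop where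
  neg : ∀ x < 0, x ≠ adr 6 5 → μ x = μ₀ x
  length : μ (adr 6 5) = w.length
  get : ∀ (i : ℕ) (h : i < w.length), μ i = w[i]

variable {w : List ℤ} {μ₀ : ℤ → ℤ}

/-- The output overwrites the input, but the tables and marks live at negative addresses, of which
only the output pointer changes. Expressions therefore keep their values while the answer is
written. -/
theorem _root_.Emitted.setting (h : Emitted w μ₀ μ) (hs : Setting I S γ μ₀) : Setting I S γ μ := by
  have hadr : ∀ (k : ℕ) (i : ℕ), 1 ≤ k → k ≤ 5 → μ (adr k i) = μ₀ (adr k i) := fun k i hk hk' =>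
    h.neg _ (by simp only [adr]; omega) (by simp only [adr]; omega)
  refine ⟨hs.pos, hs.ctx, ⟨fun j hj => ?_, fun j hj => ?_, fun v hv => ?_, ?_⟩, fun i => ?_⟩
  · rw [hadr _ _ (by norm_num) (by norm_num), hs.tables.pow j hj]
  · rw [hadr _ _ (by norm_num) (by norm_num), hs.tables.two j hj]
  · rw [hadr _ _ (by norm_num) (by norm_num), hs.tables.count v hv]
  · rw [h.neg _ (by norm_num [adr]) (by norm_num [adr]), hs.tables.half]
  · rw [hadr _ _ (by norm_num) (by norm_num), hs.marks]

theorem _root_.Emitted.emit (h : Emitted w μ₀ μ) {e : Ex} {z : ℤ} (he : e.eval γ μ η = z) :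
    Emitted (w ++ [z]) μ₀ ((emit e).run γ η μ) := by
  have h0 : adr 6 5 = -46 := by norm_num [adr]
  have hne : adr 6 5 ≠ (w.length : ℤ) := by rw [h0]; omega
  have hl := h.length
  simp only [Cmd.emit, run, Ex.eval, he, hl, Function.update_of_ne hne]
  refine ⟨fun x hx hx' => ?_, ?_, fun i hi => ?_⟩
  · rw [Function.update_of_ne hx', Function.update_of_ne (by omega), h.neg x hx hx']
  · rw [Function.update_self]
    simp
  · rw [Function.update_of_ne (by rw [h0]; omega)]
    simp only [List.length_append, List.length_cons, List.length_nil] at hi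
    rcases Nat.lt_or_ge i w.length with h' | h'
    · rw [Function.update_of_ne (by omega), h.get i h', List.getElem_append_left h']
    · obtain rfl : i = w.length := by omega
      rw [Function.update_self]
      simp

theorem run_skip : skip.run γ η μ = μ := Function.update_eq_self _ _

theorem _root_.Emitted.rep (h : Emitted w μ₀ μ) {x b N : ℕ} (hN : γ b = N) {p : Cmd} {f : ℕ → List ℤ}
    (hp : ∀ i < N, ∀ w μ, Emitted w μ₀ μ → Emitted (w ++ f i) μ₀ (p.run γ (Function.update η x i) μ)) :
    Emitted (w ++ (List.range N).flatMap f) μ₀ ((Cmd.rep x b p).run γ η μ) := by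
  rw [run, hN, Int.toNat_natCast]
  refine iter_induction (fun i μ' => Emitted (w ++ (List.range i).flatMap f) μ₀ μ') (by simpa using h) ?_
  intro i hi μ' h'
  rw [List.range_succ, List.flatMap_append, ← List.append_assoc]
  simpa using hp i hi _ _ h'

theorem _root_.List.map_filter_eq_flatMap {α β : Type*} (l : List α) (p : α → Prop) [DecidablePred p] (f : α → β) :
    (l.filter (p ·)).map f = l.flatMap fun a => if p a then [f a] else [] := by
  induction l with
  | nil => rfl
  | cons a l ih =>
    rw [List.flatMap_cons, ← ih]
    by_cases h : p a <;> simp [h]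

theorem _root_.Emitted.vars (h : Emitted w μ₀ μ) (hγ : Ctx d n γ) {c : Ex} {T : Finset (Fin n)}
    (hc : ∀ (i : Fin n) (w μ), Emitted w μ₀ μ → c.eval γ μ (Function.update η 1 (i : ℕ)) = ind (i ∈ T)) :
    Emitted (w ++ (elems T).map fun i : Fin n => ((i : ℕ) : ℤ)) μ₀ ((emitVars c).run γ η μ) := by
  have := h.rep (η := η) (x := 1) hγ.g1 (p := .ite c (Cmd.emit (loc 1)) skip)
    (f := fun i => if ∃ hi : i < n, (⟨i, hi⟩ : Fin n) ∈ T then [(i : ℤ)] else []) fun i hi w μ h => by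
      rw [run_ite, hc ⟨i, hi⟩ w μ h]
      by_cases hT : (⟨i, hi⟩ : Fin n) ∈ T
      · rw [if_pos (ind_pos.2 hT), if_pos ⟨hi, hT⟩]
        exact h.emit (by simp [Ex.eval])
      · rw [if_neg (fun ⟨_, h⟩ => hT h), if_neg (by rwa [ind_pos]), List.append_nil, run_skip]
        exact h
  rw [emitVars]
  convert this using 2
  rw [elems, List.map_filter_eq_flatMap, ← List.map_coe_finRange_eq_range, List.flatMap_map]
  congr 1
  funext i
  simp

theorem _root_.encodeVars_eq (l : List (Fin n)) :
    encodeVars l = (l.length : ℤ) :: l.map fun i : Fin n => ((i : ℕ) : ℤ) := by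
  rw [encodeVars]
  congr 1
  induction l with
  | nil => rfl
  | cons a l ih => simpa using ih

theorem run_emitKernel (hs : Setting I S γ μ₀) (h : Emitted [] μ₀ μ) :
    Emitted (0 :: (I.kernel S).encode) μ₀ (emitKernel.run γ η μ) := by
  classical
  have hγ := hs.ctx
  have k1 := h.emit (η := η) (γ := γ) (e := lit 0) rfl
  have k2 := k1.emit (η := η) (γ := γ) (e := .sum 40 1 (arr 5 (loc 40))) (z := S.card) (by
    rw [Ex.eval_sum_fin hγ (R := fun i => i ∈ S) fun i => ?_, Finset.filter_univ_mem]
    simp only [Ex.eval, Function.update_self, (k1.setting hs).marks])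
  have k3 := k2.vars (η := η) hγ (c := arr 5 (loc 1)) (T := S) fun i w μ h => by
    simp only [Ex.eval, Function.update_self, (h.setting hs).marks]
  have k4 := k3.emit (η := η) (γ := γ) (e := glob 4) (z := (2 ^ d : ℕ)) hγ.g4
  have k5 := k4.emit (η := η) (γ := γ) (e := .sum 5 5 (.valid 5))
    (z := ((Finset.range ((2 * n) ^ d)).filter (ValidCode d S ·)).card) (by
      rw [Ex.eval_sum hγ.g5 (f := fun v => ind (ValidCode d S v)), Ex.sum_ind]
      exact fun v hv => Ex.eval_valid (k4.setting hs) (by norm_num) (by simp) hv)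
  have k6 := k5.rep (η := η) (x := 5) hγ.g5 (p := .ite (.valid 5) (seq (Cmd.emit .coef) <|
      seq (Cmd.emit (.card 5)) (emitVars (.mem 1 5))) skip)
    (f := fun v => if ValidCode d S v then I.coef S (codeSet d n v) :: encodeVars (elems (codeSet d n v)) else [])
    fun v hv w μ h => by
      rw [run_ite, Ex.eval_valid (h.setting hs) (by norm_num) (by simp) hv]
      by_cases hV : ValidCode d S v
      · rw [if_pos (ind_pos.2 hV), if_pos hV, run_seq, run_seq]
        have j1 := h.emit (η := Function.update η 5 v) (γ := γ)
          (Ex.eval_coef (h.setting hs) (by simp) hv)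
        have j2 := j1.emit (η := Function.update η 5 v) (γ := γ)
          (Ex.eval_card (v := 5) (j1.setting hs) (by norm_num) (by simp) hv)
        have j3 := j2.vars (η := Function.update η 5 v) hγ (c := .mem 1 5) (T := codeSet d n v) fun i w μ h =>
          Ex.eval_mem hγ hs.pos (h.setting hs).tables.pow (by norm_num) (by norm_num) (by simp) (by simp) hv
        simpa [encodeVars_eq, length_elems] using j3
      · rw [if_neg hV, if_neg (by rwa [ind_pos]), List.append_nil, run_skip]
        exact h
  rw [emitKernel, run_seq, run_seq, run_seq, run_seq, run_seq]
  convert k6 using 1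
  have hflat : ∀ (l : List ℕ) (f : ℕ → List ℤ), ((l.filter (ValidCode d S ·)).flatMap f) =
      l.flatMap fun v => if ValidCode d S v then f v else [] := by
    intro l f
    induction l with
    | nil => rfl
    | cons a l ih =>
      rw [List.flatMap_cons, ← ih]
      by_cases h : ValidCode d S a <;> simp [h]
  have hlen : ((Finset.range ((2 * n) ^ d)).filter (ValidCode d S ·)).card =
      ((List.range ((2 * n) ^ d)).filter (ValidCode d S ·)).length := rfl
  simp only [Kernel.encode, CSP.kernel, List.flatMap_map, hflat, List.length_map, hlen]
  simp [encodeVars_eq, length_elems, Ex.eval]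

theorem run_answer (hs : Setting I S γ μ) {q : ℕ} {P : Prop} (h1 : μ (adr 6 1) = q) (h3 : μ (adr 6 3) = ind P) :
    ((¬P ∧ 2 * q ≤ S.card) ∧ Emitted [1] μ (answer.run γ η μ)) ∨
      (¬(¬P ∧ 2 * q ≤ S.card) ∧ Emitted (0 :: (I.kernel S).encode) μ (answer.run γ η μ)) := by
  rw [answer, run_seq, run_ite]
  have hE : Emitted [] μ ((wr 6 (lit 5) (lit 0)).run γ η μ) := by
    simp only [run, Ex.eval]
    exact ⟨fun x _ hx => Function.update_of_ne hx _ _, Function.update_self _ _ _, fun i hi => by simp at hi⟩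
  set μ' := (wr 6 (lit 5) (lit 0)).run γ η μ
  have hc : (Ex.and (.not (arr 6 (lit 3))) (.le (add (arr 6 (lit 1)) (arr 6 (lit 1)))
      (.sum 50 1 (arr 5 (loc 50))))).eval γ μ' η = ind (¬P ∧ 2 * q ≤ S.card) := by
    refine Ex.eval_and (Ex.eval_not ?_) ?_
    · rw [← h3]
      exact hE.neg (adr 6 3) (by norm_num [adr]) (by norm_num [adr])
    · rw [Ex.eval_le, Ex.eval_sum_fin hs.ctx (R := fun i => i ∈ S) fun i => ?_, Finset.filter_univ_mem]
      · have : μ' (adr 6 1) = q := by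
          rw [← h1]
          exact hE.neg _ (by norm_num [adr]) (by norm_num [adr])
        simp only [Ex.eval, this]
        refine ind_congr ?_
        norm_cast
        omega
      · simp only [Ex.eval, Function.update_self, (hE.setting hs).marks]
  rw [hc]
  by_cases h : ¬P ∧ 2 * q ≤ S.card
  · rw [if_pos (ind_pos.2 h)]
    exact Or.inl ⟨h, hE.emit rfl⟩
  · rw [if_neg (by rwa [ind_pos])]
    exact Or.inr ⟨h, run_emitKernel hs hE⟩

end Cmd

/-! ## The program -/

theorem Distinguishes.symm {d n : ℕ} {I : CSP d n} {a b : Fin n} (h : Distinguishes I a b) :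
    Distinguishes I b a := by
  obtain ⟨u, hu, v, hv, hc, h⟩ := h
  exact ⟨u, hu, v, hv, hc, by rwa [swapAt_comm]⟩

/-- The variables in `S` are matched in pairs of variables that are not interchangeable. -/
def Matched {d n : ℕ} (I : CSP d n) (S : Finset (Fin n)) : Prop :=
  ∃ π : Fin n → Fin n, Function.Involutive π ∧ (∀ i, i ∈ S ↔ π i ≠ i) ∧ ∀ i ∈ S, Distinguishes I i (π i)

/-- Unmarked variables are fixed points of the involution, so it can be redefined to exchange two of
them. -/
theorem Matched.insert {d n : ℕ} {I : CSP d n} {S : Finset (Fin n)} {a b : Fin n} (h : Matched I S)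
    (ha : a ∉ S) (hb : b ∉ S) (hab : Distinguishes I a b) : Matched I (insert a (insert b S)) := by
  obtain ⟨π, h1, h2, h3⟩ := h
  have hne := hab.ne
  have πa : π a = a := by simpa [h2] using ha
  have πb : π b = b := by simpa [h2] using hb
  have hfix : ∀ i, i ≠ a → i ≠ b → π i ≠ a ∧ π i ≠ b := fun i hia hib =>
    ⟨fun h => hia (by rw [← h1 i, h, πa]), fun h => hib (by rw [← h1 i, h, πb])⟩
  refine ⟨fun i => if i = a then b else if i = b then a else π i, fun i => ?_, fun i => ?_, fun i hi => ?_⟩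
  · by_cases hia : i = a
    · simp [hia, hne.symm]
    · by_cases hib : i = b
      · simp [hib, hne.symm]
      · simp [hia, hib, hfix i hia hib, h1 i]
  · by_cases hia : i = a
    · simp [hia, hne.symm]
    · by_cases hib : i = b
      · simp [hib, hne, hne.symm]
      · simp [hia, hib, h2]
  · by_cases hia : i = a
    · simpa [hia] using hab
    · by_cases hib : i = b
      · simpa [hib, hne.symm] using hab.symm
      · have hS : i ∈ S := by simpa [hia, hib] using hi
        simpa [hia, hib] using h3 i hS

theorem threshold_eq (d n : ℕ) (t : ℤ) :
    threshold d n t = 4 * d * 144 ^ d * (min t.toNat ((2 * n) ^ d)) ^ 2 := by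
  rw [threshold]
  ring

/-- `7 * 9 * 2 ^ 2 = 252` exceeds `144`, and `16 * d ≤ 24 * d ^ 2`; the factorials in the constant
are not needed. -/
theorem four_mul_threshold_le {d : ℕ} (hd : 1 ≤ d) (n : ℕ) (t : ℤ) :
    ((4 * threshold d n t : ℕ) : ℤ) ≤ kernelConst d * t ^ 2 := by
  have h1 : ((min t.toNat ((2 * n) ^ d) : ℕ) : ℤ) ^ 2 ≤ t ^ 2 :=
    (sq_le_sq' (by have := abs_nonneg t; omega) (by have := abs_nonneg t; have := le_abs_self t; omega)).trans_eq
      (sq_abs t)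
  have h2 : 16 * d * 144 ^ d ≤ kernelConst d := by
    have h3 : 0 < ∏ k ∈ Finset.Icc 2 d, k.factorial := Finset.prod_pos fun k _ => k.factorial_pos
    have h4 : 7 ^ d * 9 ^ d * 2 ^ (2 * d) = 252 ^ d := by rw [pow_mul, ← mul_pow, ← mul_pow]; norm_num
    calc 16 * d * 144 ^ d ≤ (24 * d ^ 2) * 252 ^ d * 1 := by
          rw [mul_one]
          exact Nat.mul_le_mul (by nlinarith) (Nat.pow_le_pow_left (by norm_num) d)
      _ ≤ (24 * d ^ 2) * 252 ^ d * (∏ k ∈ Finset.Icc 2 d, k.factorial) ^ 2 :=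
          Nat.mul_le_mul_left _ (Nat.one_le_pow _ _ h3)
      _ = kernelConst d := by rw [← h4, kernelConst]; ring
  have h2' : (16 * d * 144 ^ d : ℤ) ≤ kernelConst d := by exact_mod_cast h2
  rw [threshold_eq]
  calc ((4 * (4 * d * 144 ^ d * (min t.toNat ((2 * n) ^ d)) ^ 2) : ℕ) : ℤ)
      = (16 * d * 144 ^ d) * ((min t.toNat ((2 * n) ^ d) : ℕ) : ℤ) ^ 2 := by
        push_cast
        ring
    _ ≤ _ := mul_le_mul h2' h1 (sq_nonneg _) (by positivity)

/-- The part of the algorithm after the constraints have been read. -/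
def Cmd.solve : Cmd := seq setup (seq greedy answer)

/-- If `n ≤ 4 q`, all variables are kept. Otherwise `2 q` matched variables contain `q` disjoint
pairs and certify the optimum, while fewer than `2 q < n / 2` leave a junta. For `t ≤ 0` one has `q
= 0` and the certificate is trivially correct. -/
theorem Cmd.run_solve {d n : ℕ} {γ η : ℕ → ℤ} {μ : ℤ → ℤ} {I : CSP d n} {t : ℤ} (hd : 1 ≤ d) (hn : 0 < n)
    (he : Even n) (hγ : Ctx d n γ) (h6 : γ 6 = 144) (hI : Input I t μ)
    (h1 : ∀ j ≤ d, μ (adr 1 j) = ((2 * n) ^ j : ℕ)) (h2 : ∀ j ≤ d, μ (adr 2 j) = (2 ^ j : ℕ))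
    (h4 : ∀ v : ℕ, μ (adr 4 v) = patternCount I.constraints v) :
    ∃ w, (∀ (i : ℕ) (h : i < w.length), solve.run γ η μ i = w[i]) ∧
      ((w = [1] ∧ I.avg + (t : ℚ) ≤ (I.opt : ℚ)) ∨ ∃ κ : Kernel n, w = 0 :: κ.encode ∧ κ.IsKernelOf I ∧
        (κ.vars.length : ℤ) ≤ (kernelConst d : ℤ) * t ^ 2) := by
  obtain ⟨h, hh⟩ := he
  have hnh : n = 2 * h := by omega
  obtain ⟨s1, s2, s3⟩ := run_setup (η := η) hn hγ h6 hI h1 h2 h4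
  have hq := four_mul_threshold_le hd n t
  have hqe := threshold_eq d n t
  rw [solve, run_seq, run_seq]
  set μ₁ := setup.run γ η μ
  set q := threshold d n t
  by_cases hsmall : n ≤ 4 * q
  · obtain ⟨S, rfl, s4, f, -⟩ := run_greedy (η := η) (fun S => S = Finset.univ) (by simp [hsmall])
      (fun S a b hS ha => absurd (hS ▸ Finset.mem_univ a) ha) s1
    rcases run_answer (η := η) s4 (by rw [f.arr, s2]) (by rw [f.arr, s3]) with ⟨h, -⟩ | ⟨-, h⟩
    · exact absurd hsmall h.1
    · refine ⟨_, h.get, Or.inr ⟨_, rfl, CSP.kernel_isKernelOf hn hnh I.isJunta_univ, le_trans ?_ hq⟩⟩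
      simp only [CSP.kernel, length_elems, Finset.card_univ, Fintype.card_fin]
      exact_mod_cast hsmall
  · obtain ⟨S, hS, s4, f, hD⟩ := run_greedy (η := η) (Matched I)
      ⟨id, fun _ => rfl, fun i => by simp [hsmall], fun i hi => by simp [hsmall] at hi⟩
      (fun S a b hS => hS.insert) s1
    rcases run_answer (η := η) s4 (by rw [f.arr, s2]) (by rw [f.arr, s3]) with ⟨hc, h⟩ | ⟨hc, h⟩
    · refine ⟨_, h.get, Or.inl ⟨rfl, ?_⟩⟩
      obtain ⟨π, p1, p2, p3⟩ := hS
      obtain ⟨d, rfl⟩ : ∃ e, d = e + 1 := ⟨d - 1, by omega⟩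
      have := avg_add_le_opt hnh I p1 p2 p3 (t := min t.toNat ((2 * n) ^ (d + 1))) (by rw [← hqe]; exact hc.2)
      -- The parameter was capped at `(2 n) ^ d` to keep the loops short. If the cap is effective
      -- then `q ≥ n`, which is the case of small `n` already settled.
      have ht : t ≤ (min t.toNat ((2 * n) ^ (d + 1)) : ℕ) := by
        rcases Nat.le_total t.toNat ((2 * n) ^ (d + 1)) with hle | hle
        · rw [min_eq_left hle]
          omega
        · rw [min_eq_right hle] at hqe
          have e1 : n ≤ (2 * n) ^ (d + 1) := (by omega : n ≤ 2 * n).trans (Nat.le_self_pow (by omega) _)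
          have e2 : (2 * n) ^ (d + 1) ≤ ((2 * n) ^ (d + 1)) ^ 2 := Nat.le_self_pow (by norm_num) _
          have e3 : 1 * ((2 * n) ^ (d + 1)) ^ 2 ≤ q := by
            rw [hqe]
            exact Nat.mul_le_mul_right _ (Nat.succ_le_of_lt (by positivity))
          omega
      have ht' : (t : ℚ) ≤ (min t.toNat ((2 * n) ^ (d + 1)) : ℕ) := by exact_mod_cast ht
      linarith
    · have hcard : S.card < 2 * q := by
        by_contra hle
        exact hc ⟨hsmall, not_lt.1 hle⟩
      refine ⟨_, h.get, Or.inr ⟨_, rfl, CSP.kernel_isKernelOf hn hnh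
        (I.isJunta_of_forall hn hnh (by omega) hD), le_trans ?_ hq⟩⟩
      simp only [CSP.kernel, length_elems]
      omega

/-! ### Assembling the program -/

/-- Set a global name to the value of an expression. -/
def assign (g : ℕ) (e : Ex) : Prog := .seq (e.comp 0) (.seq (.const (tR 1) 0) (.add (gR g) (tR 0) (tR 1)))

/-- Started with the globals `γ` and the memory `μ`, the program halts after at most `T` steps with the
globals `γ'` and the memory `μ'`. -/
def Steps (P : Prog) (γ : ℕ → ℤ) (μ : ℤ → ℤ) (T : ℕ) (γ' : ℕ → ℤ) (μ' : ℤ → ℤ) : Prop :=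
  ∀ s : RamState, s.globals = γ → s.locals = 0 → s.mem = μ →
    ∃ s', Runs P s T s' ∧ s'.globals = γ' ∧ s'.locals = 0 ∧ s'.mem = μ'

namespace Steps

variable {P Q : Prog} {γ γ' γ'' : ℕ → ℤ} {μ μ' μ'' : ℤ → ℤ} {T T' : ℕ}

theorem seq (h : Steps P γ μ T γ' μ') (h' : Steps Q γ' μ' T' γ'' μ'') :
    Steps (.seq P Q) γ μ (T + T') γ'' μ'' := by
  intro s h1 h2 h3
  obtain ⟨s', r, h1, h2, h3⟩ := h s h1 h2 h3
  obtain ⟨s'', r', h'⟩ := h' s' h1 h2 h3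
  exact ⟨s'', r.seq r', h'⟩

theorem cmd (c : Cmd) (γ : ℕ → ℤ) (μ : ℤ → ℤ) : Steps (c.comp 0) γ μ (c.time γ) γ (c.run γ 0 μ) := by
  rintro s rfl h2 rfl
  obtain ⟨s', r, a, m⟩ := c.runs_comp 0 s
  exact ⟨s', r, a.globals, a.locals.trans h2, by rw [m, h2]⟩

theorem assign (g : ℕ) (e : Ex) (γ : ℕ → ℤ) (μ : ℤ → ℤ) :
    Steps (assign g e) γ μ (e.time γ + 2) (Function.update γ g (e.eval γ μ 0)) μ := by
  rintro s rfl h2 rfl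
  obtain ⟨s', r, m, a, v⟩ := e.runs_comp 0 s
  refine ⟨_, r.seq ((Runs.const _ _ _).seq (Runs.add _ _ _ _)), ?_, ?_, m⟩
  · rw [RamState.reg_setReg_self, RamState.reg_setReg_of_ne _ _ (by norm_num [tR]), v, add_zero, h2, ← a.globals]
    funext h
    by_cases hg : h = g
    · subst hg
      rw [Function.update_self, RamState.globals, RamState.reg_setReg_self]
    · rw [Function.update_of_ne hg, RamState.globals, RamState.reg_setReg_of_ne _ _ (by simp only [gR]; omega),
        RamState.reg_setReg_of_ne _ _ (by simp only [gR, tR]; omega)]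
      rfl
  · rw [← h2, ← a.locals]
    funext x
    rw [RamState.locals, RamState.reg_setReg_of_ne _ _ (by simp only [gR, lR]; omega),
      RamState.reg_setReg_of_ne _ _ (by simp only [lR, tR]; omega)]
    rfl

end Steps

/-- The algorithm. -/
def kernelProgram : Prog := .seq (
  .seq (assign 0 (.inp (.lit 0))) <| .seq (assign 1 (.inp (.lit 1))) <| .seq (assign 2 (.inp (.lit 2))) <|
  .seq (assign 3 (.add (.glob 1) (.glob 1))) <| .seq (Cmd.tables.comp 0) <|
  .seq (assign 4 (.arr 2 (.glob 0))) <| .seq (assign 5 (.arr 1 (.glob 0))) <| .seq (assign 6 (.lit 144)) <|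
  .seq ((Cmd.rep 50 2 Cmd.countPatterns).comp 0) <|
  Cmd.solve.comp 0) (.const 0 0)

/-- The values of the global names after they have been set. -/
def finalGlobals (d n m : ℕ) : ℕ → ℤ
  | 0 => d
  | 1 => n
  | 2 => m
  | 3 => (2 * n : ℕ)
  | 4 => (2 ^ d : ℕ)
  | 5 => ((2 * n) ^ d : ℕ)
  | 6 => 144
  | _ => 0

/-- The values of the global names when the tables are computed. -/
def firstGlobals (d n m : ℕ) : ℕ → ℤ
  | 0 => d
  | 1 => n
  | 2 => m
  | 3 => (2 * n : ℕ)
  | _ => 0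

theorem ctx_finalGlobals (d n m : ℕ) : Ctx d n (finalGlobals d n m) := ⟨rfl, rfl, rfl, rfl, rfl⟩

/-- The number of constraints multiplies only the cost of reading one constraint. The bounds `2 ^ d`
and `(2 n) ^ d` are set after the tables have been computed, hence two stages of globals. -/
theorem kernelProgram_runs {d n : ℕ} (hd : 1 ≤ d) (hn : 0 < n) (he : Even n) (I : CSP d n) (t : ℤ) :
    ∃ s w, Runs kernelProgram (RamState.init (I.encode t))
      (51 + Cmd.tables.time (firstGlobals d n I.size) +
        I.size * (Cmd.countPatterns.time (finalGlobals d n I.size) + 4) +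
        Cmd.solve.time (finalGlobals d n I.size)) s ∧ s.Shows w ∧
      ((w = [1] ∧ I.avg + (t : ℚ) ≤ (I.opt : ℚ)) ∨ ∃ κ : Kernel n, w = 0 :: κ.encode ∧ κ.IsKernelOf I ∧
        (κ.vars.length : ℤ) ≤ (kernelConst d : ℤ) * t ^ 2) := by
  have hin := input_init I t
  set μ₀ := (RamState.init (I.encode t)).mem with hμ₀
  have hneg : ∀ x < 0, μ₀ x = 0 := fun x hx => by simp [hμ₀, RamState.init, not_le.2 hx]
  obtain ⟨t1, t2, t3, t4⟩ := Cmd.run_tables (γ := firstGlobals d n I.size) (η := 0) (μ := μ₀) (d := d) (n := n)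
    rfl rfl
  set μ₁ := Cmd.tables.run (firstGlobals d n I.size) 0 μ₀
  have hin1 : Input I t μ₁ := hin.congr fun x hx => t1 x fun i => by
    simp only [adr]
    omega
  obtain ⟨f, c4⟩ := Cmd.run_rep_countPatterns (η := 0) (ctx_finalGlobals d n I.size) hin1 t3 t4
    (fun v => by
      rw [t1 _ fun i => by simp only [adr]; omega]
      exact hneg _ (by simp only [adr]; omega)) rfl
  set μ₂ := (Cmd.rep 50 2 Cmd.countPatterns).run (finalGlobals d n I.size) 0 μ₁
  obtain ⟨w, hw, hres⟩ := Cmd.run_solve (η := 0) hd hn he (ctx_finalGlobals d n I.size) rfl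
    (hin1.congr fun x hx => f.inp hx) (fun j hj => by rw [f.arr, t2 j hj]) (fun j hj => by rw [f.arr, t3 j hj]) c4
  have e1 : Function.update (Function.update (Function.update (Function.update (0 : ℕ → ℤ) 0 d) 1 n) 2 I.size) 3
      (n + n) = firstGlobals d n I.size := by
    funext g
    match g with
    | 0 | 1 | 2 => simp [firstGlobals]
    | 3 => simp [firstGlobals, two_mul]
    | g + 4 => simp [firstGlobals]
  have e2 : Function.update (Function.update (Function.update (firstGlobals d n I.size) 4 (2 ^ d : ℕ)) 5
      ((2 * n) ^ d : ℕ)) 6 144 = finalGlobals d n I.size := by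
    funext g
    match g with
    | 0 | 1 | 2 | 3 | 4 | 5 | 6 => simp [firstGlobals, finalGlobals]
    | g + 7 => simp [firstGlobals, finalGlobals]
  have a0 := Steps.assign 0 (.inp (.lit 0)) 0 μ₀
  rw [show (Ex.inp (.lit 0)).eval 0 μ₀ 0 = d from hin.arity] at a0
  have a1 := Steps.assign 1 (.inp (.lit 1)) (Function.update 0 0 d) μ₀
  rw [show (Ex.inp (.lit 1)).eval (Function.update 0 0 d) μ₀ 0 = n from hin.vars] at a1
  have a2 := Steps.assign 2 (.inp (.lit 2)) (Function.update (Function.update 0 0 d) 1 n) μ₀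
  rw [show (Ex.inp (.lit 2)).eval (Function.update (Function.update 0 0 d) 1 n) μ₀ 0 = I.size from hin.size] at a2
  have a3 := Steps.assign 3 (.add (.glob 1) (.glob 1))
    (Function.update (Function.update (Function.update 0 0 d) 1 n) 2 I.size) μ₀
  rw [show (Ex.add (.glob 1) (.glob 1)).eval (Function.update (Function.update (Function.update 0 0 d) 1 n) 2
    I.size) μ₀ 0 = n + n from rfl, e1] at a3
  have b := Steps.cmd Cmd.tables (firstGlobals d n I.size) μ₀
  have a4 := Steps.assign 4 (.arr 2 (.glob 0)) (firstGlobals d n I.size) μ₁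
  rw [show (Ex.arr 2 (.glob 0)).eval (firstGlobals d n I.size) μ₁ 0 = (2 ^ d : ℕ) from t3 d le_rfl] at a4
  have a5 := Steps.assign 5 (.arr 1 (.glob 0)) (Function.update (firstGlobals d n I.size) 4 (2 ^ d : ℕ)) μ₁
  rw [show (Ex.arr 1 (.glob 0)).eval (Function.update (firstGlobals d n I.size) 4 (2 ^ d : ℕ)) μ₁ 0 =
    ((2 * n) ^ d : ℕ) from t2 d le_rfl] at a5
  have a6 := Steps.assign 6 (.lit 144) (Function.update (Function.update (firstGlobals d n I.size) 4
    (2 ^ d : ℕ)) 5 ((2 * n) ^ d : ℕ)) μ₁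
  rw [show (Ex.lit 144).eval (Function.update (Function.update (firstGlobals d n I.size) 4
    (2 ^ d : ℕ)) 5 ((2 * n) ^ d : ℕ)) μ₁ 0 = 144 from rfl, e2] at a6
  have b1 := Steps.cmd (Cmd.rep 50 2 Cmd.countPatterns) (finalGlobals d n I.size) μ₁
  have b2 := Steps.cmd Cmd.solve (finalGlobals d n I.size) μ₂
  obtain ⟨s, r, -, -, hm⟩ := (a0.seq <| a1.seq <| a2.seq <| a3.seq <| b.seq <| a4.seq <| a5.seq <| a6.seq <|
    b1.seq b2) (RamState.init (I.encode t)) rfl rfl rfl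
  refine ⟨_, w, (r.seq (Runs.const s 0 0)).mono (le_of_eq ?_), fun i hi => ?_, hres⟩
  · have : (finalGlobals d n I.size 2).toNat = I.size := rfl
    simp only [Ex.time, Cmd.time, this]
    ring
  · rw [RamState.reg_setReg_self, RamState.mem_setReg, hm, zero_add]
    exact hw i hi

theorem Cmd.bounds_tables : ∀ g ∈ tables.bounds, g = 0 ∨ g = 3 := by decide

/-- The work per constraint loops over `d` and `2 ^ d` only, so it is bounded by a function of `d`.
-/
theorem Cmd.bounds_countPatterns : ∀ g ∈ countPatterns.bounds, g = 0 ∨ g = 4 := by decide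

-- Name 2, the number of constraints, is missing: after the input has been read, the time depends on
-- `n` and `d` alone.
set_option maxRecDepth 20000 in
theorem Cmd.bounds_solve :
    ∀ g ∈ solve.bounds, g = 0 ∨ g = 1 ∨ g = 3 ∨ g = 4 ∨ g = 5 ∨ g = 6 := by decide

theorem mainTheorem2 :
    ∃ (P : Prog) (c : ℕ), ∀ d : ℕ, 1 ≤ d → ∃ K : ℕ,
      ∀ n : ℕ, 0 < n → Even n → ∀ (I : CSP d n) (t : ℤ),
        ∃ (T : ℕ) (s : RamState),
          Exec P (RamState.init (I.encode t)) T s ∧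
          T ≤ K * (I.size + n ^ (c * d)) ∧
          ((s.Shows [1] ∧ I.avg + (t : ℚ) ≤ (I.opt : ℚ)) ∨
            ∃ κ : Kernel n, s.Shows (0 :: κ.encode) ∧ κ.IsKernelOf I ∧
              (κ.vars.length : ℤ) ≤ (kernelConst d : ℤ) * t ^ 2) := by
  set a := Cmd.tables.size
  set b := Cmd.countPatterns.size
  set c := Cmd.solve.size
  refine ⟨kernelProgram, a + c, fun d hd => ⟨51 + a * (145 * 2 ^ d) ^ a + c * (145 * 2 ^ d) ^ c +
    (b * (2 ^ d + 1) ^ b + 4), fun n hn he I t => ?_⟩⟩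
  obtain ⟨s, w, ⟨T, hT, hE⟩, hs, h⟩ := kernelProgram_runs hd hn he I t
  refine ⟨T, s, hE, hT.trans ?_, ?_⟩
  · have hN : 1 ≤ (2 * n) ^ d := Nat.one_le_pow _ _ (by omega)
    have h0 : d ≤ (2 * n) ^ d := (Nat.lt_pow_self (show 1 < 2 * n by omega)).le
    have h1 : 2 * n ≤ (2 * n) ^ d := Nat.le_self_pow (by omega) _
    have h2 : 2 ^ d ≤ (2 * n) ^ d := Nat.pow_le_pow_left (by omega) d
    -- All loop bounds other than the number of constraints are at most `144 * (2 n) ^ d`, the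
    -- factor 144 because of name 6. The sizes of the fixed programs become the absolute constant in
    -- the exponent of `n`.
    have hX : ∀ k, (144 * (2 * n) ^ d + 1) ^ k ≤ (145 * 2 ^ d) ^ k * n ^ (k * d) := fun k => by
      rw [mul_comm k d, pow_mul, ← mul_pow]
      refine Nat.pow_le_pow_left ?_ k
      rw [mul_assoc, ← mul_pow]
      omega
    have hb : ∀ g, g = 0 ∨ g = 1 ∨ g = 3 ∨ g = 4 ∨ g = 5 ∨ g = 6 →
        finalGlobals d n I.size g ≤ (144 * (2 * n) ^ d : ℕ) := by
      rintro g (rfl | rfl | rfl | rfl | rfl | rfl) <;> simp only [finalGlobals] <;> norm_cast <;> omega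
    have ht := Cmd.tables.time_le (firstGlobals d n I.size) (144 * (2 * n) ^ d) fun g hg => by
      rcases Cmd.bounds_tables g hg with rfl | rfl
      · exact hb 0 (by norm_num)
      · exact hb 3 (by norm_num)
    have hp : _ ≤ b * (2 ^ d + 1) ^ b := Cmd.countPatterns.time_le (finalGlobals d n I.size) (2 ^ d) fun g hg => by
      rcases Cmd.bounds_countPatterns g hg with rfl | rfl
      · simp only [finalGlobals]
        exact_mod_cast Nat.lt_two_pow_self.le
      · exact le_rfl
    have hf := Cmd.solve.time_le (finalGlobals d n I.size) (144 * (2 * n) ^ d) fun g hg =>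
      hb g (Cmd.bounds_solve g hg)
    have ha : n ^ (a * d) ≤ n ^ ((a + c) * d) :=
      Nat.pow_le_pow_right hn (Nat.mul_le_mul_right _ (Nat.le_add_right _ _))
    have hc : n ^ (c * d) ≤ n ^ ((a + c) * d) :=
      Nat.pow_le_pow_right hn (Nat.mul_le_mul_right _ (Nat.le_add_left _ _))
    have h1' : 1 ≤ n ^ ((a + c) * d) := Nat.one_le_pow _ _ hn
    set Y := n ^ ((a + c) * d)
    have ht' := ht.trans (Nat.mul_le_mul_left a ((hX a).trans (Nat.mul_le_mul_left _ ha)))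
    have hf' := hf.trans (Nat.mul_le_mul_left c ((hX c).trans (Nat.mul_le_mul_left _ hc)))
    have hp' := Nat.mul_le_mul_left I.size (Nat.add_le_add_right hp 4)
    rw [← mul_assoc] at ht' hf'
    calc _ ≤ 51 * Y + a * (145 * 2 ^ d) ^ a * Y + I.size * (b * (2 ^ d + 1) ^ b + 4) +
          c * (145 * 2 ^ d) ^ c * Y := by omega
      _ ≤ _ := by
        generalize a * (145 * 2 ^ d) ^ a = A
        generalize c * (145 * 2 ^ d) ^ c = C
        generalize b * (2 ^ d + 1) ^ b + 4 = B
        rw [mul_add, add_mul, add_mul, add_mul, add_mul, add_mul, add_mul]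
        have := Nat.mul_comm I.size B
        have := Nat.zero_le (B * Y)
        have := Nat.zero_le (A * I.size)
        have := Nat.zero_le (C * I.size)
        omega
  · rcases h with ⟨rfl, h⟩ | ⟨κ, rfl, h⟩
    · exact Or.inl ⟨hs, h⟩
    · exact Or.inr ⟨κ, hs, h⟩
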